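/- **Setting.** Let $A$ be a unital $*$-algebra over $\mathbb C$ and let $(\Omega^1,\mathrm d)$ be a $*$-differential calculus on $A$: an $A$-bimodule $\Omega^1$, a linear map $\mathrm d:A\to\Omega^1$ with $\mathrm d(ab)=(\mathrm da)b+a\,\mathrm db$ and $\Omega^1=\mathrm{span}\{a\,\mathrm db\}$, and an antilinear map $*:\Omega^1\to\Omega^1$ with $\mathrm d(a^*)=(\mathrm da)^*$ and $(a\omega b)^*=b^*\omega^*a^*$. Assume that $\Omega^1$ is finitely generated projective as a left and as a right $A$-module. Let $\mathfrak X^R=\mathrm{Hom}_A(\Omega^1,A)$ (right $A$-linear maps), $\mathrm{ev}^L(x,\omega)=x(\omega)$, and $\mathfrak X^L={}_A\mathrm{Hom}(\Omega^1,A)$ (left $A$-linear maps), $\mathrm{ev}^R(\omega,y)=y(\omega)$, with the $A$-bimodule structures $(axb)(\omega)=a\,x(b\omega)$ and $(byc)(\omega)=y(\omega b)\,c$. Let $\sum_i\omega_i\otimes x_i$ and $\sum_j y_j\otimes\eta_j$ come from dual bases, i.e. $\omega=\sum_i\omega_i\,\mathrm{ev}^L(x_i,\omega)=\sum_j\mathrm{ev}^R(\omega,y_j)\,\eta_j$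 for all $\omega\in\Omega^1$; sums over $i$ and $j$ are implicit below. Define $\circledast:\mathfrak X^R\to\mathfrak X^L$ by $\mathrm{ev}^R(\omega,x^\circledast)=\mathrm{ev}^L(x,\omega^*)^*$; its inverse is given by $\mathrm{ev}^L(y^{\circledast^{-1}},\omega)=\mathrm{ev}^R(\omega^*,y)^*$. **Bialgebroids.** A left $A$-bialgebroid is an algebra $\mathcal L$ with an algebra map $s_L:A\to\mathcal L$ and an antialgebra map $t_L:A\to\mathcal L$ with commuting images, and an $A$-coring structure $(\Delta_L,\varepsilon_L)$ for the bimodule structure $a.X.b=s_L(a)t_L(b)X$, such that $\Delta_L$ is a unital multiplicative map into $\{X\otimes Y\in\mathcal L\otimes_A\mathcal L: Xt_L(a)\otimes Y=X\otimes Ys_L(a)\ \forall a\}$, $\varepsilon_L(1)=1$ and $\varepsilon_L(XY)=\varepsilon_L(Xs_L(\varepsilon_L(Y)))=\varepsilon_L(Xt_L(\varepsilon_L(Y)))$. A right $A$-bialgebroid $\mathcal R$ is the same with $a.X.b=X\,t_R(a)s_R(b)$, with $\Delta_R$ landing in $\{X\otimes Y: s_R(a)X\otimes Y=X\otimes t_R(a)Y\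 \forall a\}$, and with $\varepsilon_R(XY)=\varepsilon_R(s_R(\varepsilon_R(X))Y)=\varepsilon_R(t_R(\varepsilon_R(X))Y)$. A $*$-bialgebroid pair is a left and a right $A$-bialgebroid $(\mathcal L,\mathcal R)$ with * an invertible antilinear unital antialgebra map $\circledast:\mathcal L\to\mathcal R$ such that $s_L(a)^\circledast=s_R(a^*)$, $t_L(a)^\circledast=t_R(a^*)$, $\mathrm{flip}(\circledast\otimes\circledast)\Delta_L(X)=\Delta_R(X^\circledast)$, $\varepsilon_R(X^\circledast)=\varepsilon_L(X)^*$; * an invertible linear unital antialgebra map $\Phi:\mathcal L\to\mathcal R$ such that $\Phi\circ s_L=t_R$, $\Phi\circ t_L=s_R$, $(\Phi\otimes\Phi)\Delta_L=\Delta_R\Phi$, $\varepsilon_R\Phi=\varepsilon_L$; * $\Phi^{-1}\circ\circledast=\circledast^{-1}\circ\Phi$. **The algebra $\mathcal{IL}(\Omega^1)$** is generated by commuting copies of $A$ (elements $a=s_L(a)$) and $A^{op}$ (elements $\underline a=t_L(a)$), by $x\in\mathfrak X^R$ (linearly), and by $(x,\xi)$ and $(\xi,y)$ for $x\in\mathfrak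 X^R$, $\xi\in\Omega^1$, $y\in\mathfrak X^L$ (bilinearly over $\mathbb C$), with relations $$a(x,\xi)=(ax,\xi),\quad (x,\xi)a=(xa,\xi),\quad \underline a(x,\xi)=(x,\xi a),\quad (x,\xi)\underline a=(x,a\xi),$$ $$a(\xi,y)=(a\xi,y),\quad (\xi,y)a=(\xi a,y),\quad \underline a(\xi,y)=(\xi,ya),\quad (\xi,y)\underline a=(\xi,ay),$$ $$a\bullet x=ax,\quad x\bullet a=xa+\mathrm{ev}^L(x,\mathrm da),\quad x\bullet\underline a=\underline a\bullet x+(x,\mathrm da),$$ $$(\omega_i,y)(x_i,\xi)=\underline{\mathrm{ev}^R(\xi,y)},\quad (x,\eta_j)(\xi,y_j)=\mathrm{ev}^L(x,\xi).$$ **The algebra $\mathcal{IR}(\Omega^1)$** is generated by commuting copies of $A$ (elements $a=s_R(a)$) and $A^{op}$ (elements $\underline a=t_R(a)$), by $y\in\mathfrak X^L$, and by $(\xi,y)$ and $(x,\xi)$, with the same linearity and relations $$a(\xi,y)=(\xi,ay),\quad (\xi,y)a=(\xi,ya),\quad \underline a(\xi,y)=(\xi a,y),\quad (\xi,y)\underline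 a=(a\xi,y),$$ $$a(x,\xi)=(x,a\xi),\quad (x,\xi)a=(x,\xi a),\quad \underline a(x,\xi)=(xa,\xi),\quad (x,\xi)\underline a=(ax,\xi),$$ $$y\bullet a=ya,\quad a\bullet y=ay+\mathrm{ev}^R(\mathrm da,y),\quad \underline a\bullet y=y\bullet\underline a+(\mathrm da,y),$$ $$(x_i,\xi)(\omega_i,y)=\mathrm{ev}^R(\xi,y),\quad (\xi,y_j)(x,\eta_j)=\underline{\mathrm{ev}^L(x,\xi)}.$$ **Theorem.** $\mathcal{IL}(\Omega^1)$ is a left $A$-bialgebroid with $$\Delta_L(a)=a\otimes1,\ \Delta_L(\underline a)=1\otimes\underline a,\ \Delta_L(x)=x\otimes1+(x,\omega_i)\otimes x_i,\ \Delta_L(x,\xi)=(x,\omega_i)\otimes(x_i,\xi),\ \Delta_L(\xi,y)=(\xi,y_j)\otimes(\eta_j,y),$$ $$\varepsilon_L(a)=\varepsilon_L(\underline a)=a,\quad\varepsilon_L(x)=0,\quad\varepsilon_L(x,\xi)=\mathrm{ev}^L(x,\xi),\quad\varepsilon_L(\xi,y)=\mathrm{ev}^R(\xi,y),$$ $\mathcal{IR}(\Omega^1)$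 is a right $A$-bialgebroid with $$\Delta_R(a)=1\otimes a,\ \Delta_R(\underline a)=\underline a\otimes1,\ \Delta_R(y)=1\otimes y+y_j\otimes(\eta_j,y),\ \Delta_R(\xi,y)=(\xi,y_j)\otimes(\eta_j,y),\ \Delta_R(x,\xi)=(x,\omega_i)\otimes(x_i,\xi),$$ $$\varepsilon_R(a)=\varepsilon_R(\underline a)=a,\quad\varepsilon_R(y)=0,\quad\varepsilon_R(\xi,y)=\mathrm{ev}^R(\xi,y),\quad\varepsilon_R(x,\xi)=\mathrm{ev}^L(x,\xi),$$ and $(\mathcal{IL}(\Omega^1),\mathcal{IR}(\Omega^1))$ is a $*$-bialgebroid pair with $$a^\circledast=a^*,\quad\underline a^\circledast=\underline{a^*},\quad x\mapsto x^\circledast,\quad(\underline a\bullet x)^\circledast=x^\circledast\bullet\underline{a^*},\quad(x,\xi)^\circledast=(\xi^*,x^\circledast),\quad(\xi,y)^\circledast=(y^{\circledast^{-1}},\xi^*),$$ $$\Phi(x,\xi)=(x,\xi),\quad\Phi(\xi,y)=(\xi,y),\quad\Phi((\omega_i,y)\bullet x_i)=y,\quad\Phi(x)=y_j\bullet(x,\eta_j),\quad\Phi(a\underline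 b)=\underline a\,b.$$ -/

import Mathlib

open scoped TensorProduct
open MulOpposite (op)

noncomputable section

namespace StarBialgebroid

universe u v w

/-! ## Balanced tensor products and corings over a noncommutative base -/

section Coring

variable {k : Type u} {A : Type v} {C : Type w} [CommRing k] [Ring A] [Algebra k A]
  [AddCommGroup C] [Module k C]

/-- The relations `c.a ⊗ c' = c ⊗ a.c'` defining `C ⊗_A C`, where the left `A`-action on `C` is
`l` and the right `A`-action on `C` is `r`. -/
def balancing (l r : A → C →ₗ[k] C) : Submodule k (C ⊗[k] C) :=
  Submodule.span k {z | ∃ (a : A) (c c' : C), z = r a c ⊗ₜ[k] c' - c ⊗ₜ[k] l a c'}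

/-- The tensor product `C ⊗_A C` of the `A`-bimodule `C` (left action `l`, right action `r`). -/
abbrev Balanced (l r : A → C →ₗ[k] C) : Type w := (C ⊗[k] C) ⧸ balancing l r

/-- The class `c ⊗ c' ↦ c ⊗_A c'`. -/
abbrev Balanced.mk (l r : A → C →ₗ[k] C) : C ⊗[k] C →ₗ[k] Balanced l r := (balancing l r).mkQ

/-- The relations defining `C ⊗_A C ⊗_A C`. -/
def balancing₃ (l r : A → C →ₗ[k] C) : Submodule k (C ⊗[k] (C ⊗[k] C)) :=
  Submodule.span k
    ({z | ∃ (a : A) (c c' c'' : C),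
        z = r a c ⊗ₜ[k] (c' ⊗ₜ[k] c'') - c ⊗ₜ[k] (l a c' ⊗ₜ[k] c'')} ∪
     {z | ∃ (a : A) (c c' c'' : C),
        z = c ⊗ₜ[k] (r a c' ⊗ₜ[k] c'') - c ⊗ₜ[k] (c' ⊗ₜ[k] l a c'')})

/-- The triple tensor product `C ⊗_A C ⊗_A C`. -/
abbrev Balanced₃ (l r : A → C →ₗ[k] C) : Type w :=
  (C ⊗[k] (C ⊗[k] C)) ⧸ balancing₃ l r

/-- The canonical map `(C ⊗_A C) ⊗ C → C ⊗_A C ⊗_A C`. -/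
def joinLeft (l r : A → C →ₗ[k] C) : Balanced l r ⊗[k] C →ₗ[k] Balanced₃ l r :=
  TensorProduct.lift <| (balancing l r).liftQ
    (TensorProduct.curry ((balancing₃ l r).mkQ ∘ₗ (TensorProduct.assoc k C C C).toLinearMap)) <| by
      rw [balancing, Submodule.span_le]
      rintro _ ⟨a, c, c', rfl⟩
      simp only [SetLike.mem_coe, LinearMap.mem_ker]
      ext c''
      simp only [map_sub, LinearMap.sub_apply, TensorProduct.curry_apply, LinearMap.comp_apply,
        LinearEquiv.coe_coe, TensorProduct.assoc_tmul, LinearMap.zero_apply]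
      rw [← map_sub, Submodule.mkQ_apply, Submodule.Quotient.mk_eq_zero]
      exact Submodule.subset_span (Or.inl ⟨a, c, c', c'', rfl⟩)

/-- The canonical map `C ⊗ (C ⊗_A C) → C ⊗_A C ⊗_A C`. -/
def joinRight (l r : A → C →ₗ[k] C) : C ⊗[k] Balanced l r →ₗ[k] Balanced₃ l r :=
  TensorProduct.lift <| LinearMap.flip <| (balancing l r).liftQ
    (LinearMap.flip (TensorProduct.curry (balancing₃ l r).mkQ)) <| by
      rw [balancing, Submodule.span_le]
      rintro _ ⟨a, c', c'', rfl⟩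
      simp only [SetLike.mem_coe, LinearMap.mem_ker]
      ext c
      simp only [map_sub, LinearMap.sub_apply, LinearMap.flip_apply, TensorProduct.curry_apply,
        LinearMap.zero_apply]
      rw [← map_sub, Submodule.mkQ_apply, Submodule.Quotient.mk_eq_zero]
      exact Submodule.subset_span (Or.inr ⟨a, c, c', c'', rfl⟩)

/-- `(Δ, ε)` makes the `A`-bimodule `C` (left action `l`, right action `r`) an `A`-coring:
`Δ` and `ε` are `A`-bimodule maps, `Δ` is coassociative and `ε` is a counit.
Maps out of `C ⊗_A C` are evaluated on arbitrary representatives `u ∈ C ⊗ C` of `Δ c`. -/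
structure IsCoring (l r : A → C →ₗ[k] C) (Δ : C →ₗ[k] Balanced l r) (ε : C →ₗ[k] A) : Prop where
  comul_left : ∀ (a : A) (c : C) (u : C ⊗[k] C), Balanced.mk l r u = Δ c →
    Δ (l a c) = Balanced.mk l r (TensorProduct.map (l a) LinearMap.id u)
  comul_right : ∀ (a : A) (c : C) (u : C ⊗[k] C), Balanced.mk l r u = Δ c →
    Δ (r a c) = Balanced.mk l r (TensorProduct.map LinearMap.id (r a) u)
  counit_left : ∀ (a : A) (c : C), ε (l a c) = a * ε c
  counit_right : ∀ (a : A) (c : C), ε (r a c) = ε c * a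
  /-- `(Δ ⊗ id) Δ = (id ⊗ Δ) Δ` in `C ⊗_A C ⊗_A C`. -/
  coassoc : ∀ (c : C) (u : C ⊗[k] C), Balanced.mk l r u = Δ c →
    joinLeft l r (TensorProduct.map Δ LinearMap.id u) =
      joinRight l r (TensorProduct.map LinearMap.id Δ u)
  /-- `ε(c₁).c₂ = c`; the sum over the legs is written through `u = ∑ p ⊗ q`. -/
  counit_comul : ∀ (c : C) (n : ℕ) (p q : Fin n → C),
    Balanced.mk l r (∑ i, p i ⊗ₜ[k] q i) = Δ c → ∑ i, l (ε (p i)) (q i) = c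
  /-- `c₁.ε(c₂) = c`. -/
  comul_counit : ∀ (c : C) (n : ℕ) (p q : Fin n → C),
    Balanced.mk l r (∑ i, p i ⊗ₜ[k] q i) = Δ c → ∑ i, r (ε (q i)) (p i) = c

end Coring

/-! ## Left and right bialgebroids -/

section Bialgebroid

variable {k : Type u} {A : Type v} {L : Type w} [CommRing k] [Ring A] [Algebra k A]
  [Ring L] [Algebra k L]

/-- Left multiplication by `s a`: the left `A`-action `a.X = s(a)X` on a left bialgebroid. -/
abbrev leftL (s : A →ₐ[k] L) (a : A) : L →ₗ[k] L := LinearMap.mulLeft k (s a)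

/-- Left multiplication by `t a`: the right `A`-action `X.a = t(a)X` on a left bialgebroid. -/
abbrev leftR (t : Aᵐᵒᵖ →ₐ[k] L) (a : A) : L →ₗ[k] L := LinearMap.mulLeft k (t (op a))

/-- Right multiplication by `t a`: the left `A`-action `a.X = Xt(a)` on a right bialgebroid. -/
abbrev rightL (t : Aᵐᵒᵖ →ₐ[k] L) (a : A) : L →ₗ[k] L := LinearMap.mulRight k (t (op a))

/-- Right multiplication by `s a`: the right `A`-action `X.a = Xs(a)` on a right bialgebroid. -/
abbrev rightR (s : A →ₐ[k] L) (a : A) : L →ₗ[k] L := LinearMap.mulRight k (s a)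

/-- A left `A`-bialgebroid structure on the algebra `L` with source `s` and target `t`
(an antialgebra map `A → L`, written as an algebra map on `Aᵐᵒᵖ`). -/
structure LeftBialgebroid (s : A →ₐ[k] L) (t : Aᵐᵒᵖ →ₐ[k] L) where
  comm : ∀ a b : A, s a * t (op b) = t (op b) * s a
  Δ : L →ₗ[k] Balanced (leftL s) (leftR t)
  ε : L →ₗ[k] A
  isCoring : IsCoring (leftL s) (leftR t) Δ ε
  /-- The image of `Δ` lies in the Takeuchi product: `X₁ t(a) ⊗ X₂ = X₁ ⊗ X₂ s(a)`. -/
  takeuchi : ∀ (X : L) (u : L ⊗[k] L), Balanced.mk (leftL s) (leftR t) u = Δ X → ∀ a : A,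
    Balanced.mk (leftL s) (leftR t) (u * (t (op a) ⊗ₜ[k] 1)) =
      Balanced.mk (leftL s) (leftR t) (u * (1 ⊗ₜ[k] s a))
  comul_one : Δ 1 = Balanced.mk (leftL s) (leftR t) (1 ⊗ₜ[k] 1)
  /-- `Δ(XY) = X₁Y₁ ⊗ X₂Y₂`. -/
  comul_mul : ∀ (X Y : L) (u w : L ⊗[k] L), Balanced.mk (leftL s) (leftR t) u = Δ X →
    Balanced.mk (leftL s) (leftR t) w = Δ Y →
      Δ (X * Y) = Balanced.mk (leftL s) (leftR t) (u * w)
  counit_one : ε 1 = 1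
  counit_mul_s : ∀ X Y : L, ε (X * Y) = ε (X * s (ε Y))
  counit_mul_t : ∀ X Y : L, ε (X * Y) = ε (X * t (op (ε Y)))

/-- A right `A`-bialgebroid structure on the algebra `L` with source `s` and target `t`. -/
structure RightBialgebroid (s : A →ₐ[k] L) (t : Aᵐᵒᵖ →ₐ[k] L) where
  comm : ∀ a b : A, s a * t (op b) = t (op b) * s a
  Δ : L →ₗ[k] Balanced (rightL t) (rightR s)
  ε : L →ₗ[k] A
  isCoring : IsCoring (rightL t) (rightR s) Δ ε
  /-- The image of `Δ` lies in the Takeuchi product: `s(a) X₁ ⊗ X₂ = X₁ ⊗ t(a) X₂`. -/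
  takeuchi : ∀ (X : L) (u : L ⊗[k] L), Balanced.mk (rightL t) (rightR s) u = Δ X → ∀ a : A,
    Balanced.mk (rightL t) (rightR s) ((s a ⊗ₜ[k] 1) * u) =
      Balanced.mk (rightL t) (rightR s) ((1 ⊗ₜ[k] t (op a)) * u)
  comul_one : Δ 1 = Balanced.mk (rightL t) (rightR s) (1 ⊗ₜ[k] 1)
  /-- `Δ(XY) = X₁Y₁ ⊗ X₂Y₂`. -/
  comul_mul : ∀ (X Y : L) (u w : L ⊗[k] L), Balanced.mk (rightL t) (rightR s) u = Δ X →
    Balanced.mk (rightL t) (rightR s) w = Δ Y →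
      Δ (X * Y) = Balanced.mk (rightL t) (rightR s) (u * w)
  counit_one : ε 1 = 1
  counit_mul_s : ∀ X Y : L, ε (X * Y) = ε (s (ε X) * Y)
  counit_mul_t : ∀ X Y : L, ε (X * Y) = ε (t (op (ε X)) * Y)

end Bialgebroid

/-! ## Star-bialgebroid pairs -/

section Pair

variable {A : Type u} {L : Type v} {R : Type w} [Ring A] [StarRing A] [Algebra ℂ A]
  [Ring L] [Algebra ℂ L] [Ring R] [Algebra ℂ R]
  {sL : A →ₐ[ℂ] L} {tL : Aᵐᵒᵖ →ₐ[ℂ] L} {sR : A →ₐ[ℂ] R} {tR : Aᵐᵒᵖ →ₐ[ℂ] R}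

/-- `flip ∘ (f ⊗ f)` for an antilinear `f`. -/
def flipStar (f : L →ₗ⋆[ℂ] R) : L ⊗[ℂ] L →ₗ⋆[ℂ] R ⊗[ℂ] R :=
  (TensorProduct.comm ℂ R R).toLinearMap.comp (TensorProduct.map f f)

/-- `(𝓛, 𝓡)` are `*`-related by the invertible antilinear antialgebra and anticoalgebra map
`f = ⊛`. -/
structure IsStarRelated (𝓛 : LeftBialgebroid sL tL) (𝓡 : RightBialgebroid sR tR)
    (f : L ≃ₗ⋆[ℂ] R) : Prop where
  map_one : f 1 = 1
  map_mul : ∀ X Y : L, f (X * Y) = f Y * f X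
  map_s : ∀ a : A, f (sL a) = sR (star a)
  map_t : ∀ a : A, f (tL (op a)) = tR (op (star a))
  /-- `flip (⊛ ⊗ ⊛) Δ_L(X) = Δ_R(X^⊛)`. -/
  comul : ∀ (X : L) (u : L ⊗[ℂ] L), Balanced.mk (leftL sL) (leftR tL) u = 𝓛.Δ X →
    Balanced.mk (rightL tR) (rightR sR) (flipStar f.toLinearMap u) = 𝓡.Δ (f X)
  counit : ∀ X : L, 𝓡.ε (f X) = star (𝓛.ε X)

/-- `(𝓛, 𝓡)` is reflexive by the invertible linear antialgebra and coalgebra map `Φ`. -/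
structure IsReflexive (𝓛 : LeftBialgebroid sL tL) (𝓡 : RightBialgebroid sR tR)
    (Φ : L ≃ₗ[ℂ] R) : Prop where
  map_one : Φ 1 = 1
  map_mul : ∀ X Y : L, Φ (X * Y) = Φ Y * Φ X
  map_s : ∀ a : A, Φ (sL a) = tR (op a)
  map_t : ∀ a : A, Φ (tL (op a)) = sR a
  /-- `(Φ ⊗ Φ) Δ_L(X) = Δ_R(Φ X)`. -/
  comul : ∀ (X : L) (u : L ⊗[ℂ] L), Balanced.mk (leftL sL) (leftR tL) u = 𝓛.Δ X →
    Balanced.mk (rightL tR) (rightR sR) (TensorProduct.map Φ.toLinearMap Φ.toLinearMap u) =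
      𝓡.Δ (Φ X)
  counit : ∀ X : L, 𝓡.ε (Φ X) = 𝓛.ε X

/-- `(𝓛, 𝓡)` is a `*`-bialgebroid pair by means of `f = ⊛` and `Φ`. -/
structure IsStarBialgebroidPair (𝓛 : LeftBialgebroid sL tL) (𝓡 : RightBialgebroid sR tR)
    (f : L ≃ₗ⋆[ℂ] R) (Φ : L ≃ₗ[ℂ] R) : Prop where
  starRelated : IsStarRelated 𝓛 𝓡 f
  reflexive : IsReflexive 𝓛 𝓡 Φ
  /-- `Φ⁻¹ ∘ ⊛ = ⊛⁻¹ ∘ Φ`. -/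
  compat : ∀ X : L, Φ.symm (f X) = f.symm (Φ X)

end Pair

/-! ## Differential calculi and vector fields

An `A`-bimodule is a left `A`-module that is also a left `Aᵐᵒᵖ`-module, with commuting actions;
`op a • ω` is `ω a`. -/

section Calculus

/-- A first order differential calculus `(Ω, d)` on the `k`-algebra `A`. -/
structure FODC (k : Type u) (A : Type v) (Ω : Type w) [CommRing k] [Ring A] [Algebra k A]
    [AddCommGroup Ω] [Module k Ω] [Module A Ω] [Module Aᵐᵒᵖ Ω] where
  d : A →ₗ[k] Ω
  leibniz : ∀ a b : A, d (a * b) = op b • d a + a • d b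
  span_eq_top : Submodule.span k {ω : Ω | ∃ a b : A, ω = a • d b} = ⊤

/-- A `*`-differential calculus on the `*`-algebra `A`; `st` is `*` on `Ω`. (That `st` is an
involution follows, since the `a • d b` span.) -/
structure StarFODC (A : Type v) (Ω : Type w) [Ring A] [StarRing A] [Algebra ℂ A]
    [AddCommGroup Ω] [Module ℂ Ω] [Module A Ω] [Module Aᵐᵒᵖ Ω] extends FODC ℂ A Ω where
  st : Ω →ₗ⋆[ℂ] Ω
  d_star : ∀ a : A, d (star a) = st (d a)
  st_smul : ∀ (a b : A) (ω : Ω), st (a • op b • ω) = star b • op (star a) • st ω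

variable (A : Type v) (Ω : Type w) [Ring A] [AddCommGroup Ω] [Module A Ω] [Module Aᵐᵒᵖ Ω]

/-- Right vector fields `𝔛^R = Hom_A(Ω, A)` (right `A`-linear maps); `ev^L(x, ω) = x ω`. -/
abbrev RightVF : Type (max v w) := Ω →ₗ[Aᵐᵒᵖ] A

/-- Left vector fields `𝔛^L = _A Hom(Ω, A)` (left `A`-linear maps); `ev^R(ω, y) = y ω`. -/
abbrev LeftVF : Type (max v w) := Ω →ₗ[A] A

/-- A coevaluation `coev^L(1) = ∑ ω_i ⊗ x_i`: a finite dual basis of the right module `Ω`. -/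
structure RightDualBasis where
  n : ℕ
  ω : Fin n → Ω
  x : Fin n → RightVF A Ω
  sum_eq : ∀ ξ : Ω, ∑ i, op (x i ξ) • ω i = ξ

/-- A coevaluation `coev^R(1) = ∑ y_j ⊗ η_j`: a finite dual basis of the left module `Ω`. -/
structure LeftDualBasis where
  n : ℕ
  y : Fin n → LeftVF A Ω
  η : Fin n → Ω
  sum_eq : ∀ ξ : Ω, ∑ j, y j ξ • η j = ξ

variable {A Ω} [SMulCommClass A Aᵐᵒᵖ Ω]

/-- `a x`, where `ev^L(a x, ω) = a ev^L(x, ω)`. -/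
def RightVF.lact (a : A) (x : RightVF A Ω) : RightVF A Ω where
  toFun ω := a * x ω
  map_add' ω ω' := by rw [map_add, mul_add]
  map_smul' b ω := by simp [mul_assoc]

/-- `x b`, where `ev^L(x b, ω) = ev^L(x, b ω)`. -/
def RightVF.ract (x : RightVF A Ω) (b : A) : RightVF A Ω where
  toFun ω := x (b • ω)
  map_add' ω ω' := by rw [smul_add, map_add]
  map_smul' c ω := by simp [smul_comm b c ω]

/-- `b y`, where `ev^R(ω, b y) = ev^R(ω b, y)`. -/
def LeftVF.lact (b : A) (y : LeftVF A Ω) : LeftVF A Ω where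
  toFun ω := y (op b • ω)
  map_add' ω ω' := by rw [smul_add, map_add]
  map_smul' c ω := by simp [← smul_comm c (op b) ω]

/-- `y c`, where `ev^R(ω, y c) = ev^R(ω, y) c`. -/
def LeftVF.ract (y : LeftVF A Ω) (c : A) : LeftVF A Ω where
  toFun ω := y ω * c
  map_add' ω ω' := by rw [map_add, add_mul]
  map_smul' a ω := by simp [mul_assoc]

end Calculus

section StarVF

variable {A : Type v} {Ω : Type w} [Ring A] [StarRing A] [Algebra ℂ A]
  [AddCommGroup Ω] [Module ℂ Ω] [Module A Ω] [Module Aᵐᵒᵖ Ω]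

/-- `⊛ : 𝔛^R → 𝔛^L`, `ev^R(ω, x^⊛) = ev^L(x, ω^*)^*`. -/
def StarFODC.starR (D : StarFODC A Ω) (x : RightVF A Ω) : LeftVF A Ω where
  toFun ω := star (x (D.st ω))
  map_add' ω ω' := by rw [map_add, map_add, star_add]
  map_smul' a ω := by
    have h : D.st (a • ω) = op (star a) • D.st ω := by
      have := D.st_smul a 1 ω
      simpa using this
    simp [h]

/-- `⊛⁻¹ : 𝔛^L → 𝔛^R`, `ev^L(y^{⊛⁻¹}, ω) = ev^R(ω^*, y)^*`. -/
def StarFODC.starL (D : StarFODC A Ω) (y : LeftVF A Ω) : RightVF A Ω where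
  toFun ω := star (y (D.st ω))
  map_add' ω ω' := by rw [map_add, map_add, star_add]
  map_smul' a ω := by
    have h : D.st (a • ω) = star a.unop • D.st ω := by
      have := D.st_smul 1 a.unop ω
      simpa using this
    simp [h]

end StarVF

/-! ## The algebras `IL(Ω)` and `IR(Ω)` -/

/-- The generators of `IL(Ω)`: `a ∈ A`, `a̲ ∈ A^op`, `x ∈ 𝔛^R`, `(x, ξ)` and `(ξ, y)`. -/
inductive ILGen (A : Type v) (Ω : Type w) [Ring A] [AddCommGroup Ω] [Module A Ω]
    [Module Aᵐᵒᵖ Ω] : Type (max v w) where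
  | src (a : A)
  | tgt (a : A)
  | vec (x : RightVF A Ω)
  | mat (x : RightVF A Ω) (ξ : Ω)
  | inv (ξ : Ω) (y : LeftVF A Ω)

/-- The generators of `IR(Ω)`: `a ∈ A`, `a̲ ∈ A^op`, `y ∈ 𝔛^L`, `(ξ, y)` and `(x, ξ)`. -/
inductive IRGen (A : Type v) (Ω : Type w) [Ring A] [AddCommGroup Ω] [Module A Ω]
    [Module Aᵐᵒᵖ Ω] : Type (max v w) where
  | src (a : A)
  | tgt (a : A)
  | vec (y : LeftVF A Ω)
  | mat (ξ : Ω) (y : LeftVF A Ω)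
  | inv (x : RightVF A Ω) (ξ : Ω)

section Algebras

variable {k : Type u} {A : Type v} {Ω : Type w} [CommRing k] [Ring A] [Algebra k A]
  [AddCommGroup Ω] [Module k Ω] [Module A Ω] [Module Aᵐᵒᵖ Ω] [SMulCommClass A Aᵐᵒᵖ Ω]

/-- The defining relations of `IL(Ω)`. The relations `p_mul_m` and `m_mul_p` are imposed for all
dual bases; modulo the other relations their left sides depend only on `coev^L(1)` and
`coev^R(1)`, so that imposing them for one dual basis on each side is the same. Notation: a family `s, t, v, m, p` of elements
`s a = a`, `t a = a̲`, `v x = x`, `m x ξ = (x, ξ)`, `p ξ y = (ξ, y)` of an algebra. -/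
inductive ILRel (D : FODC k A Ω) {F : Type*} [Ring F] [Algebra k F]
    (s t : A → F) (v : RightVF A Ω → F) (m : RightVF A Ω → Ω → F) (p : Ω → LeftVF A Ω → F) :
    F → F → Prop
  -- `A` and `A^op` are commuting subalgebras
  | s_add (a b : A) : ILRel D s t v m p (s (a + b)) (s a + s b)
  | s_mul (a b : A) : ILRel D s t v m p (s (a * b)) (s a * s b)
  | s_algebraMap (c : k) : ILRel D s t v m p (s (algebraMap k A c)) (algebraMap k F c)
  | t_add (a b : A) : ILRel D s t v m p (t (a + b)) (t a + t b)
  | t_mul (a b : A) : ILRel D s t v m p (t (a * b)) (t b * t a)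
  | t_algebraMap (c : k) : ILRel D s t v m p (t (algebraMap k A c)) (algebraMap k F c)
  | s_comm_t (a b : A) : ILRel D s t v m p (s a * t b) (t b * s a)
  -- linearity (homogeneity over `k` follows from the actions of `s` below)
  | v_add (x x' : RightVF A Ω) : ILRel D s t v m p (v (x + x')) (v x + v x')
  | m_add_left (x x' : RightVF A Ω) (ξ : Ω) :
      ILRel D s t v m p (m (x + x') ξ) (m x ξ + m x' ξ)
  | m_add_right (x : RightVF A Ω) (ξ ξ' : Ω) :
      ILRel D s t v m p (m x (ξ + ξ')) (m x ξ + m x ξ')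
  | p_add_left (ξ ξ' : Ω) (y : LeftVF A Ω) :
      ILRel D s t v m p (p (ξ + ξ') y) (p ξ y + p ξ' y)
  | p_add_right (ξ : Ω) (y y' : LeftVF A Ω) :
      ILRel D s t v m p (p ξ (y + y')) (p ξ y + p ξ y')
  -- `A^e`-bimodule structure of `𝔛^R ⊗ Ω`
  | s_mul_m (a : A) (x : RightVF A Ω) (ξ : Ω) : ILRel D s t v m p (s a * m x ξ) (m (x.lact a) ξ)
  | m_mul_s (a : A) (x : RightVF A Ω) (ξ : Ω) : ILRel D s t v m p (m x ξ * s a) (m (x.ract a) ξ)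
  | t_mul_m (a : A) (x : RightVF A Ω) (ξ : Ω) : ILRel D s t v m p (t a * m x ξ) (m x (op a • ξ))
  | m_mul_t (a : A) (x : RightVF A Ω) (ξ : Ω) : ILRel D s t v m p (m x ξ * t a) (m x (a • ξ))
  -- `A^e`-bimodule structure of `Ω ⊗ 𝔛^L`
  | s_mul_p (a : A) (ξ : Ω) (y : LeftVF A Ω) : ILRel D s t v m p (s a * p ξ y) (p (a • ξ) y)
  | p_mul_s (a : A) (ξ : Ω) (y : LeftVF A Ω) : ILRel D s t v m p (p ξ y * s a) (p (op a • ξ) y)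
  | t_mul_p (a : A) (ξ : Ω) (y : LeftVF A Ω) : ILRel D s t v m p (t a * p ξ y) (p ξ (y.ract a))
  | p_mul_t (a : A) (ξ : Ω) (y : LeftVF A Ω) : ILRel D s t v m p (p ξ y * t a) (p ξ (y.lact a))
  -- vector fields
  | s_mul_v (a : A) (x : RightVF A Ω) : ILRel D s t v m p (s a * v x) (v (x.lact a))
  | v_mul_s (a : A) (x : RightVF A Ω) :
      ILRel D s t v m p (v x * s a) (v (x.ract a) + s (x (D.d a)))
  | v_mul_t (a : A) (x : RightVF A Ω) :
      ILRel D s t v m p (v x * t a) (t a * v x + m x (D.d a))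
  -- `(ω_i, y)(x_i, ξ) = ev^R(ξ, y)̲` and `(x, η_j)(ξ, y_j) = ev^L(x, ξ)`
  | p_mul_m (B : RightDualBasis A Ω) (ξ : Ω) (y : LeftVF A Ω) :
      ILRel D s t v m p (∑ i, p (B.ω i) y * m (B.x i) ξ) (t (y ξ))
  | m_mul_p (B : LeftDualBasis A Ω) (ξ : Ω) (x : RightVF A Ω) :
      ILRel D s t v m p (∑ j, m x (B.η j) * p ξ (B.y j)) (s (x ξ))

/-- The defining relations of `IR(Ω)` (dual bases as for `IL(Ω)`). Notation: a family `s, t, v, m, p` of elements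
`s a = a`, `t a = a̲`, `v y = y`, `m ξ y = (ξ, y)`, `p x ξ = (x, ξ)` of an algebra. -/
inductive IRRel (D : FODC k A Ω) {F : Type*} [Ring F] [Algebra k F]
    (s t : A → F) (v : LeftVF A Ω → F) (m : Ω → LeftVF A Ω → F) (p : RightVF A Ω → Ω → F) :
    F → F → Prop
  -- `A` and `A^op` are commuting subalgebras
  | s_add (a b : A) : IRRel D s t v m p (s (a + b)) (s a + s b)
  | s_mul (a b : A) : IRRel D s t v m p (s (a * b)) (s a * s b)
  | s_algebraMap (c : k) : IRRel D s t v m p (s (algebraMap k A c)) (algebraMap k F c)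
  | t_add (a b : A) : IRRel D s t v m p (t (a + b)) (t a + t b)
  | t_mul (a b : A) : IRRel D s t v m p (t (a * b)) (t b * t a)
  | t_algebraMap (c : k) : IRRel D s t v m p (t (algebraMap k A c)) (algebraMap k F c)
  | s_comm_t (a b : A) : IRRel D s t v m p (s a * t b) (t b * s a)
  -- linearity (homogeneity over `k` follows from the actions of `s` below)
  | v_add (y y' : LeftVF A Ω) : IRRel D s t v m p (v (y + y')) (v y + v y')
  | m_add_left (ξ ξ' : Ω) (y : LeftVF A Ω) :
      IRRel D s t v m p (m (ξ + ξ') y) (m ξ y + m ξ' y)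
  | m_add_right (ξ : Ω) (y y' : LeftVF A Ω) :
      IRRel D s t v m p (m ξ (y + y')) (m ξ y + m ξ y')
  | p_add_left (x x' : RightVF A Ω) (ξ : Ω) :
      IRRel D s t v m p (p (x + x') ξ) (p x ξ + p x' ξ)
  | p_add_right (x : RightVF A Ω) (ξ ξ' : Ω) :
      IRRel D s t v m p (p x (ξ + ξ')) (p x ξ + p x ξ')
  -- `A^e`-bimodule structure of the generators `(ξ, y)`
  | s_mul_m (a : A) (ξ : Ω) (y : LeftVF A Ω) : IRRel D s t v m p (s a * m ξ y) (m ξ (y.lact a))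
  | m_mul_s (a : A) (ξ : Ω) (y : LeftVF A Ω) : IRRel D s t v m p (m ξ y * s a) (m ξ (y.ract a))
  | t_mul_m (a : A) (ξ : Ω) (y : LeftVF A Ω) : IRRel D s t v m p (t a * m ξ y) (m (op a • ξ) y)
  | m_mul_t (a : A) (ξ : Ω) (y : LeftVF A Ω) : IRRel D s t v m p (m ξ y * t a) (m (a • ξ) y)
  -- `A^e`-bimodule structure of the generators `(x, ξ)`
  | s_mul_p (a : A) (x : RightVF A Ω) (ξ : Ω) : IRRel D s t v m p (s a * p x ξ) (p x (a • ξ))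
  | p_mul_s (a : A) (x : RightVF A Ω) (ξ : Ω) : IRRel D s t v m p (p x ξ * s a) (p x (op a • ξ))
  | t_mul_p (a : A) (x : RightVF A Ω) (ξ : Ω) : IRRel D s t v m p (t a * p x ξ) (p (x.ract a) ξ)
  | p_mul_t (a : A) (x : RightVF A Ω) (ξ : Ω) : IRRel D s t v m p (p x ξ * t a) (p (x.lact a) ξ)
  -- vector fields
  | v_mul_s (a : A) (y : LeftVF A Ω) : IRRel D s t v m p (v y * s a) (v (y.ract a))
  | s_mul_v (a : A) (y : LeftVF A Ω) :
      IRRel D s t v m p (s a * v y) (v (y.lact a) + s (y (D.d a)))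
  | t_mul_v (a : A) (y : LeftVF A Ω) :
      IRRel D s t v m p (t a * v y) (v y * t a + m (D.d a) y)
  -- `(x_i, ξ)(ω_i, y) = ev^R(ξ, y)` and `(ξ, y_j)(x, η_j) = ev^L(x, ξ)̲`
  | p_mul_m (B : RightDualBasis A Ω) (ξ : Ω) (y : LeftVF A Ω) :
      IRRel D s t v m p (∑ i, p (B.x i) ξ * m (B.ω i) y) (s (y ξ))
  | m_mul_p (B : LeftDualBasis A Ω) (ξ : Ω) (x : RightVF A Ω) :
      IRRel D s t v m p (∑ j, m ξ (B.y j) * p x (B.η j)) (t (x ξ))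

/-- The relation on the free algebra that defines `IL(Ω)`. -/
def ILFreeRel (D : FODC k A Ω) :
    FreeAlgebra k (ILGen A Ω) → FreeAlgebra k (ILGen A Ω) → Prop :=
  ILRel D (fun a => FreeAlgebra.ι k (.src a)) (fun a => FreeAlgebra.ι k (.tgt a))
    (fun x => FreeAlgebra.ι k (.vec x)) (fun x ξ => FreeAlgebra.ι k (.mat x ξ))
    (fun ξ y => FreeAlgebra.ι k (.inv ξ y))

/-- The algebra `IL(Ω)`. -/
def IL (D : FODC k A Ω) : Type (max u v w) := RingQuot (ILFreeRel D)

instance (D : FODC k A Ω) : Ring (IL D) := inferInstanceAs (Ring (RingQuot (ILFreeRel D)))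

instance (D : FODC k A Ω) : Algebra k (IL D) :=
  inferInstanceAs (Algebra k (RingQuot (ILFreeRel D)))

/-- The quotient map from the free algebra. -/
def IL.proj (D : FODC k A Ω) : FreeAlgebra k (ILGen A Ω) →ₐ[k] IL D :=
  RingQuot.mkAlgHom k (ILFreeRel D)

theorem IL.proj_rel {D : FODC k A Ω} {z w : FreeAlgebra k (ILGen A Ω)} (h : ILFreeRel D z w) :
    IL.proj D z = IL.proj D w :=
  RingQuot.mkAlgHom_rel k h

/-- The generator `x` of `IL(Ω)`. -/
def IL.vec (D : FODC k A Ω) (x : RightVF A Ω) : IL D := IL.proj D (FreeAlgebra.ι k (.vec x))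

/-- The generator `(x, ξ)` of `IL(Ω)`. -/
def IL.mat (D : FODC k A Ω) (x : RightVF A Ω) (ξ : Ω) : IL D :=
  IL.proj D (FreeAlgebra.ι k (.mat x ξ))

/-- The generator `(ξ, y)` of `IL(Ω)`. -/
def IL.inv (D : FODC k A Ω) (ξ : Ω) (y : LeftVF A Ω) : IL D :=
  IL.proj D (FreeAlgebra.ι k (.inv ξ y))

/-- The source map `a ↦ a` of `IL(Ω)`. -/
def IL.s (D : FODC k A Ω) : A →ₐ[k] IL D where
  toFun a := IL.proj D (FreeAlgebra.ι k (.src a))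
  map_one' := by
    have := IL.proj_rel (D := D) (ILRel.s_algebraMap 1)
    simpa using this
  map_mul' a b := by
    have := IL.proj_rel (D := D) (ILRel.s_mul a b)
    simpa using this
  map_zero' := by
    have := IL.proj_rel (D := D) (ILRel.s_algebraMap 0)
    simpa using this
  map_add' a b := by
    have := IL.proj_rel (D := D) (ILRel.s_add a b)
    simpa using this
  commutes' c := by
    have := IL.proj_rel (D := D) (ILRel.s_algebraMap c)
    simpa using this

/-- The target map `a ↦ a̲` of `IL(Ω)`. -/
def IL.t (D : FODC k A Ω) : Aᵐᵒᵖ →ₐ[k] IL D where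
  toFun a := IL.proj D (FreeAlgebra.ι k (.tgt a.unop))
  map_one' := by
    have := IL.proj_rel (D := D) (ILRel.t_algebraMap 1)
    simpa using this
  map_mul' a b := by
    have := IL.proj_rel (D := D) (ILRel.t_mul b.unop a.unop)
    simpa using this
  map_zero' := by
    have := IL.proj_rel (D := D) (ILRel.t_algebraMap 0)
    simpa using this
  map_add' a b := by
    have := IL.proj_rel (D := D) (ILRel.t_add a.unop b.unop)
    simpa using this
  commutes' c := by
    have := IL.proj_rel (D := D) (ILRel.t_algebraMap c)
    simpa using this

/-- The relation on the free algebra that defines `IR(Ω)`. -/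
def IRFreeRel (D : FODC k A Ω) :
    FreeAlgebra k (IRGen A Ω) → FreeAlgebra k (IRGen A Ω) → Prop :=
  IRRel D (fun a => FreeAlgebra.ι k (.src a)) (fun a => FreeAlgebra.ι k (.tgt a))
    (fun y => FreeAlgebra.ι k (.vec y)) (fun ξ y => FreeAlgebra.ι k (.mat ξ y))
    (fun x ξ => FreeAlgebra.ι k (.inv x ξ))

/-- The algebra `IR(Ω)`. -/
def IR (D : FODC k A Ω) : Type (max u v w) := RingQuot (IRFreeRel D)

instance (D : FODC k A Ω) : Ring (IR D) := inferInstanceAs (Ring (RingQuot (IRFreeRel D)))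

instance (D : FODC k A Ω) : Algebra k (IR D) :=
  inferInstanceAs (Algebra k (RingQuot (IRFreeRel D)))

/-- The quotient map from the free algebra. -/
def IR.proj (D : FODC k A Ω) : FreeAlgebra k (IRGen A Ω) →ₐ[k] IR D :=
  RingQuot.mkAlgHom k (IRFreeRel D)

theorem IR.proj_rel {D : FODC k A Ω} {z w : FreeAlgebra k (IRGen A Ω)} (h : IRFreeRel D z w) :
    IR.proj D z = IR.proj D w :=
  RingQuot.mkAlgHom_rel k h

/-- The generator `y` of `IR(Ω)`. -/
def IR.vec (D : FODC k A Ω) (y : LeftVF A Ω) : IR D := IR.proj D (FreeAlgebra.ι k (.vec y))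

/-- The generator `(ξ, y)` of `IR(Ω)`. -/
def IR.mat (D : FODC k A Ω) (ξ : Ω) (y : LeftVF A Ω) : IR D :=
  IR.proj D (FreeAlgebra.ι k (.mat ξ y))

/-- The generator `(x, ξ)` of `IR(Ω)`. -/
def IR.inv (D : FODC k A Ω) (x : RightVF A Ω) (ξ : Ω) : IR D :=
  IR.proj D (FreeAlgebra.ι k (.inv x ξ))

/-- The source map `a ↦ a` of `IR(Ω)`. -/
def IR.s (D : FODC k A Ω) : A →ₐ[k] IR D where
  toFun a := IR.proj D (FreeAlgebra.ι k (.src a))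
  map_one' := by
    have := IR.proj_rel (D := D) (IRRel.s_algebraMap 1)
    simpa using this
  map_mul' a b := by
    have := IR.proj_rel (D := D) (IRRel.s_mul a b)
    simpa using this
  map_zero' := by
    have := IR.proj_rel (D := D) (IRRel.s_algebraMap 0)
    simpa using this
  map_add' a b := by
    have := IR.proj_rel (D := D) (IRRel.s_add a b)
    simpa using this
  commutes' c := by
    have := IR.proj_rel (D := D) (IRRel.s_algebraMap c)
    simpa using this

/-- The target map `a ↦ a̲` of `IR(Ω)`. -/
def IR.t (D : FODC k A Ω) : Aᵐᵒᵖ →ₐ[k] IR D where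
  toFun a := IR.proj D (FreeAlgebra.ι k (.tgt a.unop))
  map_one' := by
    have := IR.proj_rel (D := D) (IRRel.t_algebraMap 1)
    simpa using this
  map_mul' a b := by
    have := IR.proj_rel (D := D) (IRRel.t_mul b.unop a.unop)
    simpa using this
  map_zero' := by
    have := IR.proj_rel (D := D) (IRRel.t_algebraMap 0)
    simpa using this
  map_add' a b := by
    have := IR.proj_rel (D := D) (IRRel.t_add a.unop b.unop)
    simpa using this
  commutes' c := by
    have := IR.proj_rel (D := D) (IRRel.t_algebraMap c)
    simpa using this

/-! ## The bialgebroid structures on generators -/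

/-- The prescribed values on generators of the coproduct and counit of `IL(Ω)`. -/
structure IsGhobadiLeft (D : FODC k A Ω) (𝓛 : LeftBialgebroid (IL.s D) (IL.t D)) : Prop where
  comul_s : ∀ a : A, 𝓛.Δ (IL.s D a) = Balanced.mk _ _ (IL.s D a ⊗ₜ[k] 1)
  comul_t : ∀ a : A, 𝓛.Δ (IL.t D (op a)) = Balanced.mk _ _ (1 ⊗ₜ[k] IL.t D (op a))
  /-- `Δ_L(x) = x ⊗ 1 + (x, ω_i) ⊗ x_i`. -/
  comul_vec : ∀ (B : RightDualBasis A Ω) (x : RightVF A Ω), 𝓛.Δ (IL.vec D x) =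
    Balanced.mk _ _ (IL.vec D x ⊗ₜ[k] 1 + ∑ i, IL.mat D x (B.ω i) ⊗ₜ[k] IL.vec D (B.x i))
  /-- `Δ_L(x, ξ) = (x, ω_i) ⊗ (x_i, ξ)`. -/
  comul_mat : ∀ (B : RightDualBasis A Ω) (x : RightVF A Ω) (ξ : Ω), 𝓛.Δ (IL.mat D x ξ) =
    Balanced.mk _ _ (∑ i, IL.mat D x (B.ω i) ⊗ₜ[k] IL.mat D (B.x i) ξ)
  /-- `Δ_L(ξ, y) = (ξ, y_j) ⊗ (η_j, y)`. -/
  comul_inv : ∀ (B : LeftDualBasis A Ω) (ξ : Ω) (y : LeftVF A Ω), 𝓛.Δ (IL.inv D ξ y) =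
    Balanced.mk _ _ (∑ j, IL.inv D ξ (B.y j) ⊗ₜ[k] IL.inv D (B.η j) y)
  counit_s : ∀ a : A, 𝓛.ε (IL.s D a) = a
  counit_t : ∀ a : A, 𝓛.ε (IL.t D (op a)) = a
  counit_vec : ∀ x : RightVF A Ω, 𝓛.ε (IL.vec D x) = 0
  counit_mat : ∀ (x : RightVF A Ω) (ξ : Ω), 𝓛.ε (IL.mat D x ξ) = x ξ
  counit_inv : ∀ (ξ : Ω) (y : LeftVF A Ω), 𝓛.ε (IL.inv D ξ y) = y ξ

/-- The prescribed values on generators of the coproduct and counit of `IR(Ω)`. -/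
structure IsGhobadiRight (D : FODC k A Ω) (𝓡 : RightBialgebroid (IR.s D) (IR.t D)) : Prop where
  comul_s : ∀ a : A, 𝓡.Δ (IR.s D a) = Balanced.mk _ _ (1 ⊗ₜ[k] IR.s D a)
  comul_t : ∀ a : A, 𝓡.Δ (IR.t D (op a)) = Balanced.mk _ _ (IR.t D (op a) ⊗ₜ[k] 1)
  /-- `Δ_R(y) = 1 ⊗ y + y_j ⊗ (η_j, y)`. -/
  comul_vec : ∀ (B : LeftDualBasis A Ω) (y : LeftVF A Ω), 𝓡.Δ (IR.vec D y) =
    Balanced.mk _ _ (1 ⊗ₜ[k] IR.vec D y + ∑ j, IR.vec D (B.y j) ⊗ₜ[k] IR.mat D (B.η j) y)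
  /-- `Δ_R(ξ, y) = (ξ, y_j) ⊗ (η_j, y)`. -/
  comul_mat : ∀ (B : LeftDualBasis A Ω) (ξ : Ω) (y : LeftVF A Ω), 𝓡.Δ (IR.mat D ξ y) =
    Balanced.mk _ _ (∑ j, IR.mat D ξ (B.y j) ⊗ₜ[k] IR.mat D (B.η j) y)
  /-- `Δ_R(x, ξ) = (x, ω_i) ⊗ (x_i, ξ)`. -/
  comul_inv : ∀ (B : RightDualBasis A Ω) (x : RightVF A Ω) (ξ : Ω), 𝓡.Δ (IR.inv D x ξ) =
    Balanced.mk _ _ (∑ i, IR.inv D x (B.ω i) ⊗ₜ[k] IR.inv D (B.x i) ξ)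
  counit_s : ∀ a : A, 𝓡.ε (IR.s D a) = a
  counit_t : ∀ a : A, 𝓡.ε (IR.t D (op a)) = a
  counit_vec : ∀ y : LeftVF A Ω, 𝓡.ε (IR.vec D y) = 0
  counit_mat : ∀ (ξ : Ω) (y : LeftVF A Ω), 𝓡.ε (IR.mat D ξ y) = y ξ
  counit_inv : ∀ (x : RightVF A Ω) (ξ : Ω), 𝓡.ε (IR.inv D x ξ) = x ξ

end Algebras

end StarBialgebroid

end

open StarBialgebroid

/-! Everything on the left rests on two constructions. First, `IL D` acts on `A`: `a` and `a̲` by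
left and right multiplication, `x` by `b ↦ ev^L(x, db)`, `(x, ξ)` by `b ↦ ev^L(x, bξ)`, `(ξ, y)` by
`b ↦ ev^R(ξb, y)`. The defining relations are Leibniz and dual basis identities for these operators
(`act_rel`). The counit is `X ↦ X·1`, so `ε(XY) = X·ε(Y)`, and both counit axioms for products
follow.

Second, the coproduct. The target `L ⊗_A L` is not an algebra, so the universal property cannot be
applied to it directly. For fixed dual bases the formulas on generators define an algebra map from
the free algebra to `L ⊗ L` over `k`. Its values lie in the subalgebra `takeuchi` of representatives
of Takeuchi elements (`comulRep_mem_takeuchi`). That subalgebra acts on `L ⊗_A L` by left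
multiplication, through classes only (`takeuchiAct_eq`). The relations of `IL D` hold modulo
balancing (`comulRep_rel`), hence exactly for this action, so `IL D` acts on `L ⊗_A L` and `Δ(X) =
X·(1 ⊗ 1)`. Multiplicativity is then built in, and coassociativity already holds on the free algebra
(`freeComul_coassoc`). Changing the dual bases changes nothing in `L ⊗_A L`, because `∑ ω_i ⊗_A x_i`
and `∑ y_j ⊗_A η_j` are canonical and central (`sum_transfer`).

The right side needs no second construction. The map `Φ` sends `x` to `y_j • (x, η_j)`, and an
analogous map back sends `y` to `(ω_i, y) • x_i`; the relations that make the matrices `(x, ξ)` and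
`(ξ, y)` mutually inverse make these maps inverse to each other (`toIL_covec`, `toIR_covec`). The
bialgebroid structure of `IR D` is transported along `Φ`, and its values on generators are read off.

Finally, `⊛` is a homomorphism into the conjugate opposite of `IR D`. The identity `⊛ Φ⁻¹ ⊛ = Φ`,
checked on generators, gives both the invertibility of `⊛` and `Φ⁻¹ ⊛ = ⊛⁻¹ Φ`. Compatibility with
the coproducts holds because `*` and `⊛` carry a dual basis on one side to a dual basis on the
other. -/

noncomputable section

namespace StarBialgebroid

universe u v w u'

set_option linter.unusedSectionVars false

/-! ### Dual bases and the coevaluation elements. -/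

section VectorFields

variable {A : Type v} {Ω : Type w} [Ring A] [AddCommGroup Ω] [Module A Ω] [Module Aᵐᵒᵖ Ω]
  [SMulCommClass A Aᵐᵒᵖ Ω]

@[simp] theorem RightVF.lact_apply (a : A) (x : RightVF A Ω) (ξ : Ω) : x.lact a ξ = a * x ξ := rfl

@[simp] theorem RightVF.ract_apply (a : A) (x : RightVF A Ω) (ξ : Ω) : x.ract a ξ = x (a • ξ) :=
  rfl

@[simp] theorem LeftVF.lact_apply (a : A) (y : LeftVF A Ω) (ξ : Ω) :
    y.lact a ξ = y (op a • ξ) := rfl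

@[simp] theorem LeftVF.ract_apply (a : A) (y : LeftVF A Ω) (ξ : Ω) : y.ract a ξ = y ξ * a := rfl

/-- Evaluate `x` on the expansion of `ξ`: the `x_i` generate `𝔛^R` as a left module, with
coefficients `x(ω_i)`. -/
theorem RightDualBasis.sum_apply_lact (B : RightDualBasis A Ω) (x : RightVF A Ω) :
    ∑ i, (B.x i).lact (x (B.ω i)) = x := by
  ext ξ
  conv_rhs => rw [← B.sum_eq ξ]
  simp [LinearMap.sum_apply]

theorem LeftDualBasis.sum_apply_ract (B : LeftDualBasis A Ω) (y : LeftVF A Ω) :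
    ∑ j, (B.y j).ract (y (B.η j)) = y := by
  ext ξ
  conv_rhs => rw [← B.sum_eq ξ]
  simp [LinearMap.sum_apply]

/-- A right linear map `T` passes through the coevaluation `∑ ω_i ⊗_A x_i`, which does not
depend on the dual basis. -/
theorem RightDualBasis.sum_transfer {N : Type*} [AddCommGroup N] (B B' : RightDualBasis A Ω)
    (F : Ω → RightVF A Ω → N) (h₁ : ∀ ξ ξ' x, F (ξ + ξ') x = F ξ x + F ξ' x)
    (h₂ : ∀ ξ x x', F ξ (x + x') = F ξ x + F ξ x')
    (hb : ∀ ξ x (a : A), F (op a • ξ) x = F ξ (x.lact a)) (T : Ω →ₗ[Aᵐᵒᵖ] Ω) :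
    ∑ i, F (T (B.ω i)) (B.x i) = ∑ i, F (B'.ω i) ((B'.x i).comp T) := by
  let G₁ (x : RightVF A Ω) : Ω →+ N := AddMonoidHom.mk' (fun ξ => F ξ x) fun ξ ξ' => h₁ ξ ξ' x
  let G₂ (ξ : Ω) : RightVF A Ω →+ N := AddMonoidHom.mk' (F ξ) (h₂ ξ)
  -- Expand `T ω_i` in the basis `B'` and push the coefficients across the balanced `F`. Once the
  -- sums are exchanged, the sum over `i` recombines into `x'_l ∘ T` by `sum_apply_lact`.
  have e₁ (i) : F (T (B.ω i)) (B.x i)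
      = ∑ l, F (B'.ω l) ((B.x i).lact (B'.x l (T (B.ω i)))) := by
    conv_lhs => rw [← B'.sum_eq (T (B.ω i))]
    exact (map_sum (G₁ (B.x i)) _ _).trans (Finset.sum_congr rfl fun l _ => hb _ _ _)
  rw [Finset.sum_congr rfl fun i _ => e₁ i, Finset.sum_comm]
  refine Finset.sum_congr rfl fun l _ => ?_
  refine (map_sum (G₂ (B'.ω l)) _ _).symm.trans (congrArg (F (B'.ω l)) ?_)
  exact B.sum_apply_lact ((B'.x l).comp T)

/-- A left linear map `T` passes through the coevaluation `∑ y_j ⊗_A η_j`, which does not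
depend on the dual basis. -/
theorem LeftDualBasis.sum_transfer {N : Type*} [AddCommGroup N] (B B' : LeftDualBasis A Ω)
    (F : Ω → LeftVF A Ω → N) (h₁ : ∀ ξ ξ' y, F (ξ + ξ') y = F ξ y + F ξ' y)
    (h₂ : ∀ ξ y y', F ξ (y + y') = F ξ y + F ξ y')
    (hb : ∀ ξ y (a : A), F (a • ξ) y = F ξ (y.ract a)) (T : Ω →ₗ[A] Ω) :
    ∑ j, F (T (B.η j)) (B.y j) = ∑ j, F (B'.η j) ((B'.y j).comp T) := by
  let G₁ (y : LeftVF A Ω) : Ω →+ N := AddMonoidHom.mk' (fun ξ => F ξ y) fun ξ ξ' => h₁ ξ ξ' y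
  let G₂ (ξ : Ω) : LeftVF A Ω →+ N := AddMonoidHom.mk' (F ξ) (h₂ ξ)
  have e₁ (i) : F (T (B.η i)) (B.y i)
      = ∑ l, F (B'.η l) ((B.y i).ract (B'.y l (T (B.η i)))) := by
    conv_lhs => rw [← B'.sum_eq (T (B.η i))]
    exact (map_sum (G₁ (B.y i)) _ _).trans (Finset.sum_congr rfl fun l _ => hb _ _ _)
  rw [Finset.sum_congr rfl fun i _ => e₁ i, Finset.sum_comm]
  refine Finset.sum_congr rfl fun l _ => ?_
  refine (map_sum (G₂ (B'.η l)) _ _).symm.trans (congrArg (F (B'.η l)) ?_)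
  exact B.sum_apply_ract ((B'.y l).comp T)

/-- Left multiplication by `a` as a right linear endomorphism of `Ω`. -/
def lmulΩ (a : A) : Ω →ₗ[Aᵐᵒᵖ] Ω where
  toFun ξ := a • ξ
  map_add' := smul_add a
  map_smul' c ξ := smul_comm a c ξ

/-- Right multiplication by `a` as a left linear endomorphism of `Ω`. -/
def rmulΩ (a : A) : Ω →ₗ[A] Ω where
  toFun ξ := op a • ξ
  map_add' := smul_add (op a)
  map_smul' c ξ := (smul_comm c (op a) ξ).symm

/-- The coevaluation is central: this is the transfer of the right linear map `ξ ↦ aξ`. It is the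
source of the Takeuchi condition. -/
theorem RightDualBasis.sum_smul {N : Type*} [AddCommGroup N] (B : RightDualBasis A Ω)
    (F : Ω → RightVF A Ω → N) (h₁ : ∀ ξ ξ' x, F (ξ + ξ') x = F ξ x + F ξ' x)
    (h₂ : ∀ ξ x x', F ξ (x + x') = F ξ x + F ξ x')
    (hb : ∀ ξ x (a : A), F (op a • ξ) x = F ξ (x.lact a)) (a : A) :
    ∑ i, F (a • B.ω i) (B.x i) = ∑ i, F (B.ω i) ((B.x i).ract a) :=
  B.sum_transfer B F h₁ h₂ hb (lmulΩ a)

theorem LeftDualBasis.sum_smul {N : Type*} [AddCommGroup N] (B : LeftDualBasis A Ω)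
    (F : Ω → LeftVF A Ω → N) (h₁ : ∀ ξ ξ' y, F (ξ + ξ') y = F ξ y + F ξ' y)
    (h₂ : ∀ ξ y y', F ξ (y + y') = F ξ y + F ξ y')
    (hb : ∀ ξ y (a : A), F (a • ξ) y = F ξ (y.ract a)) (a : A) :
    ∑ j, F (op a • B.η j) (B.y j) = ∑ j, F (B.η j) ((B.y j).lact a) :=
  B.sum_transfer B F h₁ h₂ hb (rmulΩ a)

/-- Transfer of the identity. The structures are built from one dual basis, and this gives their
formulas for every other one. -/
theorem RightDualBasis.sum_eq_sum {N : Type*} [AddCommGroup N] (B B' : RightDualBasis A Ω)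
    (F : Ω → RightVF A Ω → N) (h₁ : ∀ ξ ξ' x, F (ξ + ξ') x = F ξ x + F ξ' x)
    (h₂ : ∀ ξ x x', F ξ (x + x') = F ξ x + F ξ x')
    (hb : ∀ ξ x (a : A), F (op a • ξ) x = F ξ (x.lact a)) :
    ∑ i, F (B.ω i) (B.x i) = ∑ i, F (B'.ω i) (B'.x i) :=
  B.sum_transfer B' F h₁ h₂ hb LinearMap.id

theorem LeftDualBasis.sum_eq_sum {N : Type*} [AddCommGroup N] (B B' : LeftDualBasis A Ω)
    (F : Ω → LeftVF A Ω → N) (h₁ : ∀ ξ ξ' y, F (ξ + ξ') y = F ξ y + F ξ' y)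
    (h₂ : ∀ ξ y y', F ξ (y + y') = F ξ y + F ξ y')
    (hb : ∀ ξ y (a : A), F (a • ξ) y = F ξ (y.ract a)) :
    ∑ j, F (B.η j) (B.y j) = ∑ j, F (B'.η j) (B'.y j) :=
  B.sum_transfer B' F h₁ h₂ hb LinearMap.id

variable (A Ω) in
theorem exists_rightDualBasis [Module.Finite Aᵐᵒᵖ Ω] [Module.Projective Aᵐᵒᵖ Ω] :
    Nonempty (RightDualBasis A Ω) := by
  obtain ⟨n, f, g, -, -, h⟩ := Module.Finite.exists_comp_eq_id_of_projective Aᵐᵒᵖ Ω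
  -- The regular `Aᵐᵒᵖ`-module is `A` with right multiplication; `e` turns coordinates into
  -- `A`-valued functionals.
  let e : Aᵐᵒᵖ →ₗ[Aᵐᵒᵖ] A :=
    { toFun := MulOpposite.unop, map_add' := fun _ _ => rfl, map_smul' := fun _ _ => rfl }
  refine ⟨⟨n, fun i => f (Pi.single i 1), fun i => e ∘ₗ LinearMap.proj i ∘ₗ g, fun ξ => ?_⟩⟩
  conv_rhs => rw [← LinearMap.id_apply (R := Aᵐᵒᵖ) ξ, ← h, LinearMap.comp_apply,
    pi_eq_sum_univ' (g ξ), map_sum]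
  refine Finset.sum_congr rfl fun i _ => ?_
  rw [map_smul]
  congr 2

variable (A Ω) in
theorem exists_leftDualBasis [Module.Finite A Ω] [Module.Projective A Ω] :
    Nonempty (LeftDualBasis A Ω) := by
  obtain ⟨n, f, g, -, -, h⟩ := Module.Finite.exists_comp_eq_id_of_projective A Ω
  refine ⟨⟨n, fun i => LinearMap.proj i ∘ₗ g, fun i => f (Pi.single i 1), fun ξ => ?_⟩⟩
  conv_rhs => rw [← LinearMap.id_apply (R := A) ξ, ← h, LinearMap.comp_apply,
    pi_eq_sum_univ' (g ξ), map_sum]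
  refine Finset.sum_congr rfl fun i _ => ?_
  rw [map_smul]
  congr 2

end VectorFields

/-! ### Relations on generators, universal properties and induction for `IL` and `IR`. -/

section Presentations

variable {k : Type u} {A : Type v} {Ω : Type w} [CommRing k] [Ring A] [Algebra k A]
  [AddCommGroup Ω] [Module k Ω] [Module A Ω] [Module Aᵐᵒᵖ Ω] [SMulCommClass A Aᵐᵒᵖ Ω]
  {D : FODC k A Ω}

/-- `ILRel` concerns families in an arbitrary algebra and is natural in it. Hence the relations of a
prospective homomorphism need only be checked for the images of the generators, as in `IL.lift`. -/
theorem ILRel.map {F F' : Type*} [Ring F] [Algebra k F] [Ring F'] [Algebra k F']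
    {s t : A → F} {v : RightVF A Ω → F} {m : RightVF A Ω → Ω → F} {p : Ω → LeftVF A Ω → F}
    (φ : F →ₐ[k] F') {z w : F} (h : ILRel D s t v m p z w) :
    ILRel D (fun a => φ (s a)) (fun a => φ (t a)) (fun x => φ (v x)) (fun x ξ => φ (m x ξ))
      (fun x ξ => φ (p x ξ)) (φ z) (φ w) := by
  cases h <;> simp only [map_add, map_mul, map_sum, AlgHom.commutes]
  case s_add => exact .s_add ..
  case s_mul => exact .s_mul ..
  case s_algebraMap => exact .s_algebraMap ..
  case t_add => exact .t_add ..
  case t_mul => exact .t_mul ..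
  case t_algebraMap => exact .t_algebraMap ..
  case s_comm_t => exact .s_comm_t ..
  case v_add => exact .v_add ..
  case m_add_left => exact .m_add_left ..
  case m_add_right => exact .m_add_right ..
  case p_add_left => exact .p_add_left ..
  case p_add_right => exact .p_add_right ..
  case s_mul_m => exact .s_mul_m ..
  case m_mul_s => exact .m_mul_s ..
  case t_mul_m => exact .t_mul_m ..
  case m_mul_t => exact .m_mul_t ..
  case s_mul_p => exact .s_mul_p ..
  case p_mul_s => exact .p_mul_s ..
  case t_mul_p => exact .t_mul_p ..
  case p_mul_t => exact .p_mul_t ..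
  case s_mul_v => exact .s_mul_v ..
  case v_mul_s => exact .v_mul_s ..
  case v_mul_t => exact .v_mul_t ..
  case p_mul_m => exact .p_mul_m ..
  case m_mul_p => exact .m_mul_p ..

theorem IL.s_comm_t (a b : A) :
    IL.s D a * IL.t D (op b) = IL.t D (op b) * IL.s D a := by
  have h := IL.proj_rel (D := D) (.s_comm_t a b)
  simp only [map_mul] at h
  exact h

theorem IL.vec_add (x x' : RightVF A Ω) :
    IL.vec D (x + x') = IL.vec D x + IL.vec D x' := by
  have h := IL.proj_rel (D := D) (.v_add x x')
  simp only [map_add] at h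
  exact h

theorem IL.mat_add_left (x x' : RightVF A Ω) (ξ : Ω) :
    IL.mat D (x + x') ξ = IL.mat D x ξ + IL.mat D x' ξ := by
  have h := IL.proj_rel (D := D) (.m_add_left x x' ξ)
  simp only [map_add] at h
  exact h

theorem IL.mat_add_right (x : RightVF A Ω) (ξ ξ' : Ω) :
    IL.mat D x (ξ + ξ') = IL.mat D x ξ + IL.mat D x ξ' := by
  have h := IL.proj_rel (D := D) (.m_add_right x ξ ξ')
  simp only [map_add] at h
  exact h

theorem IL.inv_add_left (ξ ξ' : Ω) (y : LeftVF A Ω) :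
    IL.inv D (ξ + ξ') y = IL.inv D ξ y + IL.inv D ξ' y := by
  have h := IL.proj_rel (D := D) (.p_add_left ξ ξ' y)
  simp only [map_add] at h
  exact h

theorem IL.inv_add_right (ξ : Ω) (y y' : LeftVF A Ω) :
    IL.inv D ξ (y + y') = IL.inv D ξ y + IL.inv D ξ y' := by
  have h := IL.proj_rel (D := D) (.p_add_right ξ y y')
  simp only [map_add] at h
  exact h

theorem IL.s_mul_mat (a : A) (x : RightVF A Ω) (ξ : Ω) :
    IL.s D a * IL.mat D x ξ = IL.mat D (x.lact a) ξ := by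
  have h := IL.proj_rel (D := D) (.s_mul_m a x ξ)
  simp only [map_mul] at h
  exact h

theorem IL.mat_mul_s (a : A) (x : RightVF A Ω) (ξ : Ω) :
    IL.mat D x ξ * IL.s D a = IL.mat D (x.ract a) ξ := by
  have h := IL.proj_rel (D := D) (.m_mul_s a x ξ)
  simp only [map_mul] at h
  exact h

theorem IL.t_mul_mat (a : A) (x : RightVF A Ω) (ξ : Ω) :
    IL.t D (op a) * IL.mat D x ξ = IL.mat D x (op a • ξ) := by
  have h := IL.proj_rel (D := D) (.t_mul_m a x ξ)
  simp only [map_mul] at h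
  exact h

theorem IL.mat_mul_t (a : A) (x : RightVF A Ω) (ξ : Ω) :
    IL.mat D x ξ * IL.t D (op a) = IL.mat D x (a • ξ) := by
  have h := IL.proj_rel (D := D) (.m_mul_t a x ξ)
  simp only [map_mul] at h
  exact h

theorem IL.s_mul_inv (a : A) (ξ : Ω) (y : LeftVF A Ω) :
    IL.s D a * IL.inv D ξ y = IL.inv D (a • ξ) y := by
  have h := IL.proj_rel (D := D) (.s_mul_p a ξ y)
  simp only [map_mul] at h
  exact h

theorem IL.inv_mul_s (a : A) (ξ : Ω) (y : LeftVF A Ω) :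
    IL.inv D ξ y * IL.s D a = IL.inv D (op a • ξ) y := by
  have h := IL.proj_rel (D := D) (.p_mul_s a ξ y)
  simp only [map_mul] at h
  exact h

theorem IL.t_mul_inv (a : A) (ξ : Ω) (y : LeftVF A Ω) :
    IL.t D (op a) * IL.inv D ξ y = IL.inv D ξ (y.ract a) := by
  have h := IL.proj_rel (D := D) (.t_mul_p a ξ y)
  simp only [map_mul] at h
  exact h

theorem IL.inv_mul_t (a : A) (ξ : Ω) (y : LeftVF A Ω) :
    IL.inv D ξ y * IL.t D (op a) = IL.inv D ξ (y.lact a) := by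
  have h := IL.proj_rel (D := D) (.p_mul_t a ξ y)
  simp only [map_mul] at h
  exact h

theorem IL.s_mul_vec (a : A) (x : RightVF A Ω) :
    IL.s D a * IL.vec D x = IL.vec D (x.lact a) := by
  have h := IL.proj_rel (D := D) (.s_mul_v a x)
  simp only [map_mul] at h
  exact h

theorem IL.vec_mul_s (a : A) (x : RightVF A Ω) :
    IL.vec D x * IL.s D a = IL.vec D (x.ract a) + IL.s D (x (D.d a)) := by
  have h := IL.proj_rel (D := D) (.v_mul_s a x)
  simp only [map_add, map_mul] at h
  exact h

theorem IL.vec_mul_t (a : A) (x : RightVF A Ω) :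
    IL.vec D x * IL.t D (op a) = IL.t D (op a) * IL.vec D x + IL.mat D x (D.d a) := by
  have h := IL.proj_rel (D := D) (.v_mul_t a x)
  simp only [map_add, map_mul] at h
  exact h

theorem IL.inv_mul_mat (B : RightDualBasis A Ω) (ξ : Ω) (y : LeftVF A Ω) :
    ∑ i, IL.inv D (B.ω i) y * IL.mat D (B.x i) ξ = IL.t D (op (y ξ)) := by
  have h := IL.proj_rel (D := D) (.p_mul_m B ξ y)
  simp only [map_mul, map_sum] at h
  exact h

theorem IL.mat_mul_inv (B : LeftDualBasis A Ω) (ξ : Ω) (x : RightVF A Ω) :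
    ∑ j, IL.mat D x (B.η j) * IL.inv D ξ (B.y j) = IL.s D (x ξ) := by
  have h := IL.proj_rel (D := D) (.m_mul_p B ξ x)
  simp only [map_mul, map_sum] at h
  exact h

/-- The homomorphism out of `IL(Ω)` given by elements that satisfy the defining relations. -/
def IL.lift {F : Type u'} [Ring F] [Algebra k F] (s t : A → F) (v : RightVF A Ω → F)
    (m : RightVF A Ω → Ω → F) (p : Ω → LeftVF A Ω → F) (h : ∀ z w, ILRel D s t v m p z w → z = w) :
    IL D →ₐ[k] F :=
  RingQuot.liftAlgHom k ⟨FreeAlgebra.lift k (ILGen.rec s t v m p), fun z w hzw =>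
    h _ _ (by simpa only [FreeAlgebra.lift_ι_apply] using
      ILRel.map (FreeAlgebra.lift k (ILGen.rec s t v m p)) hzw)⟩

section Lift

variable {F : Type u'} [Ring F] [Algebra k F] {s t : A → F} {v : RightVF A Ω → F}
    {m : RightVF A Ω → Ω → F} {p : Ω → LeftVF A Ω → F} (h : ∀ z w, ILRel D s t v m p z w → z = w)

theorem IL.lift_proj (z : FreeAlgebra k (ILGen A Ω)) :
    IL.lift s t v m p h (IL.proj D z) = FreeAlgebra.lift k (ILGen.rec s t v m p) z :=
  RingQuot.liftAlgHom_mkAlgHom_apply ..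

@[simp] theorem IL.lift_s (a : A) : IL.lift s t v m p h (IL.s D a) = s a :=
  (IL.lift_proj h _).trans (FreeAlgebra.lift_ι_apply ..)

@[simp] theorem IL.lift_t (a : A) : IL.lift s t v m p h (IL.t D (op a)) = t a :=
  (IL.lift_proj h _).trans (FreeAlgebra.lift_ι_apply ..)

@[simp] theorem IL.lift_vec (x : RightVF A Ω) : IL.lift s t v m p h (IL.vec D x) = v x :=
  (IL.lift_proj h _).trans (FreeAlgebra.lift_ι_apply ..)

@[simp] theorem IL.lift_mat (x) (ξ) : IL.lift s t v m p h (IL.mat D x ξ) = m x ξ :=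
  (IL.lift_proj h _).trans (FreeAlgebra.lift_ι_apply ..)

@[simp] theorem IL.lift_inv (x) (ξ) : IL.lift s t v m p h (IL.inv D x ξ) = p x ξ :=
  (IL.lift_proj h _).trans (FreeAlgebra.lift_ι_apply ..)

end Lift

theorem IL.proj_surjective : Function.Surjective (IL.proj D) :=
  RingQuot.mkAlgHom_surjective k _

@[elab_as_elim]
theorem IL.induction {P : IL D → Prop} (add : ∀ X Y, P X → P Y → P (X + Y))
    (mul : ∀ X Y, P X → P Y → P (X * Y)) (s : ∀ a, P (IL.s D a))
    (t : ∀ a, P (IL.t D (op a))) (vec : ∀ x, P (IL.vec D x))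
    (mat : ∀ x ξ, P (IL.mat D x ξ)) (inv : ∀ x ξ, P (IL.inv D x ξ)) (X : IL D) : P X := by
  obtain ⟨z, rfl⟩ := IL.proj_surjective X
  induction z using FreeAlgebra.induction with
  | grade0 r =>
    -- Scalars are values of the source map, so they need no case of their own.
    rw [AlgHom.commutes, ← (IL.s D).commutes]
    exact s _
  | grade1 g => cases g <;> apply_assumption
  | mul z w hz hw => simpa using mul _ _ hz hw
  | add z w hz hw => simpa using add _ _ hz hw

theorem IRRel.map {F F' : Type*} [Ring F] [Algebra k F] [Ring F'] [Algebra k F']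
    {s t : A → F} {v : LeftVF A Ω → F} {m : Ω → LeftVF A Ω → F} {p : RightVF A Ω → Ω → F}
    (φ : F →ₐ[k] F') {z w : F} (h : IRRel D s t v m p z w) :
    IRRel D (fun a => φ (s a)) (fun a => φ (t a)) (fun x => φ (v x)) (fun x ξ => φ (m x ξ))
      (fun x ξ => φ (p x ξ)) (φ z) (φ w) := by
  cases h <;> simp only [map_add, map_mul, map_sum, AlgHom.commutes]
  case s_add => exact .s_add ..
  case s_mul => exact .s_mul ..
  case s_algebraMap => exact .s_algebraMap ..
  case t_add => exact .t_add ..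
  case t_mul => exact .t_mul ..
  case t_algebraMap => exact .t_algebraMap ..
  case s_comm_t => exact .s_comm_t ..
  case v_add => exact .v_add ..
  case m_add_left => exact .m_add_left ..
  case m_add_right => exact .m_add_right ..
  case p_add_left => exact .p_add_left ..
  case p_add_right => exact .p_add_right ..
  case s_mul_m => exact .s_mul_m ..
  case m_mul_s => exact .m_mul_s ..
  case t_mul_m => exact .t_mul_m ..
  case m_mul_t => exact .m_mul_t ..
  case s_mul_p => exact .s_mul_p ..
  case p_mul_s => exact .p_mul_s ..
  case t_mul_p => exact .t_mul_p ..
  case p_mul_t => exact .p_mul_t ..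
  case v_mul_s => exact .v_mul_s ..
  case s_mul_v => exact .s_mul_v ..
  case t_mul_v => exact .t_mul_v ..
  case p_mul_m => exact .p_mul_m ..
  case m_mul_p => exact .m_mul_p ..

theorem IR.s_comm_t (a b : A) :
    IR.s D a * IR.t D (op b) = IR.t D (op b) * IR.s D a := by
  have h := IR.proj_rel (D := D) (.s_comm_t a b)
  simp only [map_mul] at h
  exact h

theorem IR.vec_add (y y' : LeftVF A Ω) :
    IR.vec D (y + y') = IR.vec D y + IR.vec D y' := by
  have h := IR.proj_rel (D := D) (.v_add y y')
  simp only [map_add] at h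
  exact h

theorem IR.mat_add_left (ξ ξ' : Ω) (y : LeftVF A Ω) :
    IR.mat D (ξ + ξ') y = IR.mat D ξ y + IR.mat D ξ' y := by
  have h := IR.proj_rel (D := D) (.m_add_left ξ ξ' y)
  simp only [map_add] at h
  exact h

theorem IR.mat_add_right (ξ : Ω) (y y' : LeftVF A Ω) :
    IR.mat D ξ (y + y') = IR.mat D ξ y + IR.mat D ξ y' := by
  have h := IR.proj_rel (D := D) (.m_add_right ξ y y')
  simp only [map_add] at h
  exact h

theorem IR.inv_add_left (x x' : RightVF A Ω) (ξ : Ω) :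
    IR.inv D (x + x') ξ = IR.inv D x ξ + IR.inv D x' ξ := by
  have h := IR.proj_rel (D := D) (.p_add_left x x' ξ)
  simp only [map_add] at h
  exact h

theorem IR.inv_add_right (x : RightVF A Ω) (ξ ξ' : Ω) :
    IR.inv D x (ξ + ξ') = IR.inv D x ξ + IR.inv D x ξ' := by
  have h := IR.proj_rel (D := D) (.p_add_right x ξ ξ')
  simp only [map_add] at h
  exact h

theorem IR.s_mul_mat (a : A) (ξ : Ω) (y : LeftVF A Ω) :
    IR.s D a * IR.mat D ξ y = IR.mat D ξ (y.lact a) := by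
  have h := IR.proj_rel (D := D) (.s_mul_m a ξ y)
  simp only [map_mul] at h
  exact h

theorem IR.mat_mul_s (a : A) (ξ : Ω) (y : LeftVF A Ω) :
    IR.mat D ξ y * IR.s D a = IR.mat D ξ (y.ract a) := by
  have h := IR.proj_rel (D := D) (.m_mul_s a ξ y)
  simp only [map_mul] at h
  exact h

theorem IR.t_mul_mat (a : A) (ξ : Ω) (y : LeftVF A Ω) :
    IR.t D (op a) * IR.mat D ξ y = IR.mat D (op a • ξ) y := by
  have h := IR.proj_rel (D := D) (.t_mul_m a ξ y)
  simp only [map_mul] at h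
  exact h

theorem IR.mat_mul_t (a : A) (ξ : Ω) (y : LeftVF A Ω) :
    IR.mat D ξ y * IR.t D (op a) = IR.mat D (a • ξ) y := by
  have h := IR.proj_rel (D := D) (.m_mul_t a ξ y)
  simp only [map_mul] at h
  exact h

theorem IR.s_mul_inv (a : A) (x : RightVF A Ω) (ξ : Ω) :
    IR.s D a * IR.inv D x ξ = IR.inv D x (a • ξ) := by
  have h := IR.proj_rel (D := D) (.s_mul_p a x ξ)
  simp only [map_mul] at h
  exact h

theorem IR.inv_mul_s (a : A) (x : RightVF A Ω) (ξ : Ω) :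
    IR.inv D x ξ * IR.s D a = IR.inv D x (op a • ξ) := by
  have h := IR.proj_rel (D := D) (.p_mul_s a x ξ)
  simp only [map_mul] at h
  exact h

theorem IR.t_mul_inv (a : A) (x : RightVF A Ω) (ξ : Ω) :
    IR.t D (op a) * IR.inv D x ξ = IR.inv D (x.ract a) ξ := by
  have h := IR.proj_rel (D := D) (.t_mul_p a x ξ)
  simp only [map_mul] at h
  exact h

theorem IR.inv_mul_t (a : A) (x : RightVF A Ω) (ξ : Ω) :
    IR.inv D x ξ * IR.t D (op a) = IR.inv D (x.lact a) ξ := by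
  have h := IR.proj_rel (D := D) (.p_mul_t a x ξ)
  simp only [map_mul] at h
  exact h

theorem IR.vec_mul_s (a : A) (y : LeftVF A Ω) :
    IR.vec D y * IR.s D a = IR.vec D (y.ract a) := by
  have h := IR.proj_rel (D := D) (.v_mul_s a y)
  simp only [map_mul] at h
  exact h

theorem IR.s_mul_vec (a : A) (y : LeftVF A Ω) :
    IR.s D a * IR.vec D y = IR.vec D (y.lact a) + IR.s D (y (D.d a)) := by
  have h := IR.proj_rel (D := D) (.s_mul_v a y)
  simp only [map_add, map_mul] at h
  exact h

theorem IR.t_mul_vec (a : A) (y : LeftVF A Ω) :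
    IR.t D (op a) * IR.vec D y = IR.vec D y * IR.t D (op a) + IR.mat D (D.d a) y := by
  have h := IR.proj_rel (D := D) (.t_mul_v a y)
  simp only [map_add, map_mul] at h
  exact h

theorem IR.inv_mul_mat (B : RightDualBasis A Ω) (ξ : Ω) (y : LeftVF A Ω) :
    ∑ i, IR.inv D (B.x i) ξ * IR.mat D (B.ω i) y = IR.s D (y ξ) := by
  have h := IR.proj_rel (D := D) (.p_mul_m B ξ y)
  simp only [map_mul, map_sum] at h
  exact h

theorem IR.mat_mul_inv (B : LeftDualBasis A Ω) (ξ : Ω) (x : RightVF A Ω) :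
    ∑ j, IR.mat D ξ (B.y j) * IR.inv D x (B.η j) = IR.t D (op (x ξ)) := by
  have h := IR.proj_rel (D := D) (.m_mul_p B ξ x)
  simp only [map_mul, map_sum] at h
  exact h

/-- The homomorphism out of `IR(Ω)` given by elements that satisfy the defining relations. -/
def IR.lift {F : Type u'} [Ring F] [Algebra k F] (s t : A → F) (v : LeftVF A Ω → F)
    (m : Ω → LeftVF A Ω → F) (p : RightVF A Ω → Ω → F) (h : ∀ z w, IRRel D s t v m p z w → z = w) :
    IR D →ₐ[k] F :=
  RingQuot.liftAlgHom k ⟨FreeAlgebra.lift k (IRGen.rec s t v m p), fun z w hzw =>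
    h _ _ (by simpa only [FreeAlgebra.lift_ι_apply] using
      IRRel.map (FreeAlgebra.lift k (IRGen.rec s t v m p)) hzw)⟩

section Lift

variable {F : Type u'} [Ring F] [Algebra k F] {s t : A → F} {v : LeftVF A Ω → F}
    {m : Ω → LeftVF A Ω → F} {p : RightVF A Ω → Ω → F} (h : ∀ z w, IRRel D s t v m p z w → z = w)

theorem IR.lift_proj (z : FreeAlgebra k (IRGen A Ω)) :
    IR.lift s t v m p h (IR.proj D z) = FreeAlgebra.lift k (IRGen.rec s t v m p) z :=
  RingQuot.liftAlgHom_mkAlgHom_apply ..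

@[simp] theorem IR.lift_s (a : A) : IR.lift s t v m p h (IR.s D a) = s a :=
  (IR.lift_proj h _).trans (FreeAlgebra.lift_ι_apply ..)

@[simp] theorem IR.lift_t (a : A) : IR.lift s t v m p h (IR.t D (op a)) = t a :=
  (IR.lift_proj h _).trans (FreeAlgebra.lift_ι_apply ..)

@[simp] theorem IR.lift_vec (x : LeftVF A Ω) : IR.lift s t v m p h (IR.vec D x) = v x :=
  (IR.lift_proj h _).trans (FreeAlgebra.lift_ι_apply ..)

@[simp] theorem IR.lift_mat (x) (ξ) : IR.lift s t v m p h (IR.mat D x ξ) = m x ξ :=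
  (IR.lift_proj h _).trans (FreeAlgebra.lift_ι_apply ..)

@[simp] theorem IR.lift_inv (x) (ξ) : IR.lift s t v m p h (IR.inv D x ξ) = p x ξ :=
  (IR.lift_proj h _).trans (FreeAlgebra.lift_ι_apply ..)

end Lift

theorem IR.proj_surjective : Function.Surjective (IR.proj D) :=
  RingQuot.mkAlgHom_surjective k _

@[elab_as_elim]
theorem IR.induction {P : IR D → Prop} (add : ∀ X Y, P X → P Y → P (X + Y))
    (mul : ∀ X Y, P X → P Y → P (X * Y)) (s : ∀ a, P (IR.s D a))
    (t : ∀ a, P (IR.t D (op a))) (vec : ∀ x, P (IR.vec D x))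
    (mat : ∀ x ξ, P (IR.mat D x ξ)) (inv : ∀ x ξ, P (IR.inv D x ξ)) (X : IR D) : P X := by
  obtain ⟨z, rfl⟩ := IR.proj_surjective X
  induction z using FreeAlgebra.induction with
  | grade0 r =>
    rw [AlgHom.commutes, ← (IR.s D).commutes]
    exact s _
  | grade1 g => cases g <;> apply_assumption
  | mul z w hz hw => simpa using mul _ _ hz hw
  | add z w hz hw => simpa using add _ _ hz hw

end Presentations

section Sums

variable {k : Type u} {A : Type v} {Ω : Type w} [CommRing k] [Ring A] [Algebra k A]
  [AddCommGroup Ω] [Module k Ω] [Module A Ω] [Module Aᵐᵒᵖ Ω] [SMulCommClass A Aᵐᵒᵖ Ω]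
  {D : FODC k A Ω} {ι : Type*} (S : Finset ι)

theorem IL.vec_sum (x : ι → RightVF A Ω) : IL.vec D (∑ i ∈ S, x i) = ∑ i ∈ S, IL.vec D (x i) :=
  map_sum (AddMonoidHom.mk' (IL.vec D) IL.vec_add) x S

theorem IL.mat_sum_left (x : ι → RightVF A Ω) (ξ : Ω) :
    IL.mat D (∑ i ∈ S, x i) ξ = ∑ i ∈ S, IL.mat D (x i) ξ :=
  map_sum (AddMonoidHom.mk' (IL.mat D · ξ) fun _ _ => IL.mat_add_left ..) x S

theorem IL.mat_sum_right (x : RightVF A Ω) (ξ : ι → Ω) :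
    IL.mat D x (∑ i ∈ S, ξ i) = ∑ i ∈ S, IL.mat D x (ξ i) :=
  map_sum (AddMonoidHom.mk' (IL.mat D x) fun _ _ => IL.mat_add_right ..) ξ S

theorem IL.inv_sum_left (ξ : ι → Ω) (y : LeftVF A Ω) :
    IL.inv D (∑ i ∈ S, ξ i) y = ∑ i ∈ S, IL.inv D (ξ i) y :=
  map_sum (AddMonoidHom.mk' (IL.inv D · y) fun _ _ => IL.inv_add_left ..) ξ S

theorem IL.inv_sum_right (ξ : Ω) (y : ι → LeftVF A Ω) :
    IL.inv D ξ (∑ i ∈ S, y i) = ∑ i ∈ S, IL.inv D ξ (y i) :=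
  map_sum (AddMonoidHom.mk' (IL.inv D ξ) fun _ _ => IL.inv_add_right ..) y S

theorem IR.vec_sum (y : ι → LeftVF A Ω) : IR.vec D (∑ i ∈ S, y i) = ∑ i ∈ S, IR.vec D (y i) :=
  map_sum (AddMonoidHom.mk' (IR.vec D) IR.vec_add) y S

theorem IR.inv_sum_right (x : RightVF A Ω) (ξ : ι → Ω) :
    IR.inv D x (∑ i ∈ S, ξ i) = ∑ i ∈ S, IR.inv D x (ξ i) :=
  map_sum (AddMonoidHom.mk' (IR.inv D x) fun _ _ => IR.inv_add_right ..) ξ S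

end Sums

/-! ### The action of `IL` on `A` and the counit. -/

section Counit

variable {k : Type u} {A : Type v} {Ω : Type w} [CommRing k] [Ring A] [Algebra k A]
  [AddCommGroup Ω] [Module k Ω] [Module A Ω] [Module Aᵐᵒᵖ Ω] [SMulCommClass A Aᵐᵒᵖ Ω]
  [IsScalarTower k A Ω] [IsScalarTower k Aᵐᵒᵖ Ω] (D : FODC k A Ω)

/-- The action of `x` on `A`: `a ↦ ev^L(x, d a)`. -/
def vecAct (x : RightVF A Ω) : Module.End k A := x.restrictScalars k ∘ₗ D.d

/-- The action of `(x, ξ)` on `A`: `a ↦ ev^L(x, a ξ)`. -/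
def matAct (k : Type u) [CommRing k] [Algebra k A] [Module k Ω] [IsScalarTower k A Ω]
    [IsScalarTower k Aᵐᵒᵖ Ω] (x : RightVF A Ω) (ξ : Ω) : Module.End k A :=
  x.restrictScalars k ∘ₗ (LinearMap.toSpanSingleton A Ω ξ).restrictScalars k

/-- The action of `(ξ, y)` on `A`: `a ↦ ev^R(ξ a, y)`. -/
def invAct (k : Type u) [CommRing k] [Algebra k A] [Module k Ω] [IsScalarTower k A Ω]
    [IsScalarTower k Aᵐᵒᵖ Ω] (ξ : Ω) (y : LeftVF A Ω) : Module.End k A :=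
  y.restrictScalars k ∘ₗ
    (LinearMap.toSpanSingleton Aᵐᵒᵖ Ω ξ).restrictScalars k ∘ₗ
      (MulOpposite.opLinearEquiv k).toLinearMap

@[simp] theorem vecAct_apply (x : RightVF A Ω) (a : A) : vecAct D x a = x (D.d a) := rfl

@[simp] theorem matAct_apply (x : RightVF A Ω) (ξ : Ω) (a : A) : matAct k x ξ a = x (a • ξ) := rfl

@[simp] theorem invAct_apply (ξ : Ω) (y : LeftVF A Ω) (a : A) :
    invAct k ξ y a = y (op a • ξ) := rfl

/-- The relations for `x` become the Leibniz rule. The two inverse relations become `y` applied to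
the expansion of `bξ` and `x` applied to the expansion of `ξb`. -/
theorem act_rel (z w : Module.End k A)
    (h : ILRel D (LinearMap.mulLeft k) (LinearMap.mulRight k) (vecAct D) (matAct k) (invAct k) z w) :
    z = w := by
  cases h <;> ext b
  case p_mul_m B ξ y =>
    have := congrArg y (B.sum_eq (b • ξ))
    simpa [LinearMap.sum_apply] using this
  case m_mul_p B ξ x =>
    have := congrArg x (B.sum_eq (op b • ξ))
    simpa [LinearMap.sum_apply] using this
  case s_mul_p a ξ y => simp [← smul_comm a (op b) ξ]
  all_goals simp [mul_add, add_mul, mul_assoc, mul_smul, D.leibniz, Algebra.commutes,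
    Algebra.smul_def, add_comm, smul_comm]

/-- The action of `IL(Ω)` on `A`. -/
def IL.act : IL D →ₐ[k] Module.End k A := IL.lift _ _ _ _ _ (act_rel D)

@[simp] theorem IL.act_s (a b : A) : IL.act D (IL.s D a) b = a * b := by simp [IL.act]

@[simp] theorem IL.act_t (a b : A) : IL.act D (IL.t D (op a)) b = b * a := by simp [IL.act]

@[simp] theorem IL.act_vec (x : RightVF A Ω) (a : A) : IL.act D (IL.vec D x) a = x (D.d a) := by
  simp [IL.act]

@[simp] theorem IL.act_mat (x : RightVF A Ω) (ξ : Ω) (a : A) :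
    IL.act D (IL.mat D x ξ) a = x (a • ξ) := by
  simp [IL.act]

@[simp] theorem IL.act_inv (ξ : Ω) (y : LeftVF A Ω) (a : A) :
    IL.act D (IL.inv D ξ y) a = y (op a • ξ) := by
  simp [IL.act]

/-- The counit of `IL(Ω)`. -/
def IL.counit : IL D →ₗ[k] A := LinearMap.applyₗ (1 : A) ∘ₗ (IL.act D).toLinearMap

theorem IL.counit_apply (X : IL D) : IL.counit D X = IL.act D X 1 := rfl

/-- The right side depends on `Y` only through `ε(Y)`, and `s(ε(Y))` and `t(ε(Y))` have the same
counit as `Y`; this is the source of `counit_mul_s` and `counit_mul_t`. -/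
theorem IL.counit_mul (X Y : IL D) : IL.counit D (X * Y) = IL.act D X (IL.counit D Y) := by
  simp [IL.counit_apply]

end Counit

/-! ### The Takeuchi product and its action on the balanced tensor square. -/

section Takeuchi

variable {k : Type u} {A : Type v} {L : Type w} [CommRing k] [Ring A] [Algebra k A]
  [Ring L] [Algebra k L] {s : A →ₐ[k] L} {t : Aᵐᵒᵖ →ₐ[k] L}

theorem mk_t_mul_tmul (a : A) (c c' : L) :
    Balanced.mk (leftL s) (leftR t) ((t (op a) * c) ⊗ₜ c') =
      Balanced.mk (leftL s) (leftR t) (c ⊗ₜ (s a * c')) :=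
  (Submodule.Quotient.eq _).mpr (Submodule.subset_span ⟨a, c, c', rfl⟩)

/-- Both actions are left multiplications, so the balancing relations form a right ideal of `L ⊗ L`.
-/
theorem mul_mem_balancing {u : L ⊗[k] L} (hu : u ∈ balancing (leftL s) (leftR t)) (w : L ⊗[k] L) :
    u * w ∈ balancing (leftL s) (leftR t) := by
  induction hu using Submodule.span_induction with
  | mem z hz =>
    obtain ⟨a, c, c', rfl⟩ := hz
    induction w with
    | zero => simp
    | tmul p q =>
      refine Submodule.subset_span ⟨a, c * p, c' * q, ?_⟩
      simp [sub_mul, mul_assoc]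
    | add w w' h h' => rw [mul_add]; exact add_mem h h'
  | zero => simp
  | add z z' _ _ h h' => rw [add_mul]; exact add_mem h h'
  | smul r z _ h => rw [smul_mul_assoc]; exact Submodule.smul_mem _ r h

theorem mk_mul_congr_left {u u' : L ⊗[k] L}
    (h : Balanced.mk (leftL s) (leftR t) u = Balanced.mk (leftL s) (leftR t) u') (w : L ⊗[k] L) :
    Balanced.mk (leftL s) (leftR t) (u * w) = Balanced.mk (leftL s) (leftR t) (u' * w) := by
  refine (Submodule.Quotient.eq _).mpr ?_
  rw [← sub_mul]
  exact mul_mem_balancing ((Submodule.Quotient.eq _).mp h) w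

/-- A balancing relation is `(t(a) ⊗ 1 - 1 ⊗ s(a))(c ⊗ c')`. The Takeuchi condition puts `u(t(a) ⊗ 1
- 1 ⊗ s(a))` in the balancing submodule, which is a right ideal and so absorbs `c ⊗ c'`. -/
theorem mul_mem_balancing_of_takeuchi {u : L ⊗[k] L}
    (hu : ∀ a, Balanced.mk (leftL s) (leftR t) (u * (t (op a) ⊗ₜ 1)) =
      Balanced.mk (leftL s) (leftR t) (u * (1 ⊗ₜ s a)))
    {w : L ⊗[k] L} (hw : w ∈ balancing (leftL s) (leftR t)) :
    u * w ∈ balancing (leftL s) (leftR t) := by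
  induction hw using Submodule.span_induction with
  | mem z hz =>
    obtain ⟨a, c, c', rfl⟩ := hz
    have := mul_mem_balancing ((Submodule.Quotient.eq _).mp (hu a)) (c ⊗ₜ c')
    simpa [sub_mul, mul_sub, mul_assoc] using this
  | zero => simp
  | add z z' _ _ h h' => rw [mul_add]; exact add_mem h h'
  | smul r z _ h => rw [mul_smul_comm]; exact Submodule.smul_mem _ r h

variable (s t) in
/-- The representatives in `L ⊗ L` of the elements of the Takeuchi product. -/
def takeuchi : Subalgebra k (L ⊗[k] L) where
  carrier := {u | ∀ a, Balanced.mk (leftL s) (leftR t) (u * (t (op a) ⊗ₜ 1)) =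
      Balanced.mk (leftL s) (leftR t) (u * (1 ⊗ₜ s a))}
  mul_mem' {u w} hu hw a := by
    have := mul_mem_balancing_of_takeuchi hu ((Submodule.Quotient.eq _).mp (hw a))
    rw [mul_sub, ← mul_assoc, ← mul_assoc] at this
    exact (Submodule.Quotient.eq _).mpr this
  add_mem' {u w} hu hw a := by
    rw [add_mul, add_mul, map_add, map_add, hu a, hw a]
  algebraMap_mem' r a := by
    have := mk_t_mul_tmul (s := s) (t := t) a 1 1
    simp only [mul_one] at this
    rw [← Algebra.smul_def, ← Algebra.smul_def, map_smul, map_smul, this]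

variable (s t) in
/-- The action of the Takeuchi product on `L ⊗_A L` by left multiplication. -/
def takeuchiAct : takeuchi s t →ₐ[k] Module.End k (Balanced (leftL s) (leftR t)) :=
  AlgHom.ofLinearMap
    { toFun u := Submodule.mapQ _ _ (LinearMap.mulLeft k u.1)
        fun _ hw => mul_mem_balancing_of_takeuchi u.2 hw
      map_add' u w := Submodule.linearMap_qext _ <| LinearMap.ext fun x =>
        (congrArg (Balanced.mk _ _) (add_mul u.1 w.1 x)).trans (map_add _ _ _)
      map_smul' r u := Submodule.linearMap_qext _ <| LinearMap.ext fun x =>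
        (congrArg (Balanced.mk _ _) (smul_mul_assoc r u.1 x)).trans (map_smul _ _ _) }
    (Submodule.linearMap_qext _ <| LinearMap.ext fun x => congrArg (Balanced.mk _ _) (one_mul x))
    (fun u w => Submodule.linearMap_qext _ <| LinearMap.ext fun x =>
      congrArg (Balanced.mk _ _) (mul_assoc u.1 w.1 x))

@[simp] theorem takeuchiAct_mk (u : takeuchi s t) (w : L ⊗[k] L) :
    takeuchiAct s t u (Balanced.mk (leftL s) (leftR t) w) =
      Balanced.mk (leftL s) (leftR t) (u.1 * w) := rfl

/-- Equality in `L ⊗_A L` becomes equality of endomorphisms. A relation that fails in `L ⊗ L` but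
holds after balancing can therefore be used to define a homomorphism. -/
theorem takeuchiAct_eq {u u' : takeuchi s t}
    (h : Balanced.mk (leftL s) (leftR t) u.1 = Balanced.mk (leftL s) (leftR t) u'.1) :
    takeuchiAct s t u = takeuchiAct s t u' := by
  refine LinearMap.ext fun z => ?_
  obtain ⟨w, rfl⟩ := Submodule.mkQ_surjective _ z
  exact mk_mul_congr_left h w

end Takeuchi

/-! ### The coproduct on the free algebra and its compatibility with the relations. -/

section Coproduct

variable {k : Type u} {A : Type v} {Ω : Type w} [CommRing k] [Ring A] [Algebra k A]
  [AddCommGroup Ω] [Module k Ω] [Module A Ω] [Module Aᵐᵒᵖ Ω] [SMulCommClass A Aᵐᵒᵖ Ω]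
  (D : FODC k A Ω) (B : RightDualBasis A Ω) (B' : LeftDualBasis A Ω)

/-- The projection `L ⊗ L → L ⊗_A L` for `L = IL(Ω)`. -/
abbrev IL.mk₂ : IL D ⊗[k] IL D →ₗ[k] Balanced (leftL (IL.s D)) (leftR (IL.t D)) :=
  Balanced.mk (leftL (IL.s D)) (leftR (IL.t D))

variable (k) in
/-- The coproduct on the free algebra on the generators of `IL(Ω)`, given by dual bases. -/
def freeComul : FreeAlgebra k (ILGen A Ω) →ₐ[k]
    FreeAlgebra k (ILGen A Ω) ⊗[k] FreeAlgebra k (ILGen A Ω) :=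
  FreeAlgebra.lift k fun
    | .src a => FreeAlgebra.ι k (.src a) ⊗ₜ 1
    | .tgt a => 1 ⊗ₜ FreeAlgebra.ι k (.tgt a)
    | .vec x => FreeAlgebra.ι k (.vec x) ⊗ₜ 1 +
        ∑ i, FreeAlgebra.ι k (.mat x (B.ω i)) ⊗ₜ FreeAlgebra.ι k (.vec (B.x i))
    | .mat x ξ => ∑ i, FreeAlgebra.ι k (.mat x (B.ω i)) ⊗ₜ FreeAlgebra.ι k (.mat (B.x i) ξ)
    | .inv ξ y => ∑ j, FreeAlgebra.ι k (.inv ξ (B'.y j)) ⊗ₜ FreeAlgebra.ι k (.inv (B'.η j) y)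

/-- Both sides are algebra maps, so generators suffice. For fixed dual bases the generators
comultiply like matrix entries, and coassociativity is an exchange of two finite sums, with no
quotient involved. -/
theorem freeComul_coassoc :
    (Algebra.TensorProduct.assoc k k k _ _ _).toAlgHom.comp
      ((Algebra.TensorProduct.map (freeComul k B B') (AlgHom.id k _)).comp (freeComul k B B')) =
    (Algebra.TensorProduct.map (AlgHom.id k _) (freeComul k B B')).comp (freeComul k B B') := by
  refine FreeAlgebra.hom_ext (funext fun g => ?_)
  cases g
  case src a => simp [freeComul, Algebra.TensorProduct.one_def]
  case tgt a => simp [freeComul, Algebra.TensorProduct.one_def]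
  case vec x =>
    simp only [freeComul, Function.comp_apply, AlgHom.comp_apply, FreeAlgebra.lift_ι_apply, map_add,
      map_sum, Algebra.TensorProduct.map_tmul, AlgHom.id_apply, map_one, TensorProduct.add_tmul,
      TensorProduct.sum_tmul, TensorProduct.tmul_add, TensorProduct.tmul_sum, AlgEquiv.toAlgHom_apply,
      Algebra.TensorProduct.assoc_tmul, Algebra.TensorProduct.one_def, Finset.sum_add_distrib]
    rw [add_assoc]
    congr 2
    exact Finset.sum_comm
  case mat x ξ =>
    simp only [freeComul, Function.comp_apply, AlgHom.comp_apply, FreeAlgebra.lift_ι_apply,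
      map_sum, Algebra.TensorProduct.map_tmul, AlgHom.id_apply,
      TensorProduct.sum_tmul, TensorProduct.tmul_sum, AlgEquiv.toAlgHom_apply,
      Algebra.TensorProduct.assoc_tmul]
    exact Finset.sum_comm
  case inv ξ y =>
    simp only [freeComul, Function.comp_apply, AlgHom.comp_apply, FreeAlgebra.lift_ι_apply,
      map_sum, Algebra.TensorProduct.map_tmul, AlgHom.id_apply,
      TensorProduct.sum_tmul, TensorProduct.tmul_sum, AlgEquiv.toAlgHom_apply,
      Algebra.TensorProduct.assoc_tmul]
    exact Finset.sum_comm

/-- The coproduct of the free algebra, projected to `IL(Ω) ⊗ IL(Ω)`. -/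
def comulRep : FreeAlgebra k (ILGen A Ω) →ₐ[k] IL D ⊗[k] IL D :=
  (Algebra.TensorProduct.map (IL.proj D) (IL.proj D)).comp (freeComul k B B')

@[simp] theorem comulRep_src (a : A) :
    comulRep D B B' (FreeAlgebra.ι k (.src a)) = IL.s D a ⊗ₜ 1 := by
  simp [comulRep, freeComul]; rfl

@[simp] theorem comulRep_tgt (a : A) :
    comulRep D B B' (FreeAlgebra.ι k (.tgt a)) = 1 ⊗ₜ IL.t D (op a) := by
  simp [comulRep, freeComul]; rfl

@[simp] theorem comulRep_vec (x : RightVF A Ω) :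
    comulRep D B B' (FreeAlgebra.ι k (.vec x)) =
      IL.vec D x ⊗ₜ 1 + ∑ i, IL.mat D x (B.ω i) ⊗ₜ IL.vec D (B.x i) := by
  simp [comulRep, freeComul]; rfl

@[simp] theorem comulRep_mat (x : RightVF A Ω) (ξ : Ω) :
    comulRep D B B' (FreeAlgebra.ι k (.mat x ξ)) =
      ∑ i, IL.mat D x (B.ω i) ⊗ₜ IL.mat D (B.x i) ξ := by
  simp [comulRep, freeComul]; rfl

@[simp] theorem comulRep_inv (ξ : Ω) (y : LeftVF A Ω) :
    comulRep D B B' (FreeAlgebra.ι k (.inv ξ y)) =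
      ∑ j, IL.inv D ξ (B'.y j) ⊗ₜ IL.inv D (B'.η j) y := by
  simp [comulRep, freeComul]; rfl

/-- This and the next two lemmas say that the summands of the coproduct are balanced in the
contracted pair, as `sum_smul` and `sum_eq_sum` require. -/
theorem mk_mat_tmul_mat_balanced (x : RightVF A Ω) (ξ ω : Ω) (x' : RightVF A Ω) (a : A) :
    IL.mk₂ D (IL.mat D x (op a • ω) ⊗ₜ IL.mat D x' ξ) =
      IL.mk₂ D (IL.mat D x ω ⊗ₜ IL.mat D (x'.lact a) ξ) := by
  rw [← IL.t_mul_mat, mk_t_mul_tmul, IL.s_mul_mat]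

theorem mk_mat_tmul_vec_balanced (x : RightVF A Ω) (ω : Ω) (x' : RightVF A Ω) (a : A) :
    IL.mk₂ D (IL.mat D x (op a • ω) ⊗ₜ IL.vec D x') =
      IL.mk₂ D (IL.mat D x ω ⊗ₜ IL.vec D (x'.lact a)) := by
  rw [← IL.t_mul_mat, mk_t_mul_tmul, IL.s_mul_vec]

theorem mk_inv_tmul_inv_balanced (ξ η : Ω) (y y' : LeftVF A Ω) (a : A) :
    IL.mk₂ D (IL.inv D ξ y' ⊗ₜ IL.inv D (a • η) y) =
      IL.mk₂ D (IL.inv D ξ (y'.ract a) ⊗ₜ IL.inv D η y) := by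
  rw [← IL.s_mul_inv, ← mk_t_mul_tmul, IL.t_mul_inv]

/-- `takeuchi` is a subalgebra, so generators suffice; on matrix generators the condition is the
centrality of the coevaluation. -/
theorem comulRep_mem_takeuchi (z : FreeAlgebra k (ILGen A Ω)) :
    comulRep D B B' z ∈ takeuchi (IL.s D) (IL.t D) := by
  induction z using FreeAlgebra.induction with
  | grade0 r => rw [AlgHom.commutes]; exact Subalgebra.algebraMap_mem _ r
  | mul z w hz hw => rw [map_mul]; exact mul_mem hz hw
  | add z w hz hw => rw [map_add]; exact add_mem hz hw
  | grade1 g =>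
    intro a
    cases g
    case src b =>
      have := mk_t_mul_tmul (s := IL.s D) (t := IL.t D) a (IL.s D b) 1
      simpa [IL.s_comm_t] using this
    case tgt b =>
      have := mk_t_mul_tmul (s := IL.s D) (t := IL.t D) a 1 (IL.t D (op b))
      simpa [IL.s_comm_t] using this
    case mat x ξ =>
      simp only [comulRep_mat, Finset.sum_mul, Algebra.TensorProduct.tmul_mul_tmul, mul_one,
        IL.mat_mul_t, IL.mat_mul_s, map_sum]
      exact B.sum_smul (fun ω x' => IL.mk₂ D (IL.mat D x ω ⊗ₜ IL.mat D x' ξ))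
        (fun _ _ _ => by rw [IL.mat_add_right, TensorProduct.add_tmul, map_add])
        (fun _ _ _ => by rw [IL.mat_add_left, TensorProduct.tmul_add, map_add])
        (fun _ _ _ => mk_mat_tmul_mat_balanced ..) a
    case inv ξ y =>
      simp only [comulRep_inv, Finset.sum_mul, Algebra.TensorProduct.tmul_mul_tmul, mul_one,
        IL.inv_mul_t, IL.inv_mul_s, map_sum]
      exact (B'.sum_smul (fun η y' => IL.mk₂ D (IL.inv D ξ y' ⊗ₜ IL.inv D η y))
        (fun _ _ _ => by rw [IL.inv_add_left, TensorProduct.tmul_add, map_add])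
        (fun _ _ _ => by rw [IL.inv_add_right, TensorProduct.add_tmul, map_add])
        (fun _ _ _ => mk_inv_tmul_inv_balanced ..) a).symm
    case vec x =>
      simp only [comulRep_vec, add_mul, Finset.sum_mul, Algebra.TensorProduct.tmul_mul_tmul,
        mul_one, one_mul, IL.mat_mul_t, IL.vec_mul_t, IL.vec_mul_s, map_add, map_sum,
        TensorProduct.add_tmul, TensorProduct.tmul_add, Finset.sum_add_distrib]
      have h₁ := mk_t_mul_tmul (s := IL.s D) (t := IL.t D) a (IL.vec D x) 1
      -- The derivative terms on the two sides, coming from `x_i • a` in the second leg and from `x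
      -- • a̲` in the first, agree by expanding `da` in the dual basis.
      have h₂ : ∑ i, IL.mk₂ D (IL.mat D x (B.ω i) ⊗ₜ IL.s D (B.x i (D.d a))) =
          IL.mk₂ D (IL.mat D x (D.d a) ⊗ₜ 1) := by
        conv_rhs => rw [← B.sum_eq (D.d a), IL.mat_sum_right, TensorProduct.sum_tmul, map_sum]
        refine Finset.sum_congr rfl fun i _ => ?_
        rw [← IL.t_mul_mat, mk_t_mul_tmul, mul_one]
      have h₃ := B.sum_smul (fun ω x' => IL.mk₂ D (IL.mat D x ω ⊗ₜ IL.vec D x'))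
        (fun _ _ _ => by rw [IL.mat_add_right, TensorProduct.add_tmul, map_add])
        (fun _ _ _ => by rw [IL.vec_add, TensorProduct.tmul_add, map_add])
        (fun _ _ _ => mk_mat_tmul_vec_balanced ..) a
      rw [mul_one] at h₁
      rw [h₁, h₂, h₃]
      abel

/-- Only the two inverse relations need the balancing; all others hold already in `L ⊗ L`. -/
theorem comulRep_rel {z w : IL D ⊗[k] IL D}
    (h : ILRel D (fun a => comulRep D B B' (FreeAlgebra.ι k (.src a)))
      (fun a => comulRep D B B' (FreeAlgebra.ι k (.tgt a)))
      (fun x => comulRep D B B' (FreeAlgebra.ι k (.vec x)))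
      (fun x ξ => comulRep D B B' (FreeAlgebra.ι k (.mat x ξ)))
      (fun ξ y => comulRep D B B' (FreeAlgebra.ι k (.inv ξ y))) z w) :
    IL.mk₂ D z = IL.mk₂ D w := by
  cases h
  case p_mul_m B₁ ξ y =>
    simp only [comulRep_inv, comulRep_mat, comulRep_tgt]
    -- In the first leg the sum over `i` is the same relation in `IL D` and collapses to
    -- `t(y_j(ω_l))`. Balancing moves this to `s(y_j(ω_l))` in the second leg, where the sum over
    -- `j` restores `ω_l`. The other inverse relation is the mirror image.
    have h₁ : ∑ i, (∑ j, IL.inv D (B₁.ω i) (B'.y j) ⊗ₜ[k] IL.inv D (B'.η j) y) *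
          (∑ l, IL.mat D (B₁.x i) (B.ω l) ⊗ₜ[k] IL.mat D (B.x l) ξ) =
        ∑ l, ∑ j, (IL.t D (op (B'.y j (B.ω l))) * 1) ⊗ₜ
          (IL.inv D (B'.η j) y * IL.mat D (B.x l) ξ) := by
      simp only [Finset.sum_mul_sum, Algebra.TensorProduct.tmul_mul_tmul]
      rw [Finset.sum_comm]
      conv_rhs => rw [Finset.sum_comm]
      refine Finset.sum_congr rfl fun j _ => ?_
      rw [Finset.sum_comm]
      refine Finset.sum_congr rfl fun l _ => ?_
      rw [← TensorProduct.sum_tmul, IL.inv_mul_mat, mul_one]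
    rw [h₁, ← IL.inv_mul_mat B]
    simp only [map_sum, mk_t_mul_tmul, ← mul_assoc, IL.s_mul_inv, TensorProduct.tmul_sum]
    refine Finset.sum_congr rfl fun l _ => ?_
    rw [← map_sum, ← TensorProduct.tmul_sum, ← Finset.sum_mul, ← IL.inv_sum_left, B'.sum_eq]
  case m_mul_p B₁ ξ x =>
    simp only [comulRep_inv, comulRep_mat, comulRep_src]
    have h₁ : ∑ i, (∑ l, IL.mat D x (B.ω l) ⊗ₜ[k] IL.mat D (B.x l) (B₁.η i)) *
          (∑ j, IL.inv D ξ (B'.y j) ⊗ₜ[k] IL.inv D (B'.η j) (B₁.y i)) =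
        ∑ j, ∑ l, (IL.mat D x (B.ω l) * IL.inv D ξ (B'.y j)) ⊗ₜ
          (IL.s D (B.x l (B'.η j)) * 1) := by
      simp only [Finset.sum_mul_sum, Algebra.TensorProduct.tmul_mul_tmul]
      rw [Finset.sum_comm]
      conv_rhs => rw [Finset.sum_comm]
      refine Finset.sum_congr rfl fun j _ => ?_
      rw [Finset.sum_comm]
      refine Finset.sum_congr rfl fun l _ => ?_
      rw [← TensorProduct.tmul_sum, IL.mat_mul_inv, mul_one]
    rw [h₁, ← IL.mat_mul_inv B']
    simp only [map_sum, ← mk_t_mul_tmul, ← mul_assoc, IL.t_mul_mat, TensorProduct.sum_tmul]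
    refine Finset.sum_congr rfl fun l _ => ?_
    rw [← map_sum, ← TensorProduct.sum_tmul, ← Finset.sum_mul, ← IL.mat_sum_right, B.sum_eq]
  case t_algebraMap c =>
    have h₁ : IL.t D (op (algebraMap k A c)) = algebraMap k _ c := (IL.t D).commutes c
    rw [comulRep_tgt, h₁, Algebra.algebraMap_eq_smul_one, Algebra.algebraMap_eq_smul_one,
      TensorProduct.tmul_smul, Algebra.TensorProduct.one_def]
  case v_add x x' | v_mul_s a x | v_mul_t a x =>
    simp only [comulRep_vec, comulRep_src, comulRep_tgt, comulRep_mat, mul_add, add_mul,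
      Finset.mul_sum, Finset.sum_mul, TensorProduct.add_tmul, TensorProduct.tmul_add,
      Finset.sum_add_distrib, Algebra.TensorProduct.tmul_mul_tmul, mul_one, one_mul, IL.vec_add,
      IL.mat_add_left, IL.mat_mul_s, IL.vec_mul_s, IL.vec_mul_t]
    congr 1
    abel
  all_goals
    simp [mul_add, Finset.mul_sum, Finset.sum_mul, TensorProduct.add_tmul,
      TensorProduct.tmul_add, Finset.sum_add_distrib, Algebra.TensorProduct.algebraMap_apply,
      IL.mat_add_left, IL.mat_add_right, IL.inv_add_left, IL.inv_add_right,
      IL.s_mul_mat, IL.mat_mul_s, IL.t_mul_mat, IL.mat_mul_t, IL.s_mul_inv, IL.inv_mul_s,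
      IL.t_mul_inv, IL.inv_mul_t, IL.s_mul_vec]

end Coproduct

/-! ### `Δ ⊗ id` and `id ⊗ Δ` on balanced tensors. -/

section JoinMaps

variable {k : Type u} {A : Type v} {C : Type w} [CommRing k] [Ring A] [Algebra k A]
  [AddCommGroup C] [Module k C] {l r : A → C →ₗ[k] C}

theorem joinLeft_mk_tmul (u : C ⊗[k] C) (c : C) :
    joinLeft l r (Balanced.mk l r u ⊗ₜ c) =
      (balancing₃ l r).mkQ (TensorProduct.assoc k C C C (u ⊗ₜ c)) := rfl

theorem joinRight_tmul_mk (c : C) (u : C ⊗[k] C) :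
    joinRight l r (c ⊗ₜ Balanced.mk l r u) = (balancing₃ l r).mkQ (c ⊗ₜ u) := rfl

theorem joinLeft_right_tmul (a : A) (u : C ⊗[k] C) (c : C) :
    joinLeft l r (Balanced.mk l r (TensorProduct.map LinearMap.id (r a) u) ⊗ₜ c) =
      joinLeft l r (Balanced.mk l r u ⊗ₜ l a c) := by
  rw [joinLeft_mk_tmul, joinLeft_mk_tmul]
  induction u with
  | zero => simp
  | add u w hu hw => simp only [map_add, TensorProduct.add_tmul, hu, hw]
  | tmul p q =>
    exact (Submodule.Quotient.eq _).mpr (Submodule.subset_span (Or.inr ⟨a, p, q, c, rfl⟩))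

theorem joinRight_left_tmul (a : A) (c : C) (u : C ⊗[k] C) :
    joinRight l r (r a c ⊗ₜ Balanced.mk l r u) =
      joinRight l r (c ⊗ₜ Balanced.mk l r (TensorProduct.map (l a) LinearMap.id u)) := by
  rw [joinRight_tmul_mk, joinRight_tmul_mk]
  induction u with
  | zero => simp
  | add u w hu hw => simp only [map_add, TensorProduct.tmul_add, hu, hw]
  | tmul p q =>
    exact (Submodule.Quotient.eq _).mpr (Submodule.subset_span (Or.inl ⟨a, c, p, q, rfl⟩))

/-- For bimodule maps `Δ`, the map `Δ ⊗ id` only depends on the class in `C ⊗_A C`. -/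
theorem joinLeft_map_congr {Δ : C →ₗ[k] Balanced l r}
    (hΔ : ∀ (a : A) (c : C) (u : C ⊗[k] C), Balanced.mk l r u = Δ c →
      Δ (r a c) = Balanced.mk l r (TensorProduct.map LinearMap.id (r a) u))
    {u w : C ⊗[k] C} (h : Balanced.mk l r u = Balanced.mk l r w) :
    joinLeft l r (TensorProduct.map Δ LinearMap.id u) =
      joinLeft l r (TensorProduct.map Δ LinearMap.id w) := by
  have h : u - w ∈ balancing l r := (Submodule.Quotient.eq _).mp h
  suffices H : balancing l r ≤ LinearMap.ker (joinLeft l r ∘ₗ TensorProduct.map Δ LinearMap.id) by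
    have := H h
    rwa [LinearMap.mem_ker, map_sub, sub_eq_zero] at this
  refine Submodule.span_le.mpr ?_
  rintro _ ⟨a, c, c', rfl⟩
  obtain ⟨v, hv⟩ := Submodule.mkQ_surjective _ (Δ c)
  simp only [SetLike.mem_coe, LinearMap.mem_ker, LinearMap.comp_apply, map_sub,
    TensorProduct.map_tmul, LinearMap.id_apply, hΔ a c v hv]
  rw [joinLeft_right_tmul, sub_eq_zero, ← hv]

/-- For bimodule maps `Δ`, the map `id ⊗ Δ` only depends on the class in `C ⊗_A C`. -/
theorem joinRight_map_congr {Δ : C →ₗ[k] Balanced l r}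
    (hΔ : ∀ (a : A) (c : C) (u : C ⊗[k] C), Balanced.mk l r u = Δ c →
      Δ (l a c) = Balanced.mk l r (TensorProduct.map (l a) LinearMap.id u))
    {u w : C ⊗[k] C} (h : Balanced.mk l r u = Balanced.mk l r w) :
    joinRight l r (TensorProduct.map LinearMap.id Δ u) =
      joinRight l r (TensorProduct.map LinearMap.id Δ w) := by
  have h : u - w ∈ balancing l r := (Submodule.Quotient.eq _).mp h
  suffices H : balancing l r ≤ LinearMap.ker (joinRight l r ∘ₗ TensorProduct.map LinearMap.id Δ) by
    have := H h
    rwa [LinearMap.mem_ker, map_sub, sub_eq_zero] at this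
  refine Submodule.span_le.mpr ?_
  rintro _ ⟨a, c, c', rfl⟩
  obtain ⟨v, hv⟩ := Submodule.mkQ_surjective _ (Δ c')
  simp only [SetLike.mem_coe, LinearMap.mem_ker, LinearMap.comp_apply, map_sub,
    TensorProduct.map_tmul, LinearMap.id_apply, hΔ a c' v hv]
  rw [← joinRight_left_tmul, sub_eq_zero, ← hv]

end JoinMaps

/-! ### Contraction of one leg by a counit. -/

section CounitMaps

variable {k : Type u} {A : Type v} {L : Type w} [CommRing k] [Ring A] [Algebra k A]
  [Ring L] [Algebra k L] (s : A →ₐ[k] L) (t : Aᵐᵒᵖ →ₐ[k] L) (ε : L →ₗ[k] A)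

/-- The map `p ⊗ q ↦ s(ε(p)) q`. -/
def counitLeft : L ⊗[k] L →ₗ[k] L :=
  TensorProduct.lift (LinearMap.mul k L ∘ₗ s.toLinearMap ∘ₗ ε)

/-- The map `p ⊗ q ↦ t(ε(q)) p`. -/
def counitRight : L ⊗[k] L →ₗ[k] L :=
  TensorProduct.lift
    (LinearMap.mul k L ∘ₗ t.toLinearMap ∘ₗ (MulOpposite.opLinearEquiv k).toLinearMap ∘ₗ ε).flip

@[simp] theorem counitLeft_tmul (p q : L) : counitLeft s ε (p ⊗ₜ q) = s (ε p) * q := rfl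

@[simp] theorem counitRight_tmul (p q : L) : counitRight t ε (p ⊗ₜ q) = t (op (ε q)) * p := rfl

variable {s t ε}

theorem counitLeft_congr (hε : ∀ a X, ε (t (op a) * X) = ε X * a) {u w : L ⊗[k] L}
    (h : Balanced.mk (leftL s) (leftR t) u = Balanced.mk (leftL s) (leftR t) w) :
    counitLeft s ε u = counitLeft s ε w := by
  have h : u - w ∈ balancing (leftL s) (leftR t) := (Submodule.Quotient.eq _).mp h
  suffices H : balancing (leftL s) (leftR t) ≤ LinearMap.ker (counitLeft s ε) by
    have := H h
    rwa [LinearMap.mem_ker, map_sub, sub_eq_zero] at this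
  refine Submodule.span_le.mpr ?_
  rintro _ ⟨a, c, c', rfl⟩
  simp [hε, mul_assoc]

theorem counitRight_congr (hε : ∀ a X, ε (s a * X) = a * ε X) {u w : L ⊗[k] L}
    (h : Balanced.mk (leftL s) (leftR t) u = Balanced.mk (leftL s) (leftR t) w) :
    counitRight t ε u = counitRight t ε w := by
  have h : u - w ∈ balancing (leftL s) (leftR t) := (Submodule.Quotient.eq _).mp h
  suffices H : balancing (leftL s) (leftR t) ≤ LinearMap.ker (counitRight t ε) by
    have := H h
    rwa [LinearMap.mem_ker, map_sub, sub_eq_zero] at this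
  refine Submodule.span_le.mpr ?_
  rintro _ ⟨a, c, c', rfl⟩
  simp [hε, mul_assoc]

theorem map_mulLeft_id (a : L) (u : L ⊗[k] L) :
    TensorProduct.map (LinearMap.mulLeft k a) LinearMap.id u = (a ⊗ₜ 1) * u := by
  induction u with
  | zero => simp
  | add u w hu hw => rw [map_add, hu, hw, mul_add]
  | tmul p q => simp

theorem map_id_mulLeft (a : L) (u : L ⊗[k] L) :
    TensorProduct.map LinearMap.id (LinearMap.mulLeft k a) u = (1 ⊗ₜ a) * u := by
  induction u with
  | zero => simp
  | add u w hu hw => rw [map_add, hu, hw, mul_add]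
  | tmul p q => simp

end CounitMaps

/-! ### The left bialgebroid `IL`. -/

section LeftStructure

variable {k : Type u} {A : Type v} {Ω : Type w} [CommRing k] [Ring A] [Algebra k A]
  [AddCommGroup Ω] [Module k Ω] [Module A Ω] [Module Aᵐᵒᵖ Ω] [SMulCommClass A Aᵐᵒᵖ Ω]
  (D : FODC k A Ω) (B : RightDualBasis A Ω) (B' : LeftDualBasis A Ω)

/-- Left multiplication by the coproduct on `L ⊗_A L` for `L = IL(Ω)`. -/
def IL.comulAct : IL D →ₐ[k] Module.End k (Balanced (leftL (IL.s D)) (leftR (IL.t D))) :=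
  RingQuot.liftAlgHom k
    ⟨(takeuchiAct _ _).comp ((comulRep D B B').codRestrict _ (comulRep_mem_takeuchi D B B')),
      fun _ _ h => takeuchiAct_eq (comulRep_rel D B B' (h.map (comulRep D B B')))⟩

theorem IL.comulAct_proj (z : FreeAlgebra k (ILGen A Ω)) (w : IL D ⊗[k] IL D) :
    IL.comulAct D B B' (IL.proj D z) (IL.mk₂ D w) = IL.mk₂ D (comulRep D B B' z * w) := by
  have : IL.comulAct D B B' (IL.proj D z) =
      takeuchiAct _ _ ⟨_, comulRep_mem_takeuchi D B B' z⟩ :=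
    RingQuot.liftAlgHom_mkAlgHom_apply ..
  rw [this, takeuchiAct_mk]

/-- The coproduct of `IL(Ω)`. -/
def IL.comul : IL D →ₗ[k] Balanced (leftL (IL.s D)) (leftR (IL.t D)) :=
  LinearMap.applyₗ (IL.mk₂ D 1) ∘ₗ (IL.comulAct D B B').toLinearMap

theorem IL.comul_proj (z : FreeAlgebra k (ILGen A Ω)) :
    IL.comul D B B' (IL.proj D z) = IL.mk₂ D (comulRep D B B' z) :=
  (IL.comulAct_proj D B B' z 1).trans (by rw [mul_one])

/-- Since `Δ(X) = X·(1 ⊗ 1)`, one has `Δ(XY) = X·Δ(Y)`, and `X` acts as left multiplication by any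
representative of `Δ(X)`. -/
theorem IL.comul_mul (X Y : IL D) (u w : IL D ⊗[k] IL D) (hu : IL.mk₂ D u = IL.comul D B B' X)
    (hw : IL.mk₂ D w = IL.comul D B B' Y) :
    IL.comul D B B' (X * Y) = IL.mk₂ D (u * w) := by
  obtain ⟨z, rfl⟩ := IL.proj_surjective X
  have : IL.comul D B B' (IL.proj D z * Y) =
      IL.comulAct D B B' (IL.proj D z) (IL.comul D B B' Y) := by
    simp [IL.comul]
  rw [this, ← hw, IL.comulAct_proj]
  rw [IL.comul_proj] at hu
  exact mk_mul_congr_left hu.symm w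

theorem IL.comul_s (a : A) : IL.comul D B B' (IL.s D a) = IL.mk₂ D (IL.s D a ⊗ₜ 1) :=
  (IL.comul_proj D B B' _).trans (by rw [comulRep_src])

theorem IL.comul_t (a : A) : IL.comul D B B' (IL.t D (op a)) = IL.mk₂ D (1 ⊗ₜ IL.t D (op a)) :=
  (IL.comul_proj D B B' _).trans (congrArg (IL.mk₂ D) (comulRep_tgt D B B' a))

theorem IL.comul_vec (x : RightVF A Ω) : IL.comul D B B' (IL.vec D x) =
    IL.mk₂ D (IL.vec D x ⊗ₜ 1 + ∑ i, IL.mat D x (B.ω i) ⊗ₜ IL.vec D (B.x i)) :=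
  (IL.comul_proj D B B' _).trans (by rw [comulRep_vec])

theorem IL.comul_mat (x : RightVF A Ω) (ξ : Ω) : IL.comul D B B' (IL.mat D x ξ) =
    IL.mk₂ D (∑ i, IL.mat D x (B.ω i) ⊗ₜ IL.mat D (B.x i) ξ) :=
  (IL.comul_proj D B B' _).trans (by rw [comulRep_mat])

theorem IL.comul_inv (ξ : Ω) (y : LeftVF A Ω) : IL.comul D B B' (IL.inv D ξ y) =
    IL.mk₂ D (∑ j, IL.inv D ξ (B'.y j) ⊗ₜ IL.inv D (B'.η j) y) :=
  (IL.comul_proj D B B' _).trans (by rw [comulRep_inv])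

/-- A case of multiplicativity, because `Δ(s(a)) = s(a) ⊗ 1`. Likewise `comul_right` uses `Δ(t(a)) =
1 ⊗ t(a)`. -/
theorem IL.comul_left (a : A) (X : IL D) (u : IL D ⊗[k] IL D)
    (hu : IL.mk₂ D u = IL.comul D B B' X) :
    IL.comul D B B' (leftL (IL.s D) a X) =
      IL.mk₂ D (TensorProduct.map (leftL (IL.s D) a) LinearMap.id u) := by
  rw [map_mulLeft_id]
  exact IL.comul_mul D B B' _ _ _ _ (IL.comul_s D B B' a).symm hu

theorem IL.comul_right (a : A) (X : IL D) (u : IL D ⊗[k] IL D)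
    (hu : IL.mk₂ D u = IL.comul D B B' X) :
    IL.comul D B B' (leftR (IL.t D) a X) =
      IL.mk₂ D (TensorProduct.map LinearMap.id (leftR (IL.t D) a) u) := by
  rw [map_id_mulLeft]
  exact IL.comul_mul D B B' _ _ _ _ (IL.comul_t D B B' a).symm hu

/-- The class in `L ⊗_A L ⊗_A L` of an element of the triple tensor power of the free algebra. -/
def IL.mk₃ : FreeAlgebra k (ILGen A Ω) ⊗[k] (FreeAlgebra k (ILGen A Ω) ⊗[k]
    FreeAlgebra k (ILGen A Ω)) →ₗ[k] Balanced₃ (leftL (IL.s D)) (leftR (IL.t D)) :=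
  (balancing₃ _ _).mkQ ∘ₗ TensorProduct.map (IL.proj D).toLinearMap
    (TensorProduct.map (IL.proj D).toLinearMap (IL.proj D).toLinearMap)

/-- With `joinRight_comul`, this lifts both sides of coassociativity to the free algebra, where
`freeComul_coassoc` applies. -/
theorem IL.joinLeft_comul (Z : FreeAlgebra k (ILGen A Ω) ⊗[k] FreeAlgebra k (ILGen A Ω)) :
    joinLeft (leftL (IL.s D)) (leftR (IL.t D)) (TensorProduct.map (IL.comul D B B') LinearMap.id
      (Algebra.TensorProduct.map (IL.proj D) (IL.proj D) Z)) =
    IL.mk₃ D (Algebra.TensorProduct.assoc k k k _ _ _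
      (Algebra.TensorProduct.map (freeComul k B B') (AlgHom.id k _) Z)) := by
  induction Z with
  | zero => simp
  | add Z W hZ hW => simp only [map_add, hZ, hW]
  | tmul p q =>
    simp only [Algebra.TensorProduct.map_tmul, TensorProduct.map_tmul, IL.comul_proj, comulRep,
      LinearMap.id_apply, joinLeft_mk_tmul, AlgHom.comp_apply, AlgHom.id_apply]
    induction freeComul k B B' p with
    | zero => simp
    | add Z W hZ hW => simp only [map_add, TensorProduct.add_tmul, hZ, hW]
    | tmul p p' => rfl

theorem IL.joinRight_comul (Z : FreeAlgebra k (ILGen A Ω) ⊗[k] FreeAlgebra k (ILGen A Ω)) :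
    joinRight (leftL (IL.s D)) (leftR (IL.t D)) (TensorProduct.map LinearMap.id (IL.comul D B B')
      (Algebra.TensorProduct.map (IL.proj D) (IL.proj D) Z)) =
    IL.mk₃ D (Algebra.TensorProduct.map (AlgHom.id k _) (freeComul k B B') Z) := by
  induction Z with
  | zero => simp
  | add Z W hZ hW => simp only [map_add, hZ, hW]
  | tmul p q =>
    simp only [Algebra.TensorProduct.map_tmul, TensorProduct.map_tmul, IL.comul_proj, comulRep,
      LinearMap.id_apply, joinRight_tmul_mk, AlgHom.comp_apply, AlgHom.id_apply]
    induction freeComul k B B' q with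
    | zero => simp
    | add Z W hZ hW => simp only [map_add, TensorProduct.tmul_add, hZ, hW]
    | tmul p p' => rfl

theorem IL.comul_coassoc (X : IL D) (u : IL D ⊗[k] IL D) (hu : IL.mk₂ D u = IL.comul D B B' X) :
    joinLeft (leftL (IL.s D)) (leftR (IL.t D))
        (TensorProduct.map (IL.comul D B B') LinearMap.id u) =
      joinRight (leftL (IL.s D)) (leftR (IL.t D))
        (TensorProduct.map LinearMap.id (IL.comul D B B') u) := by
  obtain ⟨z, rfl⟩ := IL.proj_surjective X
  rw [IL.comul_proj] at hu
  rw [joinLeft_map_congr (IL.comul_right D B B') hu, joinRight_map_congr (IL.comul_left D B B') hu,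
    comulRep, AlgHom.comp_apply, IL.joinLeft_comul, IL.joinRight_comul]
  exact congrArg (IL.mk₃ D) (DFunLike.congr_fun (freeComul_coassoc B B') z)

variable [IsScalarTower k A Ω] [IsScalarTower k Aᵐᵒᵖ Ω]

theorem IL.counit_s_mul (a : A) (X : IL D) :
    IL.counit D (IL.s D a * X) = a * IL.counit D X := by
  simp [IL.counit_mul]

theorem IL.counit_t_mul (a : A) (X : IL D) :
    IL.counit D (IL.t D (op a) * X) = IL.counit D X * a := by
  simp [IL.counit_mul]

/-- The counit is not multiplicative, so the counit axiom alone does not pass to products. Allowing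
any right factor `w` makes the induction on words work; the axiom is the case `w = 1`. -/
theorem IL.counitLeft_comulRep_mul (z : FreeAlgebra k (ILGen A Ω)) (w : IL D ⊗[k] IL D) :
    counitLeft (IL.s D) (IL.counit D) (comulRep D B B' z * w) =
      IL.proj D z * counitLeft (IL.s D) (IL.counit D) w := by
  induction z using FreeAlgebra.induction generalizing w with
  | grade0 r =>
    rw [AlgHom.commutes, AlgHom.commutes, ← Algebra.smul_def, map_smul, Algebra.smul_def]
  | mul z z' h h' => rw [map_mul (comulRep D B B'), mul_assoc, h, h', map_mul, mul_assoc]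
  | add z z' h h' => rw [map_add, add_mul, map_add, h, h', map_add, add_mul]
  | grade1 g =>
    induction w with
    | zero => simp
    | add w w' h h' => rw [mul_add, map_add, map_add, mul_add, h, h']
    | tmul p q =>
      -- Used with `a = ε(p)`. On the right the generator `g` is moved past `s(ε(p))` by a relation;
      -- on the left `counit_mul` lets the first legs act on `ε(p)`. The two agree after summing
      -- over the dual basis.
      have hs (X : IL D) (a : A) (h : IL.proj D (FreeAlgebra.ι k g) * IL.s D a = X) (Y : IL D) :
          IL.proj D (FreeAlgebra.ι k g) * (IL.s D a * Y) = X * Y := by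
        rw [← mul_assoc, h]
      cases g
      case src a =>
        rw [counitLeft_tmul, hs _ _ (map_mul (IL.s D) a _).symm]
        simp [IL.counit_mul]
      case tgt a =>
        rw [counitLeft_tmul, hs _ _ (IL.s_comm_t _ a).symm]
        simp [mul_assoc]
      case vec x =>
        rw [counitLeft_tmul, hs _ _ (IL.vec_mul_s _ x)]
        simp only [comulRep_vec, add_mul, Finset.sum_mul, map_add, map_sum,
          Algebra.TensorProduct.tmul_mul_tmul, counitLeft_tmul, IL.counit_mul, IL.act_vec,
          IL.act_mat, one_mul, ← mul_assoc, IL.s_mul_vec]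
        rw [← Finset.sum_mul, ← IL.vec_sum, add_comm]
        congr 3
        exact B.sum_apply_lact (x.ract _)
      case mat x ξ =>
        rw [counitLeft_tmul, hs _ _ (IL.mat_mul_s _ x ξ)]
        simp only [comulRep_mat, Finset.sum_mul, map_sum, Algebra.TensorProduct.tmul_mul_tmul,
          counitLeft_tmul, IL.counit_mul, IL.act_mat, ← mul_assoc, IL.s_mul_mat]
        rw [← Finset.sum_mul, ← IL.mat_sum_left]
        congr 2
        exact B.sum_apply_lact (x.ract _)
      case inv ξ y =>
        rw [counitLeft_tmul, hs _ _ (IL.inv_mul_s _ ξ y)]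
        simp only [comulRep_inv, Finset.sum_mul, map_sum, Algebra.TensorProduct.tmul_mul_tmul,
          counitLeft_tmul, IL.counit_mul, IL.act_inv, ← mul_assoc, IL.s_mul_inv]
        rw [← Finset.sum_mul, ← IL.inv_sum_left, B'.sum_eq]

theorem IL.counitRight_comulRep_mul (z : FreeAlgebra k (ILGen A Ω)) (w : IL D ⊗[k] IL D) :
    counitRight (IL.t D) (IL.counit D) (comulRep D B B' z * w) =
      IL.proj D z * counitRight (IL.t D) (IL.counit D) w := by
  induction z using FreeAlgebra.induction generalizing w with
  | grade0 r =>
    rw [AlgHom.commutes, AlgHom.commutes, ← Algebra.smul_def, map_smul, Algebra.smul_def]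
  | mul z z' h h' => rw [map_mul (comulRep D B B'), mul_assoc, h, h', map_mul, mul_assoc]
  | add z z' h h' => rw [map_add, add_mul, map_add, h, h', map_add, add_mul]
  | grade1 g =>
    induction w with
    | zero => simp
    | add w w' h h' => rw [mul_add, map_add, map_add, mul_add, h, h']
    | tmul p q =>
      have ht (X : IL D) (a : A) (h : IL.proj D (FreeAlgebra.ι k g) * IL.t D (op a) = X)
          (Y : IL D) : IL.proj D (FreeAlgebra.ι k g) * (IL.t D (op a) * Y) = X * Y := by
        rw [← mul_assoc, h]
      cases g
      case src a =>
        rw [counitRight_tmul, ht _ _ (IL.s_comm_t a _)]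
        simp [mul_assoc]
      case tgt a =>
        rw [counitRight_tmul, ht _ _ (map_mul (IL.t D) (op a) _).symm]
        simp [IL.counit_mul]
      case vec x =>
        rw [counitRight_tmul, ht _ _ (IL.vec_mul_t _ x)]
        simp only [comulRep_vec, add_mul, Finset.sum_mul, map_add, map_sum,
          Algebra.TensorProduct.tmul_mul_tmul, counitRight_tmul, IL.counit_mul, IL.act_vec,
          one_mul, ← mul_assoc, IL.t_mul_mat]
        rw [← Finset.sum_mul, ← IL.mat_sum_right, B.sum_eq]
      case mat x ξ =>
        rw [counitRight_tmul, ht _ _ (IL.mat_mul_t _ x ξ)]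
        simp only [comulRep_mat, Finset.sum_mul, map_sum, Algebra.TensorProduct.tmul_mul_tmul,
          counitRight_tmul, IL.counit_mul, IL.act_mat, ← mul_assoc, IL.t_mul_mat]
        rw [← Finset.sum_mul, ← IL.mat_sum_right, B.sum_eq]
      case inv ξ y =>
        rw [counitRight_tmul, ht _ _ (IL.inv_mul_t _ ξ y)]
        simp only [comulRep_inv, Finset.sum_mul, map_sum, Algebra.TensorProduct.tmul_mul_tmul,
          counitRight_tmul, IL.counit_mul, IL.act_inv, ← mul_assoc, IL.t_mul_inv]
        rw [← Finset.sum_mul, ← IL.inv_sum_right]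
        congr 2
        exact B'.sum_apply_ract (y.lact _)

theorem IL.isCoring :
    IsCoring (leftL (IL.s D)) (leftR (IL.t D)) (IL.comul D B B') (IL.counit D) where
  comul_left := IL.comul_left D B B'
  comul_right := IL.comul_right D B B'
  counit_left := IL.counit_s_mul D
  counit_right := IL.counit_t_mul D
  coassoc := IL.comul_coassoc D B B'
  counit_comul X n p q h := by
    obtain ⟨z, rfl⟩ := IL.proj_surjective X
    rw [IL.comul_proj] at h
    have h₁ := counitLeft_congr (IL.counit_t_mul D) h
    have h₂ := IL.counitLeft_comulRep_mul D B B' z 1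
    rw [mul_one] at h₂
    rw [h₂, Algebra.TensorProduct.one_def] at h₁
    simpa [IL.counit_apply] using h₁
  comul_counit X n p q h := by
    obtain ⟨z, rfl⟩ := IL.proj_surjective X
    rw [IL.comul_proj] at h
    have h₁ := counitRight_congr (IL.counit_s_mul D) h
    have h₂ := IL.counitRight_comulRep_mul D B B' z 1
    rw [mul_one] at h₂
    rw [h₂, Algebra.TensorProduct.one_def] at h₁
    simpa [IL.counit_apply] using h₁

/-- The left bialgebroid `IL(Ω)`. -/
def IL.bialgebroid : LeftBialgebroid (IL.s D) (IL.t D) where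
  comm := IL.s_comm_t
  Δ := IL.comul D B B'
  ε := IL.counit D
  isCoring := IL.isCoring D B B'
  takeuchi X u hu a := by
    obtain ⟨z, rfl⟩ := IL.proj_surjective X
    rw [IL.comul_proj] at hu
    rw [mk_mul_congr_left hu, mk_mul_congr_left hu]
    exact comulRep_mem_takeuchi D B B' z a
  comul_one := by simpa using IL.comul_s D B B' 1
  comul_mul := IL.comul_mul D B B'
  counit_one := by simp [IL.counit_apply]
  counit_mul_s X Y := by simp [IL.counit_mul, IL.counit_apply (X := IL.s D _)]
  counit_mul_t X Y := by simp [IL.counit_mul, IL.counit_apply (X := IL.t D _)]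

/-- The formulas for the chosen `B`, `B'` hold by construction; `sum_eq_sum` extends them to all
dual bases, since the sums are taken modulo balancing. -/
theorem IL.isGhobadiLeft : IsGhobadiLeft D (IL.bialgebroid D B B') where
  comul_s := IL.comul_s D B B'
  comul_t := IL.comul_t D B B'
  comul_vec B₁ x := by
    refine (IL.comul_vec D B B' x).trans ?_
    rw [map_add, map_add, map_sum, map_sum]
    congr 1
    exact B.sum_eq_sum B₁ (fun ω x' => IL.mk₂ D (IL.mat D x ω ⊗ₜ IL.vec D x'))
      (fun _ _ _ => by rw [IL.mat_add_right, TensorProduct.add_tmul, map_add])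
      (fun _ _ _ => by rw [IL.vec_add, TensorProduct.tmul_add, map_add])
      (fun _ _ _ => mk_mat_tmul_vec_balanced ..)
  comul_mat B₁ x ξ := by
    refine (IL.comul_mat D B B' x ξ).trans ?_
    rw [map_sum, map_sum]
    exact B.sum_eq_sum B₁ (fun ω x' => IL.mk₂ D (IL.mat D x ω ⊗ₜ IL.mat D x' ξ))
      (fun _ _ _ => by rw [IL.mat_add_right, TensorProduct.add_tmul, map_add])
      (fun _ _ _ => by rw [IL.mat_add_left, TensorProduct.tmul_add, map_add])
      (fun _ _ _ => mk_mat_tmul_mat_balanced ..)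
  comul_inv B₁ ξ y := by
    refine (IL.comul_inv D B B' ξ y).trans ?_
    rw [map_sum, map_sum]
    exact B'.sum_eq_sum B₁ (fun η y' => IL.mk₂ D (IL.inv D ξ y' ⊗ₜ IL.inv D η y))
      (fun _ _ _ => by rw [IL.inv_add_left, TensorProduct.tmul_add, map_add])
      (fun _ _ _ => by rw [IL.inv_add_right, TensorProduct.add_tmul, map_add])
      (fun _ _ _ => mk_inv_tmul_inv_balanced ..)
  counit_s a := by simp [IL.bialgebroid, IL.counit_apply]
  counit_t a := by simp [IL.bialgebroid, IL.counit_apply]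
  counit_vec x := by
    have : D.d 1 = 0 := by simpa using D.leibniz 1 1
    simp [IL.bialgebroid, IL.counit_apply, this]
  counit_mat x ξ := by simp [IL.bialgebroid, IL.counit_apply]
  counit_inv ξ y := by simp [IL.bialgebroid, IL.counit_apply]

end LeftStructure

/-! ### Transport of corings, and of left to right bialgebroids. -/

section Transport

variable {k : Type u} {A : Type v} [CommRing k] [Ring A] [Algebra k A]
  {C C' : Type*} [AddCommGroup C] [Module k C] [AddCommGroup C'] [Module k C']
  {l r : A → C →ₗ[k] C} {l' r' : A → C' →ₗ[k] C'}

/-- The map on balanced tensor squares induced by a bimodule map. -/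
def Balanced.map (g : C →ₗ[k] C') (hl : ∀ a c, g (l a c) = l' a (g c))
    (hr : ∀ a c, g (r a c) = r' a (g c)) : Balanced l r →ₗ[k] Balanced l' r' :=
  Submodule.mapQ _ _ (TensorProduct.map g g) <| Submodule.span_le.mpr <| by
    rintro _ ⟨a, c, c', rfl⟩
    refine Submodule.subset_span ⟨a, g c, g c', ?_⟩
    simp [hl, hr]

/-- The map on balanced tensor cubes induced by a bimodule map. -/
def Balanced₃.map (g : C →ₗ[k] C') (hl : ∀ a c, g (l a c) = l' a (g c))
    (hr : ∀ a c, g (r a c) = r' a (g c)) : Balanced₃ l r →ₗ[k] Balanced₃ l' r' :=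
  Submodule.mapQ _ _ (TensorProduct.map g (TensorProduct.map g g)) <| Submodule.span_le.mpr <| by
    rintro _ (⟨a, c, c', c'', rfl⟩ | ⟨a, c, c', c'', rfl⟩)
    · refine Submodule.subset_span (Or.inl ⟨a, g c, g c', g c'', ?_⟩)
      simp [hl, hr]
    · refine Submodule.subset_span (Or.inr ⟨a, g c, g c', g c'', ?_⟩)
      simp [hl, hr]

section Maps

variable (g : C →ₗ[k] C') (hl : ∀ a c, g (l a c) = l' a (g c))
  (hr : ∀ a c, g (r a c) = r' a (g c))

theorem Balanced.map_mk (u : C ⊗[k] C) :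
    Balanced.map g hl hr (Balanced.mk l r u) = Balanced.mk l' r' (TensorProduct.map g g u) := rfl

theorem joinLeft_balancedMap (z : Balanced l r) (c : C) :
    joinLeft l' r' (Balanced.map g hl hr z ⊗ₜ g c) =
      Balanced₃.map g hl hr (joinLeft l r (z ⊗ₜ c)) := by
  obtain ⟨u, rfl⟩ := Submodule.mkQ_surjective _ z
  rw [joinLeft_mk_tmul, Balanced.map_mk, joinLeft_mk_tmul]
  induction u with
  | zero => simp
  | add u w hu hw => simp only [map_add, TensorProduct.add_tmul, hu, hw]
  | tmul p q => rfl

theorem joinRight_balancedMap (c : C) (z : Balanced l r) :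
    joinRight l' r' (g c ⊗ₜ Balanced.map g hl hr z) =
      Balanced₃.map g hl hr (joinRight l r (c ⊗ₜ z)) := by
  obtain ⟨u, rfl⟩ := Submodule.mkQ_surjective _ z
  rfl

end Maps

variable (g : C ≃ₗ[k] C') (hl : ∀ a c, g.toLinearMap (l a c) = l' a (g.toLinearMap c))
  (hr : ∀ a c, g.toLinearMap (r a c) = r' a (g.toLinearMap c))

/-- The coproduct transported along a bimodule isomorphism. -/
def transportComul (Δ : C →ₗ[k] Balanced l r) : C' →ₗ[k] Balanced l' r' :=
  Balanced.map g.toLinearMap hl hr ∘ₗ Δ ∘ₗ g.symm.toLinearMap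

theorem transportComul_apply (Δ : C →ₗ[k] Balanced l r) (c : C) :
    transportComul g hl hr Δ (g c) = Balanced.map g.toLinearMap hl hr (Δ c) := by
  simp [transportComul]

/-- The coring axioms quantify over all representatives of a coproduct; this pulls a representative
back to the original coring, where its axioms apply. -/
theorem exists_rep_of_transportComul {Δ : C →ₗ[k] Balanced l r} {c : C} {u : C' ⊗[k] C'}
    (hu : Balanced.mk l' r' u = transportComul g hl hr Δ (g c)) :
    Balanced.mk l r (TensorProduct.map g.symm.toLinearMap g.symm.toLinearMap u) = Δ c := by
  have hl' (a c) : g.symm (l' a c) = l a (g.symm c) :=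
    g.injective ((g.apply_symm_apply _).trans (by simpa using (hl a (g.symm c)).symm))
  have hr' (a c) : g.symm (r' a c) = r a (g.symm c) :=
    g.injective ((g.apply_symm_apply _).trans (by simpa using (hr a (g.symm c)).symm))
  rw [← Balanced.map_mk g.symm.toLinearMap hl' hr', hu, transportComul_apply]
  obtain ⟨w, hw⟩ := Submodule.mkQ_surjective _ (Δ c)
  rw [← hw, Balanced.map_mk, Balanced.map_mk]
  congr 1
  rw [← LinearMap.comp_apply, ← TensorProduct.map_comp]
  simp

theorem exists_preimage (u : C' ⊗[k] C') :
    TensorProduct.map g.toLinearMap g.toLinearMap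
      (TensorProduct.map g.symm.toLinearMap g.symm.toLinearMap u) = u := by
  rw [← LinearMap.comp_apply, ← TensorProduct.map_comp]
  simp

theorem IsCoring.transport {Δ : C →ₗ[k] Balanced l r} {ε : C →ₗ[k] A} (h : IsCoring l r Δ ε) :
    IsCoring l' r' (transportComul g hl hr Δ) (ε ∘ₗ g.symm.toLinearMap) where
  comul_left a c u hu := by
    have hl' : ∀ a c, g (l a c) = l' a (g c) := hl
    obtain ⟨c, rfl⟩ := g.surjective c
    have := h.comul_left a c _ (exists_rep_of_transportComul g hl hr hu)
    rw [← hl', transportComul_apply, this, Balanced.map_mk]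
    conv_rhs => rw [← exists_preimage g u]
    simp only [← LinearMap.comp_apply, ← TensorProduct.map_comp]
    congr 3
    ext c
    simp [hl']
  comul_right a c u hu := by
    have hr' : ∀ a c, g (r a c) = r' a (g c) := hr
    obtain ⟨c, rfl⟩ := g.surjective c
    have := h.comul_right a c _ (exists_rep_of_transportComul g hl hr hu)
    rw [← hr', transportComul_apply, this, Balanced.map_mk]
    conv_rhs => rw [← exists_preimage g u]
    simp only [← LinearMap.comp_apply, ← TensorProduct.map_comp]
    congr 3
    ext c
    simp [hr']
  counit_left a c := by
    have hl' : ∀ a c, g (l a c) = l' a (g c) := hl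
    obtain ⟨c, rfl⟩ := g.surjective c
    simp [← hl', h.counit_left]
  counit_right a c := by
    have hr' : ∀ a c, g (r a c) = r' a (g c) := hr
    obtain ⟨c, rfl⟩ := g.surjective c
    simp [← hr', h.counit_right]
  coassoc c u hu := by
    obtain ⟨c, rfl⟩ := g.surjective c
    have := h.coassoc c _ (exists_rep_of_transportComul g hl hr hu)
    rw [← exists_preimage g u]
    generalize TensorProduct.map g.symm.toLinearMap g.symm.toLinearMap u = w at this
    have hL : joinLeft l' r' (TensorProduct.map (transportComul g hl hr Δ) LinearMap.id
        (TensorProduct.map g.toLinearMap g.toLinearMap w)) =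
        Balanced₃.map g.toLinearMap hl hr (joinLeft l r (TensorProduct.map Δ LinearMap.id w)) := by
      clear * -
      induction w with
      | zero => simp
      | add w w' hw hw' => simp only [map_add, hw, hw']
      | tmul p q =>
        rw [TensorProduct.map_tmul, TensorProduct.map_tmul, TensorProduct.map_tmul]
        exact (congrArg (fun z => joinLeft l' r' (z ⊗ₜ g q)) (transportComul_apply ..)).trans
          (joinLeft_balancedMap ..)
    have hR : joinRight l' r' (TensorProduct.map LinearMap.id (transportComul g hl hr Δ)
        (TensorProduct.map g.toLinearMap g.toLinearMap w)) =
        Balanced₃.map g.toLinearMap hl hr (joinRight l r (TensorProduct.map LinearMap.id Δ w)) := by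
      clear * -
      induction w with
      | zero => simp
      | add w w' hw hw' => simp only [map_add, hw, hw']
      | tmul p q =>
        rw [TensorProduct.map_tmul, TensorProduct.map_tmul, TensorProduct.map_tmul]
        exact (congrArg (fun z => joinRight l' r' (g p ⊗ₜ z)) (transportComul_apply ..)).trans
          (joinRight_balancedMap ..)
    rw [hL, hR, this]
  counit_comul c n p q hu := by
    obtain ⟨c, rfl⟩ := g.surjective c
    have h₁ := exists_rep_of_transportComul g hl hr hu
    simp only [map_sum, TensorProduct.map_tmul] at h₁
    have := congrArg g (h.counit_comul c n (fun i => g.symm (p i)) (fun i => g.symm (q i))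
      ((map_sum _ _ _).trans h₁))
    have hl' : ∀ a c, g (l a c) = l' a (g c) := hl
    simpa [hl'] using this
  comul_counit c n p q hu := by
    obtain ⟨c, rfl⟩ := g.surjective c
    have h₁ := exists_rep_of_transportComul g hl hr hu
    simp only [map_sum, TensorProduct.map_tmul] at h₁
    have := congrArg g (h.comul_counit c n (fun i => g.symm (p i)) (fun i => g.symm (q i))
      ((map_sum _ _ _).trans h₁))
    have hr' : ∀ a c, g (r a c) = r' a (g c) := hr
    simpa [hr'] using this

variable {L R : Type*} [Ring L] [Algebra k L] [Ring R] [Algebra k R]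
  {sL : A →ₐ[k] L} {tL : Aᵐᵒᵖ →ₐ[k] L} {sR : A →ₐ[k] R} {tR : Aᵐᵒᵖ →ₐ[k] R}

theorem map_antiMul (Φ : L →ₗ[k] R) (hmul : ∀ X Y, Φ (X * Y) = Φ Y * Φ X) (u w : L ⊗[k] L) :
    TensorProduct.map Φ Φ (u * w) = TensorProduct.map Φ Φ w * TensorProduct.map Φ Φ u := by
  induction u with
  | zero => simp
  | add u u' h h' => simp only [map_add, add_mul, mul_add, h, h']
  | tmul p q =>
    induction w with
    | zero => simp
    | add w w' h h' => simp only [map_add, add_mul, mul_add, h, h']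
    | tmul p' q' => simp [hmul]

theorem antiMul_leftL (Φ : L →ₗ[k] R) (hmul : ∀ X Y, Φ (X * Y) = Φ Y * Φ X)
    (hs : ∀ a, Φ (sL a) = tR (op a)) (a : A) (X : L) :
    Φ (leftL sL a X) = rightL tR a (Φ X) := by
  simp [hmul, hs]

theorem antiMul_leftR (Φ : L →ₗ[k] R) (hmul : ∀ X Y, Φ (X * Y) = Φ Y * Φ X)
    (ht : ∀ a, Φ (tL (op a)) = sR a) (a : A) (X : L) :
    Φ (leftR tL a X) = rightR sR a (Φ X) := by
  simp [hmul, ht]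

/-- The right bialgebroid obtained from a left bialgebroid by an antialgebra isomorphism that
exchanges source and target. -/
def LeftBialgebroid.transport (𝓛 : LeftBialgebroid sL tL) (Φ : L ≃ₗ[k] R)
    (hone : Φ 1 = 1) (hmul : ∀ X Y, Φ (X * Y) = Φ Y * Φ X)
    (hs : ∀ a, Φ (sL a) = tR (op a)) (ht : ∀ a, Φ (tL (op a)) = sR a) :
    RightBialgebroid sR tR where
  comm a b := by rw [← hs, ← ht, ← hmul, ← hmul, 𝓛.comm]
  Δ := transportComul Φ (antiMul_leftL Φ.toLinearMap hmul hs)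
    (antiMul_leftR Φ.toLinearMap hmul ht) 𝓛.Δ
  ε := 𝓛.ε ∘ₗ Φ.symm.toLinearMap
  isCoring := 𝓛.isCoring.transport _ _ _
  takeuchi X u hu a := by
    obtain ⟨X, rfl⟩ := Φ.surjective X
    have := congrArg (Balanced.map Φ.toLinearMap
      (antiMul_leftL Φ.toLinearMap hmul hs) (antiMul_leftR Φ.toLinearMap hmul ht))
      (𝓛.takeuchi X _ (exists_rep_of_transportComul _ _ _ hu) a)
    simpa only [Balanced.map_mk, map_antiMul Φ.toLinearMap hmul, exists_preimage,
      TensorProduct.map_tmul, LinearEquiv.coe_coe, hs, ht, hone] using this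
  comul_one := by
    conv_lhs => rw [← hone]
    rw [transportComul_apply, 𝓛.comul_one, Balanced.map_mk]
    simp [hone]
  comul_mul X Y u w hu hw := by
    obtain ⟨X, rfl⟩ := Φ.surjective X
    obtain ⟨Y, rfl⟩ := Φ.surjective Y
    -- The product is reversed under `Φ`, so the coproduct of `YX` is the one needed.
    rw [← hmul, transportComul_apply, 𝓛.comul_mul Y X _ _ (exists_rep_of_transportComul _ _ _ hw)
      (exists_rep_of_transportComul _ _ _ hu), Balanced.map_mk,
      map_antiMul Φ.toLinearMap hmul, exists_preimage, exists_preimage]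
  counit_one := by
    rw [← hone]
    simp [𝓛.counit_one]
  counit_mul_s X Y := by
    obtain ⟨X, rfl⟩ := Φ.surjective X
    obtain ⟨Y, rfl⟩ := Φ.surjective Y
    -- `Φ` exchanges source and target, so the axiom for `s` on the right comes from the axiom for
    -- `t` on the left.
    simp [← hmul, ← ht, ← 𝓛.counit_mul_t]
  counit_mul_t X Y := by
    obtain ⟨X, rfl⟩ := Φ.surjective X
    obtain ⟨Y, rfl⟩ := Φ.surjective Y
    simp [← hmul, ← hs, ← 𝓛.counit_mul_s]

theorem LeftBialgebroid.transport_comul (𝓛 : LeftBialgebroid sL tL) (Φ : L ≃ₗ[k] R)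
    (hone : Φ 1 = 1) (hmul : ∀ X Y, Φ (X * Y) = Φ Y * Φ X)
    (hs : ∀ a, Φ (sL a) = tR (op a)) (ht : ∀ a, Φ (tL (op a)) = sR a) {X : L} {u : L ⊗[k] L}
    (hu : Balanced.mk (leftL sL) (leftR tL) u = 𝓛.Δ X) :
    (𝓛.transport Φ hone hmul hs ht).Δ (Φ X) =
      Balanced.mk (rightL tR) (rightR sR) (TensorProduct.map Φ.toLinearMap Φ.toLinearMap u) := by
  refine (transportComul_apply Φ _ _ 𝓛.Δ X).trans ?_
  rw [← hu, Balanced.map_mk]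

theorem LeftBialgebroid.transport_counit (𝓛 : LeftBialgebroid sL tL) (Φ : L ≃ₗ[k] R)
    (hone : Φ 1 = 1) (hmul : ∀ X Y, Φ (X * Y) = Φ Y * Φ X)
    (hs : ∀ a, Φ (sL a) = tR (op a)) (ht : ∀ a, Φ (tL (op a)) = sR a) (X : L) :
    (𝓛.transport Φ hone hmul hs ht).ε (Φ X) = 𝓛.ε X :=
  congrArg 𝓛.ε (Φ.symm_apply_apply X)

end Transport

/-! ### The antiisomorphism `Φ` and the right bialgebroid `IR`. -/

section AntiIsomorphism

variable {k : Type u} {A : Type v} {Ω : Type w} [CommRing k] [Ring A] [Algebra k A]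
  [AddCommGroup Ω] [Module k Ω] [Module A Ω] [Module Aᵐᵒᵖ Ω] [SMulCommClass A Aᵐᵒᵖ Ω]
  (D : FODC k A Ω) (B : RightDualBasis A Ω) (B' : LeftDualBasis A Ω)

/-- The element `y_j • (x, η_j)` of `IR(Ω)`. -/
def IR.covec (x : RightVF A Ω) : IR D := ∑ j, IR.vec D (B'.y j) * IR.inv D x (B'.η j)

/-- The element `(ω_i, y) • x_i` of `IL(Ω)`. -/
def IL.covec (y : LeftVF A Ω) : IL D := ∑ i, IL.inv D (B.ω i) y * IL.vec D (B.x i)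

theorem IR.covec_eq (B₁ : LeftDualBasis A Ω) (x : RightVF A Ω) :
    IR.covec D B' x = IR.covec D B₁ x :=
  B'.sum_eq_sum B₁ (fun η y => IR.vec D y * IR.inv D x η)
    (fun _ _ _ => by rw [IR.inv_add_right, mul_add])
    (fun _ _ _ => by rw [IR.vec_add, add_mul])
    (fun _ _ _ => by rw [← IR.s_mul_inv, ← mul_assoc, IR.vec_mul_s])

theorem IL.covec_eq (B₁ : RightDualBasis A Ω) (y : LeftVF A Ω) :
    IL.covec D B y = IL.covec D B₁ y :=
  B.sum_eq_sum B₁ (fun ω x => IL.inv D ω y * IL.vec D x)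
    (fun _ _ _ => by rw [IL.inv_add_left, add_mul])
    (fun _ _ _ => by rw [IL.vec_add, mul_add])
    (fun _ _ _ => by rw [← IL.inv_mul_s, mul_assoc, IL.s_mul_vec])

theorem IR.covec_mul_t (a : A) (x : RightVF A Ω) :
    IR.covec D B' x * IR.t D (op a) = IR.covec D B' (x.lact a) := by
  simp only [IR.covec, Finset.sum_mul, mul_assoc, IR.inv_mul_t]

theorem IL.t_mul_covec (a : A) (y : LeftVF A Ω) :
    IL.t D (op a) * IL.covec D B y = IL.covec D B (y.ract a) := by
  simp only [IL.covec, Finset.mul_sum, ← mul_assoc, IL.t_mul_inv]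

/-- The relation for `x • a` with the order reversed. The terms `(da, y_j)(x, η_j)` collapse by an
inverse relation to the derivative `t(x(da))`. -/
theorem IR.t_mul_covec (a : A) (x : RightVF A Ω) :
    IR.t D (op a) * IR.covec D B' x = IR.covec D B' (x.ract a) + IR.t D (op (x (D.d a))) := by
  simp only [IR.covec, Finset.mul_sum, ← mul_assoc, IR.t_mul_vec, add_mul, Finset.sum_add_distrib,
    IR.mat_mul_inv]
  simp only [mul_assoc, IR.t_mul_inv]

theorem IL.covec_mul_t (a : A) (y : LeftVF A Ω) :
    IL.covec D B y * IL.t D (op a) = IL.covec D B (y.lact a) + IL.t D (op (y (D.d a))) := by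
  simp only [IL.covec, Finset.sum_mul, mul_assoc, IL.vec_mul_t, mul_add, Finset.sum_add_distrib,
    IL.inv_mul_mat]
  simp only [← mul_assoc, IL.inv_mul_t]

/-- The relation for `x • a̲` with the order reversed. The derivative terms `y_j(da)` reassemble
`da` inside `(x, -)`, and the remaining terms match by centrality of the coevaluation. -/
theorem IR.s_mul_covec (a : A) (x : RightVF A Ω) :
    IR.s D a * IR.covec D B' x = IR.covec D B' x * IR.s D a + IR.inv D x (D.d a) := by
  simp only [IR.covec, Finset.mul_sum, Finset.sum_mul, ← mul_assoc, IR.s_mul_vec, add_mul,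
    Finset.sum_add_distrib]
  simp only [mul_assoc, IR.s_mul_inv, IR.inv_mul_s, ← IR.inv_sum_right, B'.sum_eq]
  congr 1
  exact (B'.sum_smul (fun η y => IR.vec D y * IR.inv D x η)
    (fun _ _ _ => by rw [IR.inv_add_right, mul_add])
    (fun _ _ _ => by rw [IR.vec_add, add_mul])
    (fun _ _ _ => by rw [← IR.s_mul_inv, ← mul_assoc, IR.vec_mul_s]) a).symm

theorem IL.covec_mul_s (a : A) (y : LeftVF A Ω) :
    IL.covec D B y * IL.s D a = IL.s D a * IL.covec D B y + IL.inv D (D.d a) y := by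
  simp only [IL.covec, Finset.mul_sum, Finset.sum_mul, mul_assoc, IL.vec_mul_s, mul_add,
    Finset.sum_add_distrib]
  simp only [← mul_assoc, IL.s_mul_inv, IL.inv_mul_s, ← IL.inv_sum_left, B.sum_eq]
  congr 1
  exact (B.sum_smul (fun ω x => IL.inv D ω y * IL.vec D x)
    (fun _ _ _ => by rw [IL.inv_add_left, add_mul])
    (fun _ _ _ => by rw [IL.vec_add, mul_add])
    (fun _ _ _ => by rw [← IL.inv_mul_s, mul_assoc, IL.s_mul_vec]) a).symm

theorem IR.covec_add (x x' : RightVF A Ω) :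
    IR.covec D B' (x + x') = IR.covec D B' x + IR.covec D B' x' := by
  simp only [IR.covec, IR.inv_add_left, mul_add, Finset.sum_add_distrib]

theorem IL.covec_add (y y' : LeftVF A Ω) :
    IL.covec D B (y + y') = IL.covec D B y + IL.covec D B y' := by
  simp only [IL.covec, IL.inv_add_right, add_mul, Finset.sum_add_distrib]

/-- Reversing products and exchanging `s` with `t` turns the relations among matrix generators of
`IL D` into those of `IR D`. The relations with a vector field are the `covec` lemmas. -/
theorem IL.toIR_rel (z w : (IR D)ᵐᵒᵖ)
    (h : ILRel D (fun a => op (IR.t D (op a))) (fun a => op (IR.s D a))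
      (fun x => op (IR.covec D B' x)) (fun x ξ => op (IR.inv D x ξ)) (fun ξ y => op (IR.mat D ξ y))
      z w) : z = w := by
  cases h <;> refine MulOpposite.unop_injective ?_
  case s_algebraMap c => exact (IR.t D).commutes c
  case t_algebraMap c => exact (IR.s D).commutes c
  all_goals
    simp [IR.covec_add, IR.covec_mul_t, IR.t_mul_covec, IR.s_mul_covec, IR.mat_add_left,
      IR.mat_add_right, IR.inv_add_left, IR.inv_add_right, IR.s_mul_mat, IR.mat_mul_s,
      IR.t_mul_mat, IR.mat_mul_t, IR.s_mul_inv, IR.inv_mul_s, IR.t_mul_inv, IR.inv_mul_t,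
      IR.inv_mul_mat, IR.mat_mul_inv, IR.s_comm_t]

theorem IR.toIL_rel (z w : (IL D)ᵐᵒᵖ)
    (h : IRRel D (fun a => op (IL.t D (op a))) (fun a => op (IL.s D a))
      (fun y => op (IL.covec D B y)) (fun ξ y => op (IL.inv D ξ y)) (fun x ξ => op (IL.mat D x ξ))
      z w) : z = w := by
  cases h <;> refine MulOpposite.unop_injective ?_
  case s_algebraMap c => exact (IL.t D).commutes c
  case t_algebraMap c => exact (IL.s D).commutes c
  all_goals
    simp [IL.covec_add, IL.covec_mul_t, IL.t_mul_covec, IL.covec_mul_s, IL.mat_add_left,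
      IL.mat_add_right, IL.inv_add_left, IL.inv_add_right, IL.s_mul_mat, IL.mat_mul_s,
      IL.t_mul_mat, IL.mat_mul_t, IL.s_mul_inv, IL.inv_mul_s, IL.t_mul_inv, IL.inv_mul_t,
      IL.inv_mul_mat, IL.mat_mul_inv, IL.s_comm_t]

/-- The antihomomorphism `Φ : IL(Ω) → IR(Ω)`. -/
def IL.toIR : IL D →ₐ[k] (IR D)ᵐᵒᵖ := IL.lift _ _ _ _ _ (IL.toIR_rel D B')

/-- The antihomomorphism `Φ⁻¹ : IR(Ω) → IL(Ω)`. -/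
def IR.toIL : IR D →ₐ[k] (IL D)ᵐᵒᵖ := IR.lift _ _ _ _ _ (IR.toIL_rel D B)

/-- The image is `∑ (x, η_j)(ω_i, y_j) x_i`. The sum over `j` is `s(x(ω_i))` by an inverse relation,
and `∑ x(ω_i) x_i = x`. This makes `Φ` invertible on vector fields. -/
theorem IR.toIL_covec (x : RightVF A Ω) :
    IR.toIL D B (IR.covec D B' x) = op (IL.vec D x) := by
  refine MulOpposite.unop_injective ?_
  simp only [IR.covec, map_sum, map_mul, IR.toIL, IR.lift_vec, IR.lift_inv, Finset.unop_sum,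
    MulOpposite.unop_mul, MulOpposite.unop_op, IL.covec, Finset.mul_sum]
  rw [Finset.sum_comm]
  simp only [← mul_assoc, ← Finset.sum_mul, IL.mat_mul_inv, IL.s_mul_vec, ← IL.vec_sum,
    B.sum_apply_lact]

theorem IL.toIR_covec (y : LeftVF A Ω) :
    IL.toIR D B' (IL.covec D B y) = op (IR.vec D y) := by
  refine MulOpposite.unop_injective ?_
  simp only [IL.covec, map_sum, map_mul, IL.toIR, IL.lift_vec, IL.lift_inv, Finset.unop_sum,
    MulOpposite.unop_mul, MulOpposite.unop_op, IR.covec, Finset.sum_mul]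
  rw [Finset.sum_comm]
  simp only [mul_assoc, ← Finset.mul_sum, IR.inv_mul_mat, IR.vec_mul_s, ← IR.vec_sum,
    B'.sum_apply_ract]

/-- The antiisomorphism `Φ : IL(Ω) → IR(Ω)`. -/
def IL.reflection : IL D ≃ₗ[k] IR D :=
  LinearEquiv.ofLinearMap
    ((MulOpposite.opLinearEquiv k).symm.toLinearMap ∘ₗ (IL.toIR D B').toLinearMap)
    ((MulOpposite.opLinearEquiv k).symm.toLinearMap ∘ₗ (IR.toIL D B).toLinearMap)
    (by
      refine LinearMap.ext fun X => ?_
      simp only [LinearMap.comp_apply, LinearMap.id_apply, LinearEquiv.coe_coe,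
        AlgHom.toLinearMap_apply, MulOpposite.coe_opLinearEquiv_symm]
      induction X using IR.induction with
      | add X Y hX hY => simp [hX, hY]
      | mul X Y hX hY => simp [hX, hY]
      | s a => simp [IR.toIL, IL.toIR]
      | t a => simp [IR.toIL, IL.toIR]
      | vec y => simp [IR.toIL, IL.toIR_covec]
      | mat ξ y => simp [IR.toIL, IL.toIR]
      | inv x ξ => simp [IR.toIL, IL.toIR])
    (by
      refine LinearMap.ext fun X => ?_
      simp only [LinearMap.comp_apply, LinearMap.id_apply, LinearEquiv.coe_coe,
        AlgHom.toLinearMap_apply, MulOpposite.coe_opLinearEquiv_symm]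
      induction X using IL.induction with
      | add X Y hX hY => simp [hX, hY]
      | mul X Y hX hY => simp [hX, hY]
      | s a => simp [IR.toIL, IL.toIR]
      | t a => simp [IR.toIL, IL.toIR]
      | vec x => simp [IL.toIR, IR.toIL_covec]
      | mat x ξ => simp [IR.toIL, IL.toIR]
      | inv ξ y => simp [IR.toIL, IL.toIR])

theorem IL.reflection_apply (X : IL D) :
    IL.reflection D B B' X = (IL.toIR D B' X).unop := rfl

theorem IL.reflection_one : IL.reflection D B B' 1 = 1 := by simp [IL.reflection_apply]

theorem IL.reflection_mul (X Y : IL D) :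
    IL.reflection D B B' (X * Y) = IL.reflection D B B' Y * IL.reflection D B B' X := by
  simp [IL.reflection_apply]

theorem IL.reflection_s (a : A) : IL.reflection D B B' (IL.s D a) = IR.t D (op a) := by
  simp [IL.reflection_apply, IL.toIR]

theorem IL.reflection_t (a : A) : IL.reflection D B B' (IL.t D (op a)) = IR.s D a := by
  simp [IL.reflection_apply, IL.toIR]

theorem IL.reflection_vec (x : RightVF A Ω) :
    IL.reflection D B B' (IL.vec D x) = IR.covec D B' x := by
  simp [IL.reflection_apply, IL.toIR]

theorem IL.reflection_mat (x : RightVF A Ω) (ξ : Ω) :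
    IL.reflection D B B' (IL.mat D x ξ) = IR.inv D x ξ := by
  simp [IL.reflection_apply, IL.toIR]

theorem IL.reflection_inv (ξ : Ω) (y : LeftVF A Ω) :
    IL.reflection D B B' (IL.inv D ξ y) = IR.mat D ξ y := by
  simp [IL.reflection_apply, IL.toIR]

theorem IL.reflection_covec (y : LeftVF A Ω) :
    IL.reflection D B B' (IL.covec D B y) = IR.vec D y := by
  simp [IL.reflection_apply, IL.toIR_covec]

variable [IsScalarTower k A Ω] [IsScalarTower k Aᵐᵒᵖ Ω]

/-- The right bialgebroid `IR(Ω)`. -/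
def IR.bialgebroid : RightBialgebroid (IR.s D) (IR.t D) :=
  (IL.bialgebroid D B B').transport (IL.reflection D B B') (IL.reflection_one D B B')
    (IL.reflection_mul D B B') (IL.reflection_s D B B') (IL.reflection_t D B B')

theorem IR.comul_reflection {X : IL D} {u : IL D ⊗[k] IL D}
    (hu : IL.mk₂ D u = (IL.bialgebroid D B B').Δ X) :
    (IR.bialgebroid D B B').Δ (IL.reflection D B B' X) =
      Balanced.mk (rightL (IR.t D)) (rightR (IR.s D))
        (TensorProduct.map (IL.reflection D B B').toLinearMap
          (IL.reflection D B B').toLinearMap u) :=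
  LeftBialgebroid.transport_comul _ _ _ _ _ _ hu

theorem IR.counit_reflection (X : IL D) :
    (IR.bialgebroid D B B').ε (IL.reflection D B B' X) = (IL.bialgebroid D B B').ε X :=
  LeftBialgebroid.transport_counit ..

/-- As `y = Φ(covec y)`, this computes `Δ_R(y)`. -/
theorem IL.comul_covec (B₁ : LeftDualBasis A Ω) (y : LeftVF A Ω) :
    (IL.bialgebroid D B B').Δ (IL.covec D B y) =
      IL.mk₂ D (1 ⊗ₜ IL.covec D B y +
        ∑ j, IL.covec D B (B₁.y j) ⊗ₜ IL.inv D (B₁.η j) y) := by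
  have H := IL.isGhobadiLeft D B B'
  have h₁ (i) : (IL.bialgebroid D B B').Δ (IL.inv D (B.ω i) y * IL.vec D (B.x i)) = IL.mk₂ D
      ((∑ j, IL.inv D (B.ω i) (B₁.y j) ⊗ₜ IL.inv D (B₁.η j) y) *
        (IL.vec D (B.x i) ⊗ₜ 1 + ∑ l, IL.mat D (B.x i) (B.ω l) ⊗ₜ IL.vec D (B.x l))) :=
    (IL.bialgebroid D B B').comul_mul _ _ _ _ (H.comul_inv B₁ _ _).symm (H.comul_vec B _).symm
  -- The contraction used in `comulRep_rel`, now with a vector field in the second leg: an inverse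
  -- relation in the first leg, balancing, then the dual basis.
  have h₂ : IL.mk₂ D (∑ i, (∑ j, IL.inv D (B.ω i) (B₁.y j) ⊗ₜ IL.inv D (B₁.η j) y) *
      (∑ l, IL.mat D (B.x i) (B.ω l) ⊗ₜ IL.vec D (B.x l))) = IL.mk₂ D (1 ⊗ₜ IL.covec D B y) := by
    have h₃ : ∑ i, (∑ j, IL.inv D (B.ω i) (B₁.y j) ⊗ₜ[k] IL.inv D (B₁.η j) y) *
          (∑ l, IL.mat D (B.x i) (B.ω l) ⊗ₜ[k] IL.vec D (B.x l)) =
        ∑ l, ∑ j, (IL.t D (op (B₁.y j (B.ω l))) * 1) ⊗ₜ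
          (IL.inv D (B₁.η j) y * IL.vec D (B.x l)) := by
      simp only [Finset.sum_mul_sum, Algebra.TensorProduct.tmul_mul_tmul]
      rw [Finset.sum_comm]
      conv_rhs => rw [Finset.sum_comm]
      refine Finset.sum_congr rfl fun j _ => ?_
      rw [Finset.sum_comm]
      refine Finset.sum_congr rfl fun l _ => ?_
      rw [← TensorProduct.sum_tmul, IL.inv_mul_mat, mul_one]
    rw [h₃, IL.covec]
    simp only [map_sum, mk_t_mul_tmul, ← mul_assoc, IL.s_mul_inv, TensorProduct.tmul_sum]
    refine Finset.sum_congr rfl fun l _ => ?_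
    rw [← map_sum, ← TensorProduct.tmul_sum, ← Finset.sum_mul, ← IL.inv_sum_left, B₁.sum_eq]
  have h₄ : ∑ i, (∑ j, IL.inv D (B.ω i) (B₁.y j) ⊗ₜ[k] IL.inv D (B₁.η j) y) *
      (IL.vec D (B.x i) ⊗ₜ[k] 1) = ∑ j, IL.covec D B (B₁.y j) ⊗ₜ IL.inv D (B₁.η j) y := by
    simp only [Finset.sum_mul, Algebra.TensorProduct.tmul_mul_tmul, mul_one, IL.covec,
      TensorProduct.sum_tmul]
    rw [Finset.sum_comm]
  rw [map_add, ← h₂, ← h₄, IL.covec, map_sum, Finset.sum_congr rfl fun i _ => h₁ i, ← map_sum,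
    ← map_add, Finset.sum_congr rfl fun i _ => mul_add _ _ _, Finset.sum_add_distrib, add_comm]

/-- Every generator of `IR D` is `Φ` of an element whose coproduct and counit are already known. -/
theorem IR.isGhobadiRight : IsGhobadiRight D (IR.bialgebroid D B B') where
  comul_s a := by
    rw [← IL.reflection_t D B B',
      IR.comul_reflection D B B' ((IL.isGhobadiLeft D B B').comul_t a).symm]
    simp [IL.reflection_one]
  comul_t a := by
    rw [← IL.reflection_s D B B',
      IR.comul_reflection D B B' ((IL.isGhobadiLeft D B B').comul_s a).symm]
    simp [IL.reflection_one]
  comul_vec B₁ y := by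
    rw [← IL.reflection_covec D B B',
      IR.comul_reflection D B B' (IL.comul_covec D B B' B₁ y).symm]
    simp [IL.reflection_one, IL.reflection_covec, IL.reflection_inv]
  comul_mat B₁ ξ y := by
    rw [← IL.reflection_inv D B B',
      IR.comul_reflection D B B' ((IL.isGhobadiLeft D B B').comul_inv B₁ ξ y).symm]
    simp [IL.reflection_inv]
  comul_inv B₁ x ξ := by
    rw [← IL.reflection_mat D B B',
      IR.comul_reflection D B B' ((IL.isGhobadiLeft D B B').comul_mat B₁ x ξ).symm]
    simp [IL.reflection_mat]
  counit_s a := by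
    rw [← IL.reflection_t D B B', IR.counit_reflection, (IL.isGhobadiLeft D B B').counit_t]
  counit_t a := by
    rw [← IL.reflection_s D B B', IR.counit_reflection, (IL.isGhobadiLeft D B B').counit_s]
  counit_vec y := by
    have h (i) : IL.counit D (IL.vec D (B.x i)) = 0 :=
      (IL.isGhobadiLeft D B B').counit_vec (B.x i)
    rw [← IL.reflection_covec D B B', IR.counit_reflection]
    simp [IL.bialgebroid, IL.covec, IL.counit_mul, h]
  counit_mat ξ y := by
    rw [← IL.reflection_inv D B B', IR.counit_reflection, (IL.isGhobadiLeft D B B').counit_inv]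
  counit_inv x ξ := by
    rw [← IL.reflection_mat D B B', IR.counit_reflection, (IL.isGhobadiLeft D B B').counit_mat]

end AntiIsomorphism

/-! ### The star operation and the bialgebroid pair. -/

section StarStructure

variable {A : Type v} {Ω : Type w} [Ring A] [StarRing A] [Algebra ℂ A]
  [AddCommGroup Ω] [Module ℂ Ω] [Module A Ω] [Module Aᵐᵒᵖ Ω]

section VectorFields

variable (D : StarFODC A Ω)

theorem StarFODC.st_lsmul (a : A) (ξ : Ω) : D.st (a • ξ) = op (star a) • D.st ξ := by
  simpa using D.st_smul a 1 ξ

theorem StarFODC.st_rsmul (a : A) (ξ : Ω) : D.st (op a • ξ) = star a • D.st ξ := by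
  simpa using D.st_smul 1 a ξ

theorem StarFODC.st_d (a : A) : D.st (D.d a) = D.d (star a) := (D.d_star a).symm

theorem StarFODC.st_st (ξ : Ω) : D.st (D.st ξ) = ξ := by
  have h : ξ ∈ Submodule.span ℂ {ω : Ω | ∃ a b : A, ω = a • D.d b} := D.span_eq_top ▸ trivial
  induction h using Submodule.span_induction with
  | mem z hz =>
    obtain ⟨a, b, rfl⟩ := hz
    simp [D.st_lsmul, D.st_rsmul, D.st_d, -MulOpposite.op_star]
  | zero => simp
  | add z w _ _ hz hw => rw [map_add, map_add, hz, hw]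
  | smul c z _ hz => simp [hz]

theorem StarFODC.starR_apply (x : RightVF A Ω) (ξ : Ω) : D.starR x ξ = star (x (D.st ξ)) := rfl

theorem StarFODC.starL_apply (y : LeftVF A Ω) (ξ : Ω) : D.starL y ξ = star (y (D.st ξ)) := rfl

theorem StarFODC.starL_starR (x : RightVF A Ω) : D.starL (D.starR x) = x := by
  ext ξ
  simp [D.starL_apply, D.starR_apply, D.st_st]

theorem StarFODC.starR_starL (y : LeftVF A Ω) : D.starR (D.starL y) = y := by
  ext ξ
  simp [D.starL_apply, D.starR_apply, D.st_st]

theorem StarFODC.starR_add (x x' : RightVF A Ω) :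
    D.starR (x + x') = D.starR x + D.starR x' := by
  ext ξ
  simp [D.starR_apply]

theorem StarFODC.starL_add (y y' : LeftVF A Ω) :
    D.starL (y + y') = D.starL y + D.starL y' := by
  ext ξ
  simp [D.starL_apply]

variable [SMulCommClass A Aᵐᵒᵖ Ω]

theorem StarFODC.starR_lact (a : A) (x : RightVF A Ω) :
    D.starR (x.lact a) = (D.starR x).ract (star a) := by
  ext ξ
  simp [D.starR_apply]

theorem StarFODC.starR_ract (a : A) (x : RightVF A Ω) :
    D.starR (x.ract a) = (D.starR x).lact (star a) := by
  ext ξ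
  simp [D.starR_apply, D.st_rsmul, -MulOpposite.op_star]

theorem StarFODC.starL_lact (a : A) (y : LeftVF A Ω) :
    D.starL (y.lact a) = (D.starL y).ract (star a) := by
  ext ξ
  simp [D.starL_apply, D.st_lsmul, -MulOpposite.op_star]

theorem StarFODC.starL_ract (a : A) (y : LeftVF A Ω) :
    D.starL (y.ract a) = (D.starL y).lact (star a) := by
  ext ξ
  simp [D.starL_apply]

/-- The left dual basis `x_i^⊛ ⊗ ω_i^*`. -/
def RightDualBasis.conj (B : RightDualBasis A Ω) : LeftDualBasis A Ω where
  n := B.n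
  y i := D.starR (B.x i)
  η i := D.st (B.ω i)
  sum_eq ξ := by
    have := congrArg D.st (B.sum_eq (D.st ξ))
    simpa [D.st_rsmul, D.st_st, D.starR_apply] using this

/-- The right dual basis `η_j^* ⊗ y_j^{⊛⁻¹}`. -/
def LeftDualBasis.conj (B : LeftDualBasis A Ω) : RightDualBasis A Ω where
  n := B.n
  ω j := D.st (B.η j)
  x j := D.starL (B.y j)
  sum_eq ξ := by
    have := congrArg D.st (B.sum_eq (D.st ξ))
    simpa [D.st_lsmul, D.st_st, D.starL_apply] using this

end VectorFields

/-- A complex algebra with the opposite multiplication and the conjugate scalar action. -/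
def ConjOp (R : Type*) : Type _ := Rᵐᵒᵖ

instance (R : Type*) [Ring R] : Ring (ConjOp R) := inferInstanceAs (Ring Rᵐᵒᵖ)

instance (R : Type*) [Ring R] [Algebra ℂ R] : Algebra ℂ (ConjOp R) :=
  Algebra.compHom Rᵐᵒᵖ (starRingEnd ℂ)

/-- The identity map `R → ConjOp R`. -/
def ConjOp.mk (R : Type*) [Ring R] : R ≃+ ConjOp R := MulOpposite.opAddEquiv

section

variable {R : Type*} [Ring R] [Algebra ℂ R]

theorem ConjOp.mk_mul (X Y : R) : ConjOp.mk R (X * Y) = ConjOp.mk R Y * ConjOp.mk R X := rfl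

theorem ConjOp.mk_algebraMap (c : ℂ) :
    ConjOp.mk R (algebraMap ℂ R (star c)) = algebraMap ℂ (ConjOp R) c := rfl

theorem ConjOp.symm_mul (X Y : ConjOp R) :
    (ConjOp.mk R).symm (X * Y) = (ConjOp.mk R).symm Y * (ConjOp.mk R).symm X := rfl

theorem ConjOp.symm_smul (c : ℂ) (X : ConjOp R) :
    (ConjOp.mk R).symm (c • X) = star c • (ConjOp.mk R).symm X := rfl

end

variable [StarModule ℂ A] [SMulCommClass A Aᵐᵒᵖ Ω] (D : StarFODC A Ω)
  (B : RightDualBasis A Ω) (B' : LeftDualBasis A Ω)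

/-- An antilinear antihomomorphism to `IR D` is an algebra homomorphism to `ConjOp`, so the
universal property of `IL D` yields `⊛` from these relations. -/
theorem IL.toConjOp_rel (z w : ConjOp (IR D.toFODC))
    (h : ILRel D.toFODC (fun a => ConjOp.mk _ (IR.s D.toFODC (star a)))
      (fun a => ConjOp.mk _ (IR.t D.toFODC (op (star a))))
      (fun x => ConjOp.mk _ (IR.vec D.toFODC (D.starR x)))
      (fun x ξ => ConjOp.mk _ (IR.mat D.toFODC (D.st ξ) (D.starR x)))
      (fun ξ y => ConjOp.mk _ (IR.inv D.toFODC (D.starL y) (D.st ξ))) z w) : z = w := by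
  have hd (a : A) (x : RightVF A Ω) : D.starR x (D.d (star a)) = star (x (D.d a)) := by
    rw [D.starR_apply, D.st_d, star_star]
  cases h
  case s_algebraMap c =>
    rw [← ConjOp.mk_algebraMap, ← algebraMap_star_comm, AlgHom.commutes]
  case t_algebraMap c =>
    rw [← ConjOp.mk_algebraMap, ← algebraMap_star_comm]
    exact congrArg _ ((IR.t D.toFODC).commutes _)
  -- Conjugating a right dual basis gives a left one, so each inverse relation of `IL D` becomes the
  -- opposite inverse relation of `IR D` for the conjugate basis.
  case p_mul_m B ξ y =>
    simp only [← ConjOp.mk_mul, ← map_sum]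
    rw [← D.st_st ξ, ← D.starL_apply, D.st_st]
    exact congrArg _ (IR.mat_mul_inv (D := D.toFODC) (B.conj D) (D.st ξ) (D.starL y))
  case m_mul_p B ξ x =>
    simp only [← ConjOp.mk_mul, ← map_sum]
    rw [← D.st_st ξ, ← D.starR_apply, D.st_st]
    exact congrArg _ (IR.inv_mul_mat (D := D.toFODC) (B.conj D) (D.st ξ) (D.starR x))
  all_goals
    simp only [← ConjOp.mk_mul, ← map_add]
    congr 1
    simp [-MulOpposite.op_star, D.starR_add, D.starL_add, D.starR_lact, D.starR_ract,
      D.starL_lact, D.starL_ract,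
      D.st_lsmul, D.st_rsmul, D.st_d, hd, IR.vec_add, IR.mat_add_left, IR.mat_add_right,
      IR.inv_add_left, IR.inv_add_right, IR.s_mul_mat, IR.mat_mul_s, IR.t_mul_mat, IR.mat_mul_t,
      IR.s_mul_inv, IR.inv_mul_s, IR.t_mul_inv, IR.inv_mul_t, IR.s_comm_t, IR.vec_mul_s,
      IR.s_mul_vec, IR.t_mul_vec]

/-- The antilinear antihomomorphism `⊛ : IL(Ω) → IR(Ω)`. -/
def IL.starMap : IL D.toFODC →ₗ⋆[ℂ] IR D.toFODC where
  toFun X := (ConjOp.mk _).symm (IL.lift _ _ _ _ _ (IL.toConjOp_rel D) X)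
  map_add' X Y := by rw [map_add, map_add]
  map_smul' c X := by rw [map_smul, ConjOp.symm_smul]; rfl

theorem IL.starMap_apply (X : IL D.toFODC) :
    IL.starMap D X = (ConjOp.mk _).symm (IL.lift _ _ _ _ _ (IL.toConjOp_rel D) X) := rfl

theorem IL.starMap_mul (X Y : IL D.toFODC) :
    IL.starMap D (X * Y) = IL.starMap D Y * IL.starMap D X := by
  simp only [IL.starMap_apply, map_mul, ConjOp.symm_mul]

theorem IL.starMap_s (a : A) : IL.starMap D (IL.s D.toFODC a) = IR.s D.toFODC (star a) := by
  simp [IL.starMap_apply]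

theorem IL.starMap_t (a : A) :
    IL.starMap D (IL.t D.toFODC (op a)) = IR.t D.toFODC (op (star a)) := by
  simp [IL.starMap_apply]

theorem IL.starMap_vec (x : RightVF A Ω) :
    IL.starMap D (IL.vec D.toFODC x) = IR.vec D.toFODC (D.starR x) := by
  simp [IL.starMap_apply]

theorem IL.starMap_mat (x : RightVF A Ω) (ξ : Ω) :
    IL.starMap D (IL.mat D.toFODC x ξ) = IR.mat D.toFODC (D.st ξ) (D.starR x) := by
  simp [IL.starMap_apply]

theorem IL.starMap_inv (ξ : Ω) (y : LeftVF A Ω) :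
    IL.starMap D (IL.inv D.toFODC ξ y) = IR.inv D.toFODC (D.starL y) (D.st ξ) := by
  simp [IL.starMap_apply]

theorem IL.starMap_one : IL.starMap D 1 = 1 := by simpa using IL.starMap_s D 1

/-- `⊛` takes `(ω_i, y) • x_i` to `x_i^⊛ • (y^{⊛⁻¹}, ω_i^*)`, which is `covec` for the conjugate
dual basis and hence for any other. -/
theorem IL.starMap_covec (y : LeftVF A Ω) :
    IL.starMap D (IL.covec D.toFODC B y) = IR.covec D.toFODC B' (D.starL y) := by
  rw [IR.covec_eq _ _ (B.conj D)]
  simp only [IL.covec, map_sum, IL.starMap_mul, IL.starMap_inv, IL.starMap_vec]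
  rfl

theorem IL.reflection_symm_mul (X Y : IR D.toFODC) : (IL.reflection D.toFODC B B').symm (X * Y) =
    (IL.reflection D.toFODC B B').symm Y * (IL.reflection D.toFODC B B').symm X := by
  rw [LinearEquiv.symm_apply_eq, IL.reflection_mul, LinearEquiv.apply_symm_apply,
    LinearEquiv.apply_symm_apply]

/-- `⊛ Φ⁻¹ ⊛ = Φ`. -/
theorem IL.starMap_symm_starMap (X : IL D.toFODC) :
    IL.starMap D ((IL.reflection D.toFODC B B').symm (IL.starMap D X)) =
      IL.reflection D.toFODC B B' X := by
  induction X using IL.induction with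
  | add X Y hX hY => simp only [map_add, hX, hY]
  | mul X Y hX hY => simp only [IL.starMap_mul, IL.reflection_symm_mul, IL.reflection_mul, hX, hY]
  | s a =>
    rw [IL.starMap_s, ← IL.reflection_t D.toFODC B B', LinearEquiv.symm_apply_apply, IL.starMap_t,
      star_star, IL.reflection_s]
  | t a =>
    rw [IL.starMap_t, ← IL.reflection_s D.toFODC B B', LinearEquiv.symm_apply_apply, IL.starMap_s,
      star_star, IL.reflection_t]
  | vec x =>
    rw [IL.starMap_vec, ← IL.reflection_covec D.toFODC B B', LinearEquiv.symm_apply_apply,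
      IL.starMap_covec D B B', D.starL_starR, IL.reflection_vec]
  | mat x ξ =>
    rw [IL.starMap_mat, ← IL.reflection_inv D.toFODC B B', LinearEquiv.symm_apply_apply,
      IL.starMap_inv, D.st_st, D.starL_starR, IL.reflection_mat]
  | inv ξ y =>
    rw [IL.starMap_inv, ← IL.reflection_mat D.toFODC B B', LinearEquiv.symm_apply_apply,
      IL.starMap_mat, D.st_st, D.starR_starL, IL.reflection_inv]

/-- The antilinear antiisomorphism `⊛ : IL(Ω) → IR(Ω)`. -/
def IL.starEquiv : IL D.toFODC ≃ₗ⋆[ℂ] IR D.toFODC :=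
  { IL.starMap D with
    -- From `⊛ Φ⁻¹ ⊛ = Φ` the map `Φ⁻¹ ⊛ Φ⁻¹` is inverse to `⊛` on both sides.
    invFun := fun Y => (IL.reflection D.toFODC B B').symm
      (IL.starMap D ((IL.reflection D.toFODC B B').symm Y))
    left_inv := fun X => by
      refine (congrArg _ (IL.starMap_symm_starMap D B B' X)).trans ?_
      exact LinearEquiv.symm_apply_apply _ X
    right_inv := fun Y => by
      refine (IL.starMap_symm_starMap D B B' _).trans ?_
      exact LinearEquiv.apply_symm_apply _ Y }

theorem IL.starEquiv_apply (X : IL D.toFODC) : IL.starEquiv D B B' X = IL.starMap D X := rfl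

theorem IL.starEquiv_compat (X : IL D.toFODC) :
    (IL.reflection D.toFODC B B').symm (IL.starEquiv D B B' X) =
      (IL.starEquiv D B B').symm (IL.reflection D.toFODC B B' X) := by
  refine ((LinearEquiv.symm_apply_eq (IL.starEquiv D B B')).mpr ?_).symm
  exact (IL.starMap_symm_starMap D B B' X).symm

theorem flipStar_tmul {L R : Type*} [Ring L] [Algebra ℂ L] [Ring R] [Algebra ℂ R]
    (f : L →ₗ⋆[ℂ] R) (p q : L) : flipStar f (p ⊗ₜ q) = f q ⊗ₜ f p := rfl

theorem flipStar_mul {L R : Type*} [Ring L] [Algebra ℂ L] [Ring R] [Algebra ℂ R]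
    (f : L →ₗ⋆[ℂ] R) (hf : ∀ X Y, f (X * Y) = f Y * f X) (u w : L ⊗[ℂ] L) :
    flipStar f (u * w) = flipStar f w * flipStar f u := by
  induction u with
  | zero => simp
  | add u u' h h' => simp only [map_add, add_mul, mul_add, h, h']
  | tmul p q =>
    induction w with
    | zero => simp
    | add w w' h h' => simp only [map_add, add_mul, mul_add, h, h']
    | tmul p' q' => simp [hf, flipStar_tmul]

/-- `⊛` turns left multiplications by `s`, `t` into right ones and the flip exchanges the legs, so
the relation for `a` goes to minus the relation for `a^*`. -/
theorem flipStar_congr {u w : IL D.toFODC ⊗[ℂ] IL D.toFODC}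
    (h : IL.mk₂ D.toFODC u = IL.mk₂ D.toFODC w) :
    Balanced.mk (rightL (IR.t D.toFODC)) (rightR (IR.s D.toFODC)) (flipStar (IL.starMap D) u) =
      Balanced.mk (rightL (IR.t D.toFODC)) (rightR (IR.s D.toFODC))
        (flipStar (IL.starMap D) w) := by
  have h : u - w ∈ balancing _ _ := (Submodule.Quotient.eq _).mp h
  suffices H : balancing (leftL (IL.s D.toFODC)) (leftR (IL.t D.toFODC)) ≤
      LinearMap.ker ((Balanced.mk (rightL (IR.t D.toFODC)) (rightR (IR.s D.toFODC))).comp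
        (flipStar (IL.starMap D))) by
    have := H h
    rwa [LinearMap.mem_ker, map_sub, sub_eq_zero] at this
  refine Submodule.span_le.mpr ?_
  rintro _ ⟨a, c, c', rfl⟩
  have : Balanced.mk (rightL (IR.t D.toFODC)) (rightR (IR.s D.toFODC))
      ((IL.starMap D c' * IR.s D.toFODC (star a)) ⊗ₜ IL.starMap D c) =
      Balanced.mk _ _ (IL.starMap D c' ⊗ₜ (IL.starMap D c * IR.t D.toFODC (op (star a)))) :=
    (Submodule.Quotient.eq _).mpr (Submodule.subset_span ⟨star a, _, _, rfl⟩)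
  rw [SetLike.mem_coe, LinearMap.mem_ker, map_sub, sub_eq_zero, LinearMap.comp_apply,
    LinearMap.comp_apply, flipStar_tmul, flipStar_tmul]
  simp only [LinearMap.mulLeft_apply, IL.starMap_mul, IL.starMap_s, IL.starMap_t]
  exact this.symm

variable [IsScalarTower ℂ A Ω] [IsScalarTower ℂ Aᵐᵒᵖ Ω]

theorem IL.starMap_comul (X : IL D.toFODC) (u : IL D.toFODC ⊗[ℂ] IL D.toFODC)
    (hu : IL.mk₂ D.toFODC u = (IL.bialgebroid D.toFODC B B').Δ X) :
    Balanced.mk (rightL (IR.t D.toFODC)) (rightR (IR.s D.toFODC)) (flipStar (IL.starMap D) u) =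
      (IR.bialgebroid D.toFODC B B').Δ (IL.starMap D X) := by
  have HL := IL.isGhobadiLeft D.toFODC B B'
  have HR := IR.isGhobadiRight D.toFODC B B'
  -- By `flipStar_congr` one representative is enough, and in this form the claim passes to sums and
  -- products.
  suffices h : ∃ u, IL.mk₂ D.toFODC u = (IL.bialgebroid D.toFODC B B').Δ X ∧
      Balanced.mk (rightL (IR.t D.toFODC)) (rightR (IR.s D.toFODC)) (flipStar (IL.starMap D) u) =
        (IR.bialgebroid D.toFODC B B').Δ (IL.starMap D X) by
    obtain ⟨w, hw, h⟩ := h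
    rw [← h]
    exact flipStar_congr D (hu.trans hw.symm)
  clear hu u
  induction X using IL.induction with
  | add X Y hX hY =>
    obtain ⟨u, hu, hu'⟩ := hX
    obtain ⟨w, hw, hw'⟩ := hY
    exact ⟨u + w, by rw [map_add, map_add, hu, hw], by simp only [map_add, hu', hw']⟩
  | mul X Y hX hY =>
    obtain ⟨u, hu, hu'⟩ := hX
    obtain ⟨w, hw, hw'⟩ := hY
    refine ⟨u * w, ((IL.bialgebroid D.toFODC B B').comul_mul _ _ _ _ hu hw).symm, ?_⟩
    rw [flipStar_mul _ (IL.starMap_mul D), IL.starMap_mul,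
      (IR.bialgebroid D.toFODC B B').comul_mul _ _ _ _ hw' hu']
  | s a =>
    refine ⟨_, (HL.comul_s a).symm, ?_⟩
    rw [flipStar_tmul, IL.starMap_s, HR.comul_s, IL.starMap_one]
  | t a =>
    refine ⟨_, (HL.comul_t a).symm, ?_⟩
    rw [flipStar_tmul, IL.starMap_t, HR.comul_t, IL.starMap_one]
  | vec x =>
    refine ⟨_, (HL.comul_vec B x).symm, ?_⟩
    -- With the conjugate dual basis in `Δ_R` the two sides agree term by term.
    simp only [map_add, map_sum, flipStar_tmul, IL.starMap_vec, IL.starMap_mat, IL.starMap_one,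
      HR.comul_vec (B.conj D)]
    rfl
  | mat x ξ =>
    refine ⟨_, (HL.comul_mat B x ξ).symm, ?_⟩
    simp only [map_sum, flipStar_tmul, IL.starMap_mat, HR.comul_mat (B.conj D)]
    rfl
  | inv ξ y =>
    refine ⟨_, (HL.comul_inv B' ξ y).symm, ?_⟩
    simp only [map_sum, flipStar_tmul, IL.starMap_inv, HR.comul_inv (B'.conj D)]
    rfl

theorem IL.starMap_counit (X : IL D.toFODC) :
    (IR.bialgebroid D.toFODC B B').ε (IL.starMap D X) =
      star ((IL.bialgebroid D.toFODC B B').ε X) := by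
  have HL := IL.isGhobadiLeft D.toFODC B B'
  have HR := IR.isGhobadiRight D.toFODC B B'
  -- The extra factor `s(a)` makes the claim inductive: in a product `XY`, the counit axioms replace
  -- `Y s(a)` by `s(b)` with `b = ε(Y s(a))`, and the hypothesis for `X` applies with `b`.
  suffices key : ∀ a, (IR.bialgebroid D.toFODC B B').ε (IL.starMap D (X * IL.s D.toFODC a)) =
      star ((IL.bialgebroid D.toFODC B B').ε (X * IL.s D.toFODC a)) by
    simpa using key 1
  induction X using IL.induction with
  | add X Y hX hY =>
    intro a
    simp only [add_mul, map_add, star_add, hX a, hY a]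
  | mul X Y hX hY =>
    intro a
    rw [mul_assoc, IL.starMap_mul, (IR.bialgebroid D.toFODC B B').counit_mul_s, hY a,
      ← IL.starMap_s, ← IL.starMap_mul, hX, ← (IL.bialgebroid D.toFODC B B').counit_mul_s]
  | s b =>
    intro a
    rw [← map_mul, IL.starMap_s, HR.counit_s, HL.counit_s]
  | t b =>
    intro a
    rw [IL.starMap_mul, IL.starMap_s, IL.starMap_t, IR.s_comm_t]
    have h₁ := (IR.bialgebroid D.toFODC B B').isCoring.counit_right (star a)
      (IR.t D.toFODC (op (star b)))
    have h₂ := (IL.bialgebroid D.toFODC B B').isCoring.counit_right b (IL.s D.toFODC a)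
    rw [LinearMap.mulRight_apply, HR.counit_t] at h₁
    rw [LinearMap.mulLeft_apply, HL.counit_s] at h₂
    rw [h₁, h₂, star_mul]
  | vec x =>
    intro a
    simp only [IL.vec_mul_s, map_add, IL.starMap_vec, IL.starMap_s, HR.counit_vec, HL.counit_vec,
      HR.counit_s, HL.counit_s, zero_add]
  | mat x ξ =>
    intro a
    rw [IL.mat_mul_s, IL.starMap_mat, HR.counit_mat, HL.counit_mat, D.starR_apply, D.st_st]
  | inv ξ y =>
    intro a
    rw [IL.inv_mul_s, IL.starMap_inv, HR.counit_inv, HL.counit_inv, D.starL_apply, D.st_st]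

theorem IL.isReflexive : IsReflexive (IL.bialgebroid D.toFODC B B') (IR.bialgebroid D.toFODC B B')
    (IL.reflection D.toFODC B B') where
  map_one := IL.reflection_one D.toFODC B B'
  map_mul := IL.reflection_mul D.toFODC B B'
  map_s := IL.reflection_s D.toFODC B B'
  map_t := IL.reflection_t D.toFODC B B'
  comul _ _ hu := (IR.comul_reflection D.toFODC B B' hu).symm
  counit := IR.counit_reflection D.toFODC B B'

theorem IL.isStarRelated : IsStarRelated (IL.bialgebroid D.toFODC B B')
    (IR.bialgebroid D.toFODC B B') (IL.starEquiv D B B') where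
  map_one := IL.starMap_one D
  map_mul := IL.starMap_mul D
  map_s := IL.starMap_s D
  map_t := IL.starMap_t D
  comul := IL.starMap_comul D B B'
  counit := IL.starMap_counit D B B'

end StarStructure

end StarBialgebroid

end

theorem theorem5p8 {A : Type*} {Ω : Type*} [Ring A] [StarRing A] [Algebra ℂ A] [StarModule ℂ A]
    [AddCommGroup Ω] [Module ℂ Ω] [Module A Ω] [Module Aᵐᵒᵖ Ω] [SMulCommClass A Aᵐᵒᵖ Ω]
    [IsScalarTower ℂ A Ω] [IsScalarTower ℂ Aᵐᵒᵖ Ω]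
    [Module.Finite A Ω] [Module.Projective A Ω]
    [Module.Finite Aᵐᵒᵖ Ω] [Module.Projective Aᵐᵒᵖ Ω]
    (D : StarFODC A Ω) :
    ∃ (𝓛 : LeftBialgebroid (IL.s D.toFODC) (IL.t D.toFODC))
      (𝓡 : RightBialgebroid (IR.s D.toFODC) (IR.t D.toFODC))
      (f : IL D.toFODC ≃ₗ⋆[ℂ] IR D.toFODC) (Φ : IL D.toFODC ≃ₗ[ℂ] IR D.toFODC),
      IsGhobadiLeft D.toFODC 𝓛 ∧ IsGhobadiRight D.toFODC 𝓡 ∧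
      IsStarBialgebroidPair 𝓛 𝓡 f Φ ∧
      -- `⊛` on generators
      (∀ a : A, f (IL.s D.toFODC a) = IR.s D.toFODC (star a)) ∧
      (∀ a : A, f (IL.t D.toFODC (op a)) = IR.t D.toFODC (op (star a))) ∧
      (∀ x : RightVF A Ω, f (IL.vec D.toFODC x) = IR.vec D.toFODC (D.starR x)) ∧
      (∀ (a : A) (x : RightVF A Ω), f (IL.t D.toFODC (op a) * IL.vec D.toFODC x) =
        IR.vec D.toFODC (D.starR x) * IR.t D.toFODC (op (star a))) ∧
      (∀ (x : RightVF A Ω) (ξ : Ω),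
        f (IL.mat D.toFODC x ξ) = IR.mat D.toFODC (D.st ξ) (D.starR x)) ∧
      (∀ (ξ : Ω) (y : LeftVF A Ω),
        f (IL.inv D.toFODC ξ y) = IR.inv D.toFODC (D.starL y) (D.st ξ)) ∧
      -- `Φ` on generators
      (∀ (x : RightVF A Ω) (ξ : Ω), Φ (IL.mat D.toFODC x ξ) = IR.inv D.toFODC x ξ) ∧
      (∀ (ξ : Ω) (y : LeftVF A Ω), Φ (IL.inv D.toFODC ξ y) = IR.mat D.toFODC ξ y) ∧
      (∀ (B : RightDualBasis A Ω) (y : LeftVF A Ω),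
        Φ (∑ i, IL.inv D.toFODC (B.ω i) y * IL.vec D.toFODC (B.x i)) = IR.vec D.toFODC y) ∧
      (∀ (B : LeftDualBasis A Ω) (x : RightVF A Ω), Φ (IL.vec D.toFODC x) =
        ∑ j, IR.vec D.toFODC (B.y j) * IR.inv D.toFODC x (B.η j)) ∧
      (∀ a b : A, Φ (IL.s D.toFODC a * IL.t D.toFODC (op b)) =
        IR.t D.toFODC (op a) * IR.s D.toFODC b) := by
  obtain ⟨B⟩ := exists_rightDualBasis A Ω
  obtain ⟨B'⟩ := exists_leftDualBasis A Ω
  refine ⟨IL.bialgebroid D.toFODC B B', IR.bialgebroid D.toFODC B B', IL.starEquiv D B B',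
    IL.reflection D.toFODC B B', IL.isGhobadiLeft D.toFODC B B', IR.isGhobadiRight D.toFODC B B',
    ⟨IL.isStarRelated D B B', IL.isReflexive D B B', IL.starEquiv_compat D B B'⟩,
    IL.starMap_s D, IL.starMap_t D, IL.starMap_vec D, fun a x => ?_, IL.starMap_mat D,
    IL.starMap_inv D, IL.reflection_mat D.toFODC B B', IL.reflection_inv D.toFODC B B',
    fun B₁ y => ?_, fun B₁ x => ?_, fun a b => ?_⟩
  · rw [IL.starEquiv_apply, IL.starMap_mul, IL.starMap_vec, IL.starMap_t]
  · exact (congrArg _ (IL.covec_eq D.toFODC B₁ B y)).trans (IL.reflection_covec D.toFODC B B' y)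
  · exact (IL.reflection_vec D.toFODC B B' x).trans (IR.covec_eq D.toFODC B' B₁ x)
  · rw [IL.reflection_mul, IL.reflection_s, IL.reflection_t, IR.s_comm_t]
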